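/- **Model.** Fix a road of length $L>0$ and width $W>0$, a vehicle width $d>0$ and length $l\ge 0$, a spacing $s_1>0$ of the human-driven vehicles (class 1), and, for the classes $m=1,2$ (class 2: autonomous vehicles), positive free-flow velocities $V_m$, maximum area occupancies $\overline{AO}_m$, exponents $\gamma_m$, relaxation times $\iota_m$ and equilibrium densities $\rho_m^*$. For a spacing $s>0$ of the autonomous vehicles put $$AO^s(\rho_1,\rho_2)=\frac{d(l+s_1)\rho_1+d(l+s)\rho_2}{W},\qquad V^s_{e,m}=V_m\Big(1-\big(AO^s/\overline{AO}_m\big)^{\gamma_m}\Big),$$ $v_m^s=V^s_{e,m}(\rho_1^*,\rho_2^*)$ and $\beta^s_{mn}=-\partial_{\rho_n}V^s_{e,m}(\rho_1^*,\rho_2^*)$, and $$J_\lambda^s=\begin{bmatrix} v_1^s&\rho_1^*&0&0\\ 0&v_1^s-\beta_{11}^s\rho_1^*&\beta_{12}^s(v_1^s-v_2^s)&-\beta_{12}^s\rho_2^*\\ 0&0&v_2^s&\rho_2^*\\ \beta_{21}^s(v_2^s-v_1^s)&-\beta_{21}^s\rho_1^*&0&v_2^s-\beta_{22}^s\rho_2^*\end{bmatrix},\quad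 J_s=\begin{bmatrix}0&0&0&0\\ -\frac{\beta_{11}^s}{\iota_1}&-\frac1{\iota_1}&-\frac{\beta_{12}^s}{\iota_1}&0\\ 0&0&0&0\\ -\frac{\beta_{21}^s}{\iota_2}&0&-\frac{\beta_{22}^s}{\iota_2}&-\frac1{\iota_2}\end{bmatrix},$$ $$A_s=\begin{bmatrix}1&0&0&0\\0&0&1&0\\ v_1^s&\rho_1^*&v_2^s&\rho_2^*\end{bmatrix},\qquad b_s=\begin{bmatrix}v_1^s&\rho_1^*&v_2^s&\rho_2^*\end{bmatrix}.$$ Let $\lambda_1^s=v_1^s$, $\lambda_2^s=v_2^s$, $\lambda_{3}^s,\lambda_4^s=\frac12\big(v_1^s+v_2^s-\beta_{11}^s\rho_1^*-\beta_{22}^s\rho_2^*\pm\Delta_s\big)$ with $\Delta_s=\sqrt{(\beta_{22}^s\rho_2^*-\beta_{11}^s\rho_1^*+v_1^s-v_2^s)^2+4\beta_{12}^s\beta_{21}^s\rho_1^*\rho_2^*}$ be the eigenvalues of $J^s_\lambda$. **Markov chain.** Let $0<s_2^1<\dots<s_2^r$, and let $s_2(t)$, $t\ge0$, be a Markov process on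 a probability space with values in $\{s_2^1,\dots,s_2^r\}$, with almost surely right-continuous paths, an arbitrary initial law (in particular any deterministic initial mode), and transition probabilities $P_{ij}(\varrho,t)$ satisfying, for $0\le\varrho<t$, the Kolmogorov forward equations $\partial_tP_{ij}(\varrho,t)=-\sum_k\tau_{jk}(t)\,P_{ij}(\varrho,t)+\sum_kP_{ik}(\varrho,t)\tau_{kj}(t)$ with $P_{ij}(\varrho,\varrho)=\delta_{ij}$, where $P_{ij}(\varrho,\cdot)$ is continuous on $[\varrho,\infty)$, $\tau_{ii}=0$ and $0\le\tau_{ij}(t)\le\tau^\star$ for a constant $\tau^\star$. **Nominal feedback.** Let $s_2^0>0$ be a nominal spacing. For every $i\in\{0,1,\dots,r\}$, with $s=s_2^i$, assume the congested regime $\lambda_1^s,\lambda_2^s,\lambda_3^s>0>\lambda_4^s$, and let $\mathbf V_i$ be an invertible matrix with $\mathbf V_i^{-1}J_\lambda^{s}\mathbf V_i=\mathrm{Diag}(\lambda^s_1,\lambda^s_2,\lambda^s_3,\lambda^s_4)$. Let $\hat J=\mathbf V_0^{-1}J_{s_2^0}\mathbf V_0$, write $e_k(x)=\exp(-\hat J_{kk}x/\lambda_k^{s_2^0})$,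 and set $$\mathbf T_0(x)=\begin{bmatrix}0&e_2(x)&0&0\\0&0&e_3(x)&0\\e_1(x)&0&0&0\\0&0&0&e_4(x)\end{bmatrix}\mathbf V_0^{-1},$$ with $\mathbf T_0^+$ its first three rows. For a constant row $F\in\mathbb R^{1\times3}$ and a piecewise continuous $K:[0,L]\to\mathbb R^{1\times4}$ the nominal control law is $$U(t)=-F\,\mathbf T_0^+(L)\mathbf z(L,t)+\int_0^LK(\xi)\mathbf T_0(\xi)\mathbf z(\xi,t)\,d\xi .$$ Assume that in each mode $s=s_2^i$, $1\le i\le r$, the boundary conditions determine the incoming characteristic components: the $3\times3$ matrix formed by the first three columns of $A_s\mathbf V_i$ is invertible, and $\big(b_s+F\,\mathbf T_0^+(L)\big)\mathbf V_ie_4\ne0$, where $e_4=(0,0,0,1)^{\mathsf T}$. **Claim.** For every $\mathbf z_0\in L^2((0,L);\mathbb R^4)$ the closed-loop system $$\mathbf z_t+J_\lambda^{s_2(t)}\mathbf z_x=J_{s_2(t)}\mathbf z,\qquad A_{s_2(t)}\mathbf z(0,t)=0,\qquad b_{s_2(t)}\mathbf z(L,t)=U(t),\qquad \mathbf z(\cdot,0)=\mathbf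 z_0,$$ has a solution $\mathbf z$, and $\mathbb E\,\|\mathbf z(\cdot,t)\|_{L^2(0,L)}<\infty$ for every $t\ge0$. The solution is unique: any two solutions coincide for all $t\ge0$ almost surely. Here a solution is a random function whose paths are, almost surely, continuous from $[0,\infty)$ to $L^2((0,L);\mathbb R^4)$ and satisfy the system in the weak sense, with boundary traces $\mathbf z(0,\cdot),\mathbf z(L,\cdot)\in L^2_{\mathrm{loc}}([0,\infty);\mathbb R^4)$: Green's formula for the equation holds on $[0,L]\times[0,t]$, for every $t\ge0$, against all $C^1$ test functions, and the boundary conditions hold for almost every time. -/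

import Mathlib

open MeasureTheory Set Filter Topology Matrix

noncomputable section

namespace MixedTraffic

/-- Physical parameters of the two-class (index `0`: human-driven vehicles, index `1`: autonomous
vehicles) extended Aw-Rascle model on a road segment `[0, L]`. -/
structure Params where
  /-- length of the road segment -/
  L : ℝ
  /-- road width -/
  W : ℝ
  /-- vehicle width -/
  d : ℝ
  /-- vehicle length -/
  l : ℝ
  /-- spacing of the human-driven vehicles -/
  s₁ : ℝ
  /-- free-flow velocities -/
  V : Fin 2 → ℝ
  /-- maximum area occupancies -/
  AOmax : Fin 2 → ℝ
  /-- traffic pressure exponents -/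
  γ : Fin 2 → ℝ
  /-- relaxation times -/
  ι : Fin 2 → ℝ
  /-- equilibrium densities -/
  ρ : Fin 2 → ℝ
  L_pos : 0 < L
  W_pos : 0 < W
  d_pos : 0 < d
  l_nonneg : 0 ≤ l
  s₁_pos : 0 < s₁
  V_pos : ∀ m, 0 < V m
  AOmax_pos : ∀ m, 0 < AOmax m
  γ_pos : ∀ m, 0 < γ m
  ι_pos : ∀ m, 0 < ι m
  ρ_pos : ∀ m, 0 < ρ m

/-- Parameters of the nominal feedback law: nominal spacing `s₀`, a diagonalizing change of basis
`B₀` at `s₀`, boundary gain `F`, and integral kernel `K`. -/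
structure Feedback where
  s₀ : ℝ
  B₀ : Matrix (Fin 4) (Fin 4) ℝ
  F : Fin 3 → ℝ
  K : ℝ → Fin 4 → ℝ

namespace Params

variable (p : Params)

/-- Area occupancy at densities `y`, when the spacing of the autonomous vehicles is `s`:
the impact areas are `a₁ = d (l + s₁)` and `a₂ = d (l + s)`. -/
def areaOccupancy (s : ℝ) (y : Fin 2 → ℝ) : ℝ :=
  (p.d * (p.l + p.s₁) * y 0 + p.d * (p.l + s) * y 1) / p.W

/-- Fundamental diagram of class `m` (modified Greenshields). -/
def Ve (m : Fin 2) (s : ℝ) (y : Fin 2 → ℝ) : ℝ :=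
  p.V m * (1 - (p.areaOccupancy s y / p.AOmax m) ^ (p.γ m))

/-- Equilibrium velocity of class `m`. -/
def vEq (m : Fin 2) (s : ℝ) : ℝ := p.Ve m s p.ρ

/-- `β m n s = - ∂ V_{e,m} / ∂ ρ_n` at the equilibrium densities. -/
def β (m n : Fin 2) (s : ℝ) : ℝ :=
  -deriv (fun y : ℝ => p.Ve m s (Function.update p.ρ n y)) (p.ρ n)

/-- Transport matrix of the linearization; the state is `z = (ρ̃₁, ṽ₁, ρ̃₂, ṽ₂)`. -/
def Jlam (s : ℝ) : Matrix (Fin 4) (Fin 4) ℝ :=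
  !![p.vEq 0 s, p.ρ 0, 0, 0;
     0, p.vEq 0 s - p.β 0 0 s * p.ρ 0,
       p.β 0 1 s * (p.vEq 0 s - p.vEq 1 s), -(p.β 0 1 s * p.ρ 1);
     0, 0, p.vEq 1 s, p.ρ 1;
     p.β 1 0 s * (p.vEq 1 s - p.vEq 0 s), -(p.β 1 0 s * p.ρ 0),
       0, p.vEq 1 s - p.β 1 1 s * p.ρ 1]

/-- Source matrix of the linearization. -/
def Jsrc (s : ℝ) : Matrix (Fin 4) (Fin 4) ℝ :=
  !![0, 0, 0, 0;
     -(1 / p.ι 0 * p.β 0 0 s), -(1 / p.ι 0), -(1 / p.ι 0 * p.β 0 1 s), 0;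
     0, 0, 0, 0;
     -(1 / p.ι 1 * p.β 1 0 s), 0, -(1 / p.ι 1 * p.β 1 1 s), -(1 / p.ι 1)]

/-- Boundary matrix at `x = 0`. -/
def inlet (s : ℝ) : Matrix (Fin 3) (Fin 4) ℝ :=
  !![1, 0, 0, 0;
     0, 0, 1, 0;
     p.vEq 0 s, p.ρ 0, p.vEq 1 s, p.ρ 1]

/-- Boundary row vector at `x = L`. -/
def outlet (s : ℝ) : Fin 4 → ℝ :=
  ![p.vEq 0 s, p.ρ 0, p.vEq 1 s, p.ρ 1]

/-- The discriminant root `Δ`. -/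
def Δ (s : ℝ) : ℝ :=
  Real.sqrt ((p.β 1 1 s * p.ρ 1 - p.β 0 0 s * p.ρ 0 + p.vEq 0 s - p.vEq 1 s) ^ 2
    + 4 * (p.β 0 1 s * p.β 1 0 s * p.ρ 0 * p.ρ 1))

/-- The characteristic velocities `(λ₁, λ₂, λ₃, λ₄)`. -/
def lam (s : ℝ) : Fin 4 → ℝ :=
  ![p.vEq 0 s,
    p.vEq 1 s,
    (p.vEq 0 s + p.vEq 1 s - p.β 0 0 s * p.ρ 0 - p.β 1 1 s * p.ρ 1 + p.Δ s) / 2,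
    (p.vEq 0 s + p.vEq 1 s - p.β 0 0 s * p.ρ 0 - p.β 1 1 s * p.ρ 1 - p.Δ s) / 2]

/-- Congested regime at spacing `s`: `λ₁, λ₂, λ₃ > 0 > λ₄`. -/
def Congested (s : ℝ) : Prop :=
  0 < p.lam s 0 ∧ 0 < p.lam s 1 ∧ 0 < p.lam s 2 ∧ p.lam s 3 < 0

/-- `B` is a change of basis with `B⁻¹ J_λ B = diag (λ₁, λ₂, λ₃, λ₄)`. -/
def Diagonalizes (s : ℝ) (B : Matrix (Fin 4) (Fin 4) ℝ) : Prop :=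
  IsUnit B.det ∧ B⁻¹ * p.Jlam s * B = Matrix.diagonal (p.lam s)

/-- The source matrix in the basis `B`. -/
def Jhat (s : ℝ) (B : Matrix (Fin 4) (Fin 4) ℝ) : Matrix (Fin 4) (Fin 4) ℝ :=
  B⁻¹ * p.Jsrc s * B

/-- The (`x`-dependent) matrix `𝐓` mapping the state `z` to Riemann coordinates
`w = (w₁, w₂, w₃, w₄)`. -/
def T (s : ℝ) (B : Matrix (Fin 4) (Fin 4) ℝ) (x : ℝ) : Matrix (Fin 4) (Fin 4) ℝ :=
  !![0, Real.exp (-(p.Jhat s B 1 1 / p.lam s 1) * x), 0, 0;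
     0, 0, Real.exp (-(p.Jhat s B 2 2 / p.lam s 2) * x), 0;
     Real.exp (-(p.Jhat s B 0 0 / p.lam s 0) * x), 0, 0, 0;
     0, 0, 0, Real.exp (-(p.Jhat s B 3 3 / p.lam s 3) * x)] * B⁻¹

/-- The first three rows `𝐓⁺` of `𝐓`. -/
def Tplus (s : ℝ) (B : Matrix (Fin 4) (Fin 4) ℝ) (x : ℝ) : Matrix (Fin 3) (Fin 4) ℝ :=
  fun k j => p.T s B x k.castSucc j

/-- The state space `L²((0, L); ℝ⁴)`. -/
abbrev State : Type :=
  Lp (EuclideanSpace ℝ (Fin 4)) 2 (volume.restrict (Ioo 0 p.L))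

/-- Pointwise values of (a representative of) an `L²` state, as a plain vector. -/
def val (z : p.State) (x : ℝ) : Fin 4 → ℝ := fun j => z x j

/-- The control `U = -F (𝐓₀⁺ z)(L) + ∫₀ᴸ K(ξ) (𝐓₀ z)(ξ) dξ`, for an `L²` state `z` whose trace at
`x = L` is `zL`. -/
def control (c : Feedback) (z : p.State) (zL : Fin 4 → ℝ) : ℝ :=
  -(c.F ⬝ᵥ (p.Tplus c.s₀ c.B₀ p.L *ᵥ zL))
    + ∫ ξ in Ioo 0 p.L, c.K ξ ⬝ᵥ (p.T c.s₀ c.B₀ ξ *ᵥ p.val z ξ)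

/-- The terms of the weak formulation at time `t` inside the domain, in the mode with spacing `s`:
`∫₀ᴸ (φ_t · z + φ_x · J_λ z + φ · J z) dx`, where `φ` is a test function of `(t, x)`. -/
def weakInterior (s : ℝ) (φ : ℝ → ℝ → Fin 4 → ℝ) (t : ℝ) (z : p.State) : ℝ :=
  ∫ x in Ioo 0 p.L,
    (deriv (fun τ => φ τ x) t ⬝ᵥ p.val z x
      + deriv (fun y => φ t y) x ⬝ᵥ (p.Jlam s *ᵥ p.val z x)
      + φ t x ⬝ᵥ (p.Jsrc s *ᵥ p.val z x))

/-- `z : [0, ∞) → L²((0, L); ℝ⁴)` is an `L²` solution, for the initial condition `z₀` and the path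
`σ` of the spacing, of the linearized closed-loop system
`z_t + J_λ^σ z_x = J_σ z`, `inlet_σ z(0, t) = 0`, `outlet_σ · z(L, t) = U(t)`:
it is continuous in time with values in `L²`, and it has boundary traces `h₀ = z(0, ·)`,
`hL = z(L, ·)` in `L²_loc` which satisfy the boundary conditions for almost every time and with
which the equation holds in the weak sense (Green's formula against all `C¹` test functions). -/
def IsL2Solution (c : Feedback) (σ : ℝ → ℝ) (z₀ : p.State) (z : ℝ → p.State) : Prop :=
  ContinuousOn z (Ici 0) ∧ z 0 = z₀ ∧
  ∃ h₀ hL : ℝ → Fin 4 → ℝ,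
    (∀ t : ℝ, MemLp h₀ 2 (volume.restrict (Ioc 0 t)) ∧
      MemLp hL 2 (volume.restrict (Ioc 0 t))) ∧
    (∀ᵐ t ∂(volume.restrict (Ioi (0 : ℝ))),
      p.inlet (σ t) *ᵥ h₀ t = 0 ∧
      p.outlet (σ t) ⬝ᵥ hL t = p.control c (z t) (hL t)) ∧
    ∀ φ : ℝ → ℝ → Fin 4 → ℝ, ContDiff ℝ 1 (fun q : ℝ × ℝ => φ q.1 q.2) →
      ∀ t : ℝ, 0 ≤ t →
        (∫ x in Ioo 0 p.L, φ t x ⬝ᵥ p.val (z t) x) - (∫ x in Ioo 0 p.L, φ 0 x ⬝ᵥ p.val z₀ x)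
          = (∫ τ in Ioc 0 t, p.weakInterior (σ τ) φ τ (z τ))
            - ∫ τ in Ioc 0 t, (φ τ p.L ⬝ᵥ (p.Jlam (σ τ) *ᵥ hL τ)
                - φ τ 0 ⬝ᵥ (p.Jlam (σ τ) *ᵥ h₀ τ))

/-- The boundary conditions at spacing `s` determine the incoming characteristic components (`B` is
the eigenvector matrix there). At `x = 0`: the `3 × 3` matrix of the boundary condition acting on
the three right-going components is invertible. At `x = L`: the coefficient of the left-going
component in the closed-loop boundary condition is nonzero. -/
def BoundarySolvable (c : Feedback) (s : ℝ) (B : Matrix (Fin 4) (Fin 4) ℝ) : Prop :=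
  IsUnit ((p.inlet s * B).submatrix id (Fin.castSucc : Fin 3 → Fin 4)).det ∧
  p.outlet s ⬝ᵥ B.col 3 + c.F ⬝ᵥ (p.Tplus c.s₀ c.B₀ p.L *ᵥ B.col 3) ≠ 0

end Params

/-- Piecewise continuity on `[a, b]`: continuous off a finite set, with finite one-sided limits
everywhere. -/
def PiecewiseContinuousOn {E : Type*} [TopologicalSpace E] (f : ℝ → E) (a b : ℝ) : Prop :=
  (∃ D : Finset ℝ, ∀ x ∈ Icc a b, x ∉ D → ContinuousWithinAt f (Icc a b) x) ∧
  ∀ x ∈ Icc a b, (∃ y, Tendsto f (𝓝[Ioo a x] x) (𝓝 y)) ∧ (∃ y, Tendsto f (𝓝[Ioo x b] x) (𝓝 y))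

/-- `τ` is a family of nonnegative transition rates with zero diagonal bounded by `τmax`, and `P` is
a family of transition probabilities (`P i j ϱ t`: from `i` at time `ϱ` to `j` at time `t`)
satisfying the Kolmogorov forward equations for the rates `τ`. -/
structure IsTransitionFamily {r : ℕ} (τ : Fin r → Fin r → ℝ → ℝ) (τmax : ℝ)
    (P : Fin r → Fin r → ℝ → ℝ → ℝ) : Prop where
  rate_nonneg : ∀ i j t, 0 ≤ t → 0 ≤ τ i j t
  rate_diag : ∀ i t, 0 ≤ t → τ i i t = 0
  rate_le : ∀ i j t, 0 ≤ t → τ i j t ≤ τmax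
  prob_mem : ∀ i j ϱ t, 0 ≤ ϱ → ϱ ≤ t → P i j ϱ t ∈ Icc (0 : ℝ) 1
  prob_sum : ∀ i ϱ t, 0 ≤ ϱ → ϱ ≤ t → ∑ j, P i j ϱ t = 1
  prob_self : ∀ i j ϱ, 0 ≤ ϱ → P i j ϱ ϱ = if i = j then 1 else 0
  prob_cont : ∀ i j ϱ, 0 ≤ ϱ → ContinuousOn (P i j ϱ) (Ici ϱ)
  forward : ∀ i j ϱ t, 0 ≤ ϱ → ϱ < t →
    HasDerivAt (P i j ϱ) (-(∑ k, τ j k t) * P i j ϱ t + ∑ k, P i k ϱ t * τ k j t) t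

/-- `X` (time `t ≥ 0`) is a Markov process with values in the modes `Fin r`, with transition
probabilities `P` and an arbitrary initial law, almost all of whose paths are right-continuous. -/
structure IsMarkovChain {Ω : Type*} [MeasurableSpace Ω] (μ : Measure Ω) {r : ℕ}
    (P : Fin r → Fin r → ℝ → ℝ → ℝ) (X : ℝ → Ω → Fin r) : Prop where
  measurable : ∀ t, 0 ≤ t → Measurable (X t)
  markov : ∀ (n : ℕ) (t : Fin (n + 1) → ℝ) (i : Fin (n + 1) → Fin r), 0 ≤ t 0 → Monotone t →
    μ.real {ω | ∀ k, X (t k) ω = i k} =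
      μ.real {ω | X (t 0) ω = i 0} *
        ∏ k : Fin n, P (i k.castSucc) (i k.succ) (t k.castSucc) (t k.succ)
  rightCont : ∀ᵐ ω ∂μ, ∀ t, 0 ≤ t → ∀ᶠ u in 𝓝[≥] t, X u ω = X t ω

end MixedTraffic

end

/-! In a fixed mode the closed loop is a linear hyperbolic boundary value problem with constant
coefficients. In Riemann coordinates the squared norm is weighted by `exp (θ x)` on the three
right-going components and by `exp (θ (L - x))` on the left-going one. At either end the outgoing
components then carry the weight `exp (θ L)` and the incoming ones the weight 1. Boundary
solvability bounds the incoming components by the outgoing ones and the integral term of the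
control, so for large `θ` the boundary contributes a strictly negative multiple of both traces, up
to a multiple of the squared state norm (`boundary_form_le`, `exists_diagonal_bvp`). The source, the
integral term and the slope of the weights cost only an exponential growth rate.

This energy estimate drives the theory of a single mode. It makes the shifted generator
m-dissipative, so the Hille–Yosida theorem gives evolution operators. It also bounds the traces in
L² of time by the initial state, so weak solutions with traces exist for all L² data, by density. A
weak solution starting from zero vanishes, because its time integral lies in the domain of the
generator, where the energy estimate applies (`IsWeakSolutionOn.eq_zero`).

Along a right-continuous path with left limits only finitely many switches occur in bounded time,
and the solutions of the modes are concatenated (`path_induction`). The norms adapted to the modes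
are equivalent with one constant `C`, so each switch costs a factor `C` and the solution at time t
is bounded by a constant times `exp (ω t) * C ^ N`, with `N` the number of switches. Bounded rates
give `N` exponential moments, hence the finite expectation.

Left limits of the paths are not assumed. They follow from the same moment bound: on grids of
vanishing step the expected weights are uniformly bounded, and Fatou's lemma excludes oscillation
(`ae_hasLeftLimits`). Freezing the mode on such grids also yields approximations that depend on
finitely many values of the chain; their limit is the solution, which gives measurability and, by
Fatou again, the bound on the mean. -/

namespace MixedTraffic

open scoped RealInnerProductSpace

/-! ### The Hille–Yosida theorem for linear relations. -/

section HilleYosida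

variable {H : Type*} [NormedAddCommGroup H] [NormedSpace ℝ H]

/-- A linear relation on `H` is `m`-dissipative if it is dissipative and `μ - A` is onto for every
`μ > 0`. -/
structure IsMDissipative (G : Submodule ℝ (H × H)) : Prop where
  dissipative : ∀ q ∈ G, ∀ μ : ℝ, 0 < μ → μ * ‖q.1‖ ≤ ‖μ • q.1 - q.2‖
  range : ∀ μ : ℝ, 0 < μ → ∀ f : H, ∃ q ∈ G, μ • q.1 - q.2 = f

namespace IsMDissipative

variable {G : Submodule ℝ (H × H)}

/-- Dissipativity at `μ` makes the first component of a solution unique. Linearity of the resolvent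
is this uniqueness, and its norm bound is dissipativity itself. -/
theorem exists_resolvent (hG : IsMDissipative G) {μ : ℝ} (hμ : 0 < μ) :
    ∃ R : H →L[ℝ] H, (∀ f, (R f, μ • R f - f) ∈ G) ∧ (∀ q ∈ G, R (μ • q.1 - q.2) = q.1) ∧
      ∀ f, μ * ‖R f‖ ≤ ‖f‖ := by
  choose q hq hqf using hG.range μ hμ
  have huniq : ∀ a ∈ G, ∀ b ∈ G, μ • a.1 - a.2 = μ • b.1 - b.2 → a.1 = b.1 := by
    intro a ha b hb hab
    have h := hG.dissipative (a - b) (G.sub_mem ha hb) μ hμ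
    have h0 : μ • (a - b).1 - (a - b).2 = 0 := by
      rw [Prod.fst_sub, Prod.snd_sub, smul_sub]
      rw [← sub_eq_zero] at hab
      rw [← hab]; abel
    rw [h0, norm_zero] at h
    have : ‖(a - b).1‖ ≤ 0 := by
      by_contra hc
      push Not at hc
      have := mul_pos hμ hc
      linarith
    rw [Prod.fst_sub] at this
    exact sub_eq_zero.mp (norm_le_zero_iff.mp this)
  let R₀ : H →ₗ[ℝ] H :=
    { toFun := fun f => (q f).1
      map_add' := fun f g => by
        refine huniq _ (hq _) (q f + q g) (G.add_mem (hq f) (hq g)) ?_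
        rw [hqf, Prod.fst_add, Prod.snd_add, smul_add, add_sub_add_comm, hqf, hqf]
      map_smul' := fun r f => by
        refine huniq _ (hq _) (r • q f) (G.smul_mem r (hq f)) ?_
        rw [hqf, Prod.smul_fst, Prod.smul_snd, smul_comm, ← smul_sub, hqf] }
  have hb : ∀ f, μ * ‖R₀ f‖ ≤ ‖f‖ := fun f => by
    have := hG.dissipative _ (hq f) μ hμ
    rwa [hqf] at this
  refine ⟨R₀.mkContinuous μ⁻¹ fun f => ?_, fun f => ?_, fun a ha => ?_, hb⟩
  · rw [inv_mul_eq_div, le_div_iff₀ hμ, mul_comm]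
    exact hb f
  · have : (R₀ f, μ • R₀ f - f) = q f := by
      refine Prod.ext rfl ?_
      change μ • (q f).1 - f = (q f).2
      nth_rewrite 2 [← hqf f]
      abel
    rw [LinearMap.mkContinuous_apply, this]
    exact hq f
  · exact huniq _ (hq _) a ha (hqf _)

end IsMDissipative

/-- The exponential `exp (t A)` of a bounded operator, applied to a vector, is differentiable. -/
theorem hasDerivAt_exp_smul_apply [CompleteSpace H] (A : H →L[ℝ] H) (u : H) (t : ℝ) :
    HasDerivAt (fun t : ℝ => NormedSpace.exp (t • A) u) (NormedSpace.exp (t • A) (A u)) t := by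
  have h := hasDerivAt_exp_smul_const (𝕂 := ℝ) A t
  simpa using h.clm_apply (hasDerivAt_const t u)

theorem exp_apply_comm [CompleteSpace H] {A B : H →L[ℝ] H} (h : Commute A B) (u : H) :
    NormedSpace.exp A (B u) = B (NormedSpace.exp A u) := by
  have := (h.exp_left (𝔸 := H →L[ℝ] H)).eq
  exact congrArg (fun T : H →L[ℝ] H => T u) this

/-- Two commuting bounded operators generating contractions: their exponentials differ by at most
the difference of the generators. -/
theorem norm_exp_sub_exp_le [CompleteSpace H] {A B : H →L[ℝ] H} (h : Commute A B)
    (hA : ∀ t : ℝ, 0 ≤ t → ∀ u, ‖NormedSpace.exp (t • A) u‖ ≤ ‖u‖)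
    (hB : ∀ t : ℝ, 0 ≤ t → ∀ u, ‖NormedSpace.exp (t • B) u‖ ≤ ‖u‖) {t : ℝ} (ht : 0 ≤ t) (u : H) :
    ‖NormedSpace.exp (t • A) u - NormedSpace.exp (t • B) u‖ ≤ t * ‖A u - B u‖ := by
  -- The curve `exp (x A) exp ((t - x) B) u` joins the two exponentials. On `[0, t]` its derivative
  -- is a product of two contractions applied to `A u - B u`.
  have hd : ∀ x : ℝ, HasDerivAt
      (fun x : ℝ => NormedSpace.exp (x • A) (NormedSpace.exp ((t - x) • B) u))
      (NormedSpace.exp (x • A) (NormedSpace.exp ((t - x) • B) (A u - B u))) x := by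
    intro x
    have h1 := hasDerivAt_exp_smul_const (𝕂 := ℝ) A x
    have h2 : HasDerivAt (fun x : ℝ => NormedSpace.exp ((t - x) • B) u)
        (-(NormedSpace.exp ((t - x) • B) (B u))) x := by
      have := (hasDerivAt_exp_smul_apply B u (t - x)).scomp x ((hasDerivAt_id x).const_sub t)
      simpa [Function.comp_def] using this
    have h3 := h1.clm_apply h2
    convert h3 using 1
    have hc : Commute ((t - x) • B) A := (h.symm).smul_left _
    have := exp_apply_comm hc u
    rw [map_sub, map_sub, this]
    simp [sub_eq_add_neg]
  have hm := norm_image_sub_le_of_norm_deriv_le_segment_01' (E := H)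
    (f := fun y : ℝ => NormedSpace.exp ((t * y) • A) (NormedSpace.exp ((t - t * y) • B) u))
    (f' := fun y => t • (NormedSpace.exp ((t * y) • A)
      (NormedSpace.exp ((t - t * y) • B) (A u - B u))))
    (C := t * ‖A u - B u‖) ?_ ?_
  · simpa [NormedSpace.exp_zero] using hm
  · intro y _
    have h5 : HasDerivAt (fun y : ℝ => t * y) t y := by simpa using (hasDerivAt_id y).const_mul t
    have := (hd (t * y)).scomp y h5
    exact this.hasDerivWithinAt
  · intro y hy
    rw [norm_smul, Real.norm_of_nonneg ht]
    have h0 : 0 ≤ t * y := mul_nonneg ht hy.1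
    have h1 : 0 ≤ t - t * y := by nlinarith [hy.2]
    exact mul_le_mul_of_nonneg_left ((hA _ h0 _).trans (hB _ h1 _)) ht

theorem norm_exp_apply_le [CompleteSpace H] (A : H →L[ℝ] H) (u : H) :
    ‖NormedSpace.exp A u‖ ≤ Real.exp ‖A‖ * ‖u‖ := by
  -- At exponent zero only `‖1‖ ≤ 1` can be used, since `H` may be trivial.
  have hpow : ∀ n : ℕ, ‖A ^ n‖ ≤ ‖A‖ ^ n := by
    intro n
    induction n with
    | zero => rw [pow_zero, pow_zero]; exact ContinuousLinearMap.norm_id_le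
    | succ k ih =>
      rw [pow_succ, pow_succ]
      exact (norm_mul_le _ _).trans (by gcongr)
  have h1 : ‖NormedSpace.exp A‖ ≤ Real.exp ‖A‖ := by
    have hs := NormedSpace.expSeries_div_hasSum_exp (𝔸 := ℝ) ‖A‖
    rw [← Real.exp_eq_exp_ℝ] at hs
    rw [NormedSpace.exp_eq_tsum ℝ]
    refine tsum_of_norm_bounded hs fun n => ?_
    rw [norm_smul, norm_inv, RCLike.norm_natCast, inv_mul_eq_div]
    gcongr
    exact hpow n
  exact (ContinuousLinearMap.le_opNorm _ _).trans (by gcongr)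

/-- The scalar part contributes exactly `exp (-t μ)`, and the remaining exponential is at most `exp
(t μ² ‖R‖) ≤ exp (t μ)`. -/
theorem norm_exp_smul_le_of_resolvent [CompleteSpace H] {R : H →L[ℝ] H} {μ : ℝ} (hμ : 0 < μ)
    (hR : ∀ f, μ * ‖R f‖ ≤ ‖f‖) {t : ℝ} (ht : 0 ≤ t) (u : H) :
    ‖NormedSpace.exp (t • (μ ^ 2 • R - μ • ContinuousLinearMap.id ℝ H)) u‖ ≤ ‖u‖ := by
  have hRn : ‖R‖ ≤ μ⁻¹ := R.opNorm_le_bound (inv_nonneg.mpr hμ.le) fun f => by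
    rw [inv_mul_eq_div, le_div_iff₀ hμ, mul_comm]; exact hR f
  have hsplit : t • (μ ^ 2 • R - μ • ContinuousLinearMap.id ℝ H)
      = algebraMap ℝ (H →L[ℝ] H) (-(t * μ)) + (t * μ ^ 2) • R := by
    ext v
    simp [Algebra.algebraMap_eq_smul_one, smul_sub, smul_smul]
    abel
  let _ : NormedAlgebra ℚ (H →L[ℝ] H) := NormedAlgebra.restrictScalars ℚ ℝ _
  rw [hsplit, NormedSpace.exp_add_of_commute (Algebra.commutes _ _),
    ← NormedSpace.algebraMap_exp_comm, mul_apply_eq_comp,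
    Algebra.algebraMap_eq_smul_one, _root_.smul_apply, one_apply_eq_self,
    norm_smul, ← Real.exp_eq_exp_ℝ, Real.norm_of_nonneg (Real.exp_pos _).le]
  have hexp : ‖(t * μ ^ 2) • R‖ ≤ t * μ := by
    rw [norm_smul, Real.norm_of_nonneg (by positivity)]
    calc t * μ ^ 2 * ‖R‖ ≤ t * μ ^ 2 * μ⁻¹ := by gcongr
      _ = t * μ := by field_simp
  calc Real.exp (-(t * μ)) * ‖NormedSpace.exp ((t * μ ^ 2) • R) u‖
      ≤ Real.exp (-(t * μ)) * (Real.exp (t * μ) * ‖u‖) := by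
        gcongr
        exact (norm_exp_apply_le _ _).trans (by gcongr)
    _ = ‖u‖ := by rw [← mul_assoc, ← Real.exp_add]; simp

/-- Uniformly nonexpansive operators which converge on a dense set converge everywhere. -/
theorem cauchySeq_apply_of_dense {D : Set H} (hD : Dense D) (B : ℕ → H →L[ℝ] H)
    (hB : ∀ n u, ‖B n u‖ ≤ ‖u‖) (hc : ∀ u ∈ D, CauchySeq fun n => B n u) (f : H) :
    CauchySeq fun n => B n f := by
  rw [Metric.cauchySeq_iff]
  intro ε hε
  obtain ⟨u, huD, hu⟩ := hD.exists_dist_lt f (show (0 : ℝ) < ε / 3 by positivity)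
  obtain ⟨N, hN⟩ := Metric.cauchySeq_iff.mp (hc u huD) (ε / 3) (by positivity)
  refine ⟨N, fun m hm n hn => ?_⟩
  have h1 : ∀ k, dist (B k f) (B k u) ≤ dist f u := fun k => by
    rw [dist_eq_norm, dist_eq_norm, ← map_sub]; exact hB k _
  calc dist (B m f) (B n f) ≤ dist (B m f) (B m u) + dist (B m u) (B n u) + dist (B n u) (B n f) :=
        dist_triangle4 _ _ _ _
    _ < ε / 3 + ε / 3 + ε / 3 := by
        have := h1 m
        have h2 := h1 n
        rw [dist_comm] at h2
        linarith [hN m hm n hn]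
    _ = ε := by ring

theorem tendsto_apply_of_dense {D : Set H} (hD : Dense D) (B : ℕ → H →L[ℝ] H) (B' : H →L[ℝ] H)
    (hB : ∀ n u, ‖B n u‖ ≤ ‖u‖) (hB' : ∀ u, ‖B' u‖ ≤ ‖u‖)
    (hc : ∀ u ∈ D, Tendsto (fun n => B n u) atTop (𝓝 (B' u))) (f : H) :
    Tendsto (fun n => B n f) atTop (𝓝 (B' f)) := by
  rw [Metric.tendsto_atTop]
  intro ε hε
  obtain ⟨u, huD, hu⟩ := hD.exists_dist_lt f (show (0 : ℝ) < ε / 3 by positivity)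
  obtain ⟨N, hN⟩ := Metric.tendsto_atTop.mp (hc u huD) (ε / 3) (by positivity)
  refine ⟨N, fun m hm => ?_⟩
  have h1 : dist (B m f) (B m u) ≤ dist f u := by
    rw [dist_eq_norm, dist_eq_norm, ← map_sub]; exact hB m _
  have h2 : dist (B' u) (B' f) ≤ dist f u := by
    rw [dist_comm, dist_eq_norm, dist_eq_norm, ← map_sub]; exact hB' _
  calc dist (B m f) (B' f) ≤ dist (B m f) (B m u) + dist (B m u) (B' u) + dist (B' u) (B' f) :=
        dist_triangle4 _ _ _ _
    _ < ε / 3 + ε / 3 + ε / 3 := by linarith [hN m hm]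
    _ = ε := by ring

/-- Yosida approximation with parameter μ = n + 1 and `A n = μ² R n - μ`. On a pair `(u, v)` of the
relation, `A n u = μ R n v`, and `μ R n` tends strongly to the identity because `μ R n u - u = R n
v` is of order 1/μ on the domain. The operator `R` is the resolvent at 1; it is kept in order to
recover membership in the relation after passing to the limit. -/
theorem IsMDissipative.exists_yosida [CompleteSpace H] {G : Submodule ℝ (H × H)}
    (hG : IsMDissipative G) (hD : Dense {u : H | ∃ v, (u, v) ∈ G}) :
    ∃ (A : ℕ → H →L[ℝ] H) (R : H →L[ℝ] H),
      (∀ (n : ℕ) (t : ℝ) u, 0 ≤ t → ‖NormedSpace.exp (t • A n) u‖ ≤ ‖u‖) ∧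
      (∀ m n, Commute (A m) (A n)) ∧ (∀ n, Commute (A n) R) ∧
      (∀ q ∈ G, ∀ n, ‖A n q.1‖ ≤ ‖q.2‖) ∧
      (∀ q ∈ G, Tendsto (fun n => A n q.1) atTop (𝓝 q.2)) ∧
      (∀ f, (R f, R f - f) ∈ G) ∧ ∀ q ∈ G, R (q.1 - q.2) = q.1 := by
  have hpos : ∀ n : ℕ, (0 : ℝ) < n + 1 := fun n => by positivity
  choose R hRmem hRinv hRb using fun n : ℕ => hG.exists_resolvent (hpos n)
  have hcomm : ∀ m n, Commute (R m) (R n) := by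
    intro m n
    -- Resolvent identity; for `m ≠ n` it expresses both products by the difference of the
    -- resolvents, so they commute.
    have hres : ∀ m n : ℕ, ∀ f, R n f - R m f = ((m : ℝ) - n) • R m (R n f) := by
      intro m n f
      have h1 := G.sub_mem (hRmem n f) (hRmem m f)
      have h2 := hRinv m _ h1
      rw [Prod.fst_sub, Prod.snd_sub] at h2
      dsimp only at h2
      rw [← map_smul]
      refine h2.symm.trans (congrArg _ ?_)
      module
    rcases eq_or_ne m n with rfl | hmn
    · exact Commute.refl _
    · ext f
      have h1 := hres m n f
      have h2 := hres n m f
      have h3 : ((m : ℝ) - n) • R m (R n f) = ((m : ℝ) - n) • R n (R m f) := by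
        rw [← h1, ← neg_sub (n : ℝ) m, neg_smul, ← h2]; abel
      have h4 : ((m : ℝ) - n) ≠ 0 := sub_ne_zero.mpr (by exact_mod_cast hmn)
      exact smul_right_injective H h4 h3
  let A : ℕ → H →L[ℝ] H := fun n =>
    ((n : ℝ) + 1) ^ 2 • R n - ((n : ℝ) + 1) • ContinuousLinearMap.id ℝ H
  have hAR : ∀ m n, Commute (A m) (R n) := fun m n =>
    ((hcomm m n).smul_left _).sub_left ((Commute.one_left (R n)).smul_left _)
  have hμR : ∀ (n : ℕ) f, ‖((n : ℝ) + 1) • R n f‖ ≤ ‖f‖ := fun n f => by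
    rw [norm_smul, Real.norm_of_nonneg (hpos n).le]; exact hRb n f
  have hAq : ∀ q ∈ G, ∀ n, A n q.1 = ((n : ℝ) + 1) • R n q.2 := by
    intro q hq n
    have h := hRinv n q hq
    rw [map_sub, map_smul] at h
    change ((n : ℝ) + 1) ^ 2 • R n q.1 - ((n : ℝ) + 1) • q.1 = _
    nth_rewrite 2 [← h]
    module
  have hlim : ∀ f, Tendsto (fun n : ℕ => ((n : ℝ) + 1) • R n f) atTop (𝓝 f) := by
    refine fun f => tendsto_apply_of_dense hD (fun n : ℕ => ((n : ℝ) + 1) • R n)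
      (ContinuousLinearMap.id ℝ H) hμR (fun u => le_rfl) (fun u hu => ?_) f
    obtain ⟨v, hv⟩ := hu
    rw [tendsto_iff_norm_sub_tendsto_zero]
    refine squeeze_zero (g := fun n : ℕ => ‖v‖ * (1 / ((n : ℝ) + 1))) (fun _ => norm_nonneg _)
      (fun n => ?_) (by simpa using tendsto_one_div_add_atTop_nhds_zero_nat.const_mul ‖v‖)
    have h := hRinv n _ hv
    rw [map_sub, map_smul] at h
    have h' : ((n : ℝ) + 1) • R n u - u = R n v := by
      rw [sub_eq_iff_eq_add, ← sub_eq_iff_eq_add']; exact h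
    change ‖((n : ℝ) + 1) • R n u - u‖ ≤ _
    rw [h', mul_one_div, le_div_iff₀ (hpos n), mul_comm]
    exact hRb n v
  refine ⟨A, R 0, fun n t u ht => norm_exp_smul_le_of_resolvent (hpos n) (hRb n) ht u, ?_,
    fun n => hAR n 0, fun q hq n => ?_, fun q hq => ?_, fun f => ?_, fun q hq => ?_⟩
  · exact fun m n => ((hAR m n).smul_right _).sub_right ((Commute.one_right (A m)).smul_right _)
  · rw [hAq q hq]; exact hμR n _
  · simp only [hAq q hq]; exact hlim _
  · simpa using hRmem 0 f
  · simpa using hRinv 0 q hq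

/-- A strongly continuous contraction semigroup. -/
structure IsContractionSemigroup (S : ℝ → H →L[ℝ] H) : Prop where
  zero : ∀ u, S 0 u = u
  add : ∀ a b, 0 ≤ a → 0 ≤ b → ∀ u, S (a + b) u = S a (S b u)
  norm_le : ∀ t, 0 ≤ t → ∀ u, ‖S t u‖ ≤ ‖u‖
  cont : ∀ u, ContinuousOn (fun t => S t u) (Ici 0)

/-- **Hille-Yosida theorem**: a densely defined `m`-dissipative operator generates a contraction
semigroup. -/
theorem IsMDissipative.exists_semigroup [CompleteSpace H] {G : Submodule ℝ (H × H)}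
    (hG : IsMDissipative G) (hD : Dense {u : H | ∃ v, (u, v) ∈ G}) :
    ∃ S : ℝ → H →L[ℝ] H, IsContractionSemigroup S ∧ ∀ q ∈ G, ∀ t, 0 ≤ t →
      (S t q.1, S t q.2) ∈ G ∧ HasDerivWithinAt (fun t => S t q.1) (S t q.2) (Ici 0) t := by
  obtain ⟨A, R, hA, hAA, hAR, hAle, hAlim, hRmem, hRinv⟩ := hG.exists_yosida hD
  -- On the domain the approximate semigroups differ by at most `t ‖A m u - A n u‖`; contractivity
  -- extends the convergence to all vectors.
  have hcau : ∀ t : ℝ, 0 ≤ t → ∀ f, CauchySeq fun n => NormedSpace.exp (t • A n) f := by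
    intro t ht
    refine cauchySeq_apply_of_dense hD _ (fun n u => hA n t u ht) fun u ⟨v, hv⟩ => ?_
    have hc := (hAlim _ hv).cauchySeq
    rw [Metric.cauchySeq_iff] at hc ⊢
    intro ε hε
    obtain ⟨N, hN⟩ := hc (ε / (t + 1)) (by positivity)
    refine ⟨N, fun m hm n hn => ?_⟩
    rw [dist_eq_norm]
    refine (norm_exp_sub_exp_le (hAA m n) (fun t ht u => hA m t u ht) (fun t ht u => hA n t u ht)
      ht u).trans_lt ?_
    have := hN m hm n hn
    rw [dist_eq_norm, lt_div_iff₀ (by positivity)] at this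
    nlinarith [norm_nonneg (A m u - A n u)]
  have hex : ∀ t : ℝ, ∃ T : H →L[ℝ] H, 0 ≤ t →
      ∀ f, Tendsto (fun n => NormedSpace.exp (t • A n) f) atTop (𝓝 (T f)) := by
    intro t
    by_cases ht : 0 ≤ t
    · choose T hT using fun f => cauchySeq_tendsto_of_complete (hcau t ht f)
      let T₀ : H →ₗ[ℝ] H :=
        { toFun := T
          map_add' := fun f g => tendsto_nhds_unique (hT (f + g))
            (by simpa using (hT f).add (hT g))
          map_smul' := fun r f => tendsto_nhds_unique (hT (r • f))
            (by simpa using (hT f).const_smul r) }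
      exact ⟨T₀.mkContinuous 1 fun f => by
        rw [one_mul]; exact le_of_tendsto' (hT f).norm fun n => hA n t f ht, fun _ => hT⟩
    · exact ⟨0, fun h => absurd h ht⟩
  choose S hS using hex
  have hSn : ∀ t, 0 ≤ t → ∀ u, ‖S t u‖ ≤ ‖u‖ := fun t ht u =>
    le_of_tendsto' (hS t ht u).norm fun n => hA n t u ht
  have hSint : ∀ q ∈ G, ∀ a b, 0 ≤ a → 0 ≤ b → ‖S b q.1 - S a q.1‖ ≤ ‖q.2‖ * |b - a| := by
    intro q hq a b ha hb
    refine le_of_tendsto' ((hS b hb q.1).sub (hS a ha q.1)).norm fun n => ?_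
    have := (convex_Ici (0 : ℝ)).norm_image_sub_le_of_norm_hasDerivWithin_le
      (f := fun t : ℝ => NormedSpace.exp (t • A n) q.1) (C := ‖q.2‖)
      (fun x _ => (hasDerivAt_exp_smul_apply (A n) q.1 x).hasDerivWithinAt)
      (fun x hx => (hA n x _ hx).trans (hAle q hq n)) ha hb
    simpa [Real.norm_eq_abs] using this
  have hcont : ∀ u, ContinuousOn (fun t => S t u) (Ici 0) := by
    intro f a ha
    rw [Metric.continuousWithinAt_iff]
    intro ε hε
    obtain ⟨u, ⟨v, hv⟩, hu⟩ := hD.exists_dist_lt f (show (0 : ℝ) < ε / 3 by positivity)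
    refine ⟨ε / 3 / (‖v‖ + 1), by positivity, fun b hb hba => ?_⟩
    have h1 := hSint _ hv a b ha hb
    rw [Real.dist_eq, lt_div_iff₀ (by positivity)] at hba
    have h2 : ∀ t, 0 ≤ t → dist (S t f) (S t u) ≤ dist f u := fun t ht => by
      rw [dist_eq_norm, dist_eq_norm, ← map_sub]; exact hSn t ht _
    have h3 := h2 a ha
    rw [dist_comm] at h3
    calc dist (S b f) (S a f)
        ≤ dist (S b f) (S b u) + dist (S b u) (S a u) + dist (S a u) (S a f) :=
          dist_triangle4 _ _ _ _
      _ < ε / 3 + ε / 3 + ε / 3 := by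
          have h4 : dist (S b u) (S a u) < ε / 3 := by
            rw [dist_eq_norm]; nlinarith [abs_nonneg (b - a)]
          linarith [h2 b hb]
      _ = ε := by ring
  refine ⟨S, ⟨fun u => ?_, fun a b ha hb u => ?_, hSn, hcont⟩, fun q hq t ht => ⟨?_, ?_⟩⟩
  · exact tendsto_nhds_unique (hS 0 le_rfl u) (by simp [NormedSpace.exp_zero])
  · refine tendsto_nhds_unique (hS (a + b) (add_nonneg ha hb) u) ?_
    have h1 : ∀ n, NormedSpace.exp ((a + b) • A n) u
        = NormedSpace.exp (a • A n) (NormedSpace.exp (b • A n) u - S b u)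
          + NormedSpace.exp (a • A n) (S b u) := by
      intro n
      let _ : NormedAlgebra ℚ (H →L[ℝ] H) := NormedAlgebra.restrictScalars ℚ ℝ _
      rw [add_smul, NormedSpace.exp_add_of_commute
        (((Commute.refl (A n)).smul_left a).smul_right b), mul_apply_eq_comp, ← map_add]
      congr 1
      abel
    simp only [h1]
    rw [← zero_add (S a (S b u))]
    refine Tendsto.add ?_ (hS a ha (S b u))
    refine squeeze_zero_norm (fun n => hA n a _ ha) ?_
    have := (hS b hb u).sub_const (S b u)
    rw [sub_self] at this
    simpa using this.norm
  -- Invariance of the relation: `q.1 = R (q.1 - q.2)` and `S t` commutes with `R`, so `S t q.1` is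
  -- a value of the resolvent.
  · have hRS : ∀ f, S t (R f) = R (S t f) := fun f => by
      refine tendsto_nhds_unique (hS t ht (R f)) ?_
      have h1 : ∀ n, NormedSpace.exp (t • A n) (R f) = R (NormedSpace.exp (t • A n) f) := fun n =>
        exp_apply_comm ((hAR n).smul_left t) f
      simp only [h1]
      exact (R.continuous.tendsto _).comp (hS t ht f)
    have h1 := hRmem (S t (q.1 - q.2))
    rw [← hRS, hRinv q hq] at h1
    rw [map_sub] at h1
    simpa using h1
  -- The integrated equation survives the limit by dominated convergence; differentiability is then
  -- the fundamental theorem of calculus.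
  · have hint : ∀ b, 0 ≤ b → S b q.1 = q.1 + ∫ x in (0 : ℝ)..b, S x q.2 := by
      intro b hb
      have h1 : ∀ n, NormedSpace.exp (b • A n) q.1
          = q.1 + ∫ x in (0 : ℝ)..b, NormedSpace.exp (x • A n) (A n q.1) := by
        intro n
        rw [intervalIntegral.integral_eq_sub_of_hasDerivAt
          (f := fun x : ℝ => NormedSpace.exp (x • A n) q.1)
          (fun x _ => hasDerivAt_exp_smul_apply (A n) q.1 x)]
        · simp [NormedSpace.exp_zero]
        · refine Continuous.intervalIntegrable ?_ _ _
          exact continuous_iff_continuousAt.mpr fun x =>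
            (hasDerivAt_exp_smul_apply (A n) (A n q.1) x).continuousAt
      refine tendsto_nhds_unique (hS b hb q.1) ?_
      simp only [h1]
      refine tendsto_const_nhds.add ?_
      refine intervalIntegral.tendsto_integral_filter_of_dominated_convergence (fun _ => ‖q.2‖)
        (.of_forall fun n => ?_) (.of_forall fun n => .of_forall fun x hx => ?_) (by simp)
        (.of_forall fun x hx => ?_)
      · refine Continuous.aestronglyMeasurable ?_
        exact continuous_iff_continuousAt.mpr fun x =>
            (hasDerivAt_exp_smul_apply (A n) (A n q.1) x).continuousAt
      · rw [uIoc_of_le hb] at hx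
        exact (hA n x _ hx.1.le).trans (hAle q hq n)
      · rw [uIoc_of_le hb] at hx
        have h2 : ∀ n, NormedSpace.exp (x • A n) (A n q.1)
          = NormedSpace.exp (x • A n) (A n q.1 - q.2) + NormedSpace.exp (x • A n) q.2 := by
          intro n; rw [← map_add]; congr 1; abel
        simp only [h2]
        rw [← zero_add (S x q.2)]
        refine Tendsto.add ?_ (hS x hx.1.le q.2)
        refine squeeze_zero_norm (fun n => hA n x _ hx.1.le) ?_
        have := (hAlim q hq).sub_const q.2
        rw [sub_self] at this
        simpa using this.norm
    have hc := hcont q.2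
    -- `S` is controlled only for nonnegative times. Freezing the integrand to the left of 0 gives a
    -- two-sided derivative, which is then restricted to `[0, ∞)`.
    have hc' : Continuous fun x : ℝ => S (max x 0) q.2 := by
      refine hc.comp_continuous (by fun_prop) fun x => mem_Ici.mpr (le_max_right _ _)
    have h3 : HasDerivAt (fun b => q.1 + ∫ x in (0 : ℝ)..b, S (max x 0) q.2) (S (max t 0) q.2) t :=
      (intervalIntegral.integral_hasDerivAt_right (hc'.intervalIntegrable _ _)
        (hc'.stronglyMeasurableAtFilter _ _) hc'.continuousAt).const_add _
    rw [max_eq_left ht] at h3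
    refine h3.hasDerivWithinAt.congr_of_mem (fun b hb => ?_) ht
    rw [hint b hb]
    congr 1
    refine intervalIntegral.integral_congr fun x hx => ?_
    rw [uIcc_of_le hb] at hx
    simp only [max_eq_left hx.1]

end HilleYosida

/-! ### Continuous functions as elements of L²(0, L). -/

section StateSpace

variable {E : Type*} [NormedAddCommGroup E] [InnerProductSpace ℝ E] [FiniteDimensional ℝ E]

/-- The space `L²((0, L); E)`. -/
abbrev L2 (E : Type*) [NormedAddCommGroup E] (L : ℝ) : Type _ :=
  Lp E 2 (volume.restrict (Ioo 0 L))

theorem memLp_two_of_continuous {f : ℝ → E} (hf : Continuous f) (L : ℝ) :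
    MemLp f 2 (volume.restrict (Ioo 0 L)) := by
  obtain ⟨C, hC⟩ := isCompact_Icc.exists_bound_of_continuousOn (s := Icc 0 L) hf.continuousOn
  refine MemLp.of_bound hf.aestronglyMeasurable C ?_
  exact (ae_restrict_mem measurableSet_Ioo).mono fun x hx => hC x (Ioo_subset_Icc_self hx)

open Classical in
/-- The class in `L²((0, L); E)` of a function (zero if it is not square integrable). -/
noncomputable def cls (L : ℝ) (f : ℝ → E) : L2 E L :=
  if h : MemLp f 2 (volume.restrict (Ioo 0 L)) then h.toLp f else 0

variable {L : ℝ}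

theorem coeFn_cls {f : ℝ → E} (hf : Continuous f) :
    cls L f =ᵐ[volume.restrict (Ioo 0 L)] f := by
  have h := memLp_two_of_continuous hf L
  rw [cls, dif_pos h]
  exact h.coeFn_toLp

theorem cls_add {f g : ℝ → E} (hf : Continuous f) (hg : Continuous g) :
    cls L (fun x => f x + g x) = cls L f + cls L g := by
  refine Lp.ext ?_
  filter_upwards [coeFn_cls (L := L) hf, coeFn_cls (L := L) hg, coeFn_cls (L := L) (hf.add hg),
    Lp.coeFn_add (cls L f) (cls L g)] with x h1 h2 h3 h4
  rw [h4, Pi.add_apply, h1, h2]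
  exact h3

theorem cls_smul {f : ℝ → E} (r : ℝ) (hf : Continuous f) :
    cls L (fun x => r • f x) = r • cls L f := by
  refine Lp.ext ?_
  filter_upwards [coeFn_cls (L := L) hf, coeFn_cls (L := L) (hf.const_smul r),
    Lp.coeFn_smul r (cls L f)] with x h1 h2 h3
  rw [h3, Pi.smul_apply, h1]
  exact h2

theorem cls_sub {f g : ℝ → E} (hf : Continuous f) (hg : Continuous g) :
    cls L (fun x => f x - g x) = cls L f - cls L g := by
  have h := cls_add (L := L) hf (g := fun x => (-1 : ℝ) • g x) (hg.const_smul (-1 : ℝ))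
  rw [cls_smul (-1 : ℝ) hg] at h
  simpa [sub_eq_add_neg] using h

theorem cls_zero : cls L (fun _ => (0 : E)) = 0 := by
  simpa using cls_smul (L := L) (0 : ℝ) (continuous_const (y := (0 : E)))

theorem integrable_inner_of_continuous {f : ℝ → E} (hf : Continuous f) (z : L2 E L) :
    Integrable (fun x => ⟪f x, z x⟫) (volume.restrict (Ioo 0 L)) := by
  have h := L2.integrable_inner (𝕜 := ℝ) (cls L f) z
  refine h.congr ?_
  filter_upwards [coeFn_cls (L := L) hf] with x hx
  rw [hx]

theorem inner_cls {f : ℝ → E} (hf : Continuous f) (z : L2 E L) :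
    ⟪cls L f, z⟫ = ∫ x in Ioo 0 L, ⟪f x, z x⟫ := by
  rw [L2.inner_def]
  refine integral_congr_ae ?_
  filter_upwards [coeFn_cls (L := L) hf] with x hx
  rw [hx]

/-- The exact factor is the square root of `max L 0`; `1 + L ^ 2` is a convenient polynomial bound
for it. -/
theorem norm_cls_le {f : ℝ → E} (hf : Continuous f) {C : ℝ} (hC : ∀ x ∈ Icc 0 L, ‖f x‖ ≤ C) :
    ‖cls L f‖ ≤ (1 + L ^ 2) * |C| := by
  have h := Lp.norm_le_of_ae_bound (f := cls L f) (abs_nonneg C) (by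
    filter_upwards [coeFn_cls (L := L) hf, ae_restrict_mem measurableSet_Ioo] with x hx hx'
    rw [hx]
    exact (hC x (Ioo_subset_Icc_self hx')).trans (le_abs_self C))
  refine h.trans ?_
  gcongr
  have h1 : (measureUnivNNReal (volume.restrict (Ioo 0 L)) : ℝ) = max L 0 := by
    rw [measureUnivNNReal, ← ENNReal.toReal, Measure.restrict_apply_univ, Real.volume_Ioo, sub_zero,
      ENNReal.toReal_ofReal']
  rw [h1]
  have h2 : (max L 0) ^ ((2 : ENNReal).toReal⁻¹) = √(max L 0) := by
    rw [Real.sqrt_eq_rpow]; norm_num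
  rw [h2, Real.sqrt_le_left (by positivity)]
  rcases le_total L 0 with h | h
  · rw [max_eq_right h]; positivity
  · rw [max_eq_left h]; nlinarith [sq_nonneg (L - 1), sq_nonneg L, sq_nonneg (L ^ 2)]

/-- Joint continuity is uniform on a compact rectangle; this turns pointwise continuity and
differentiability in the parameter into the same properties in L². -/
theorem exists_uniform_modulus {E : Type*} [NormedAddCommGroup E] {g : ℝ → ℝ → E}
    (hg : Continuous fun q : ℝ × ℝ => g q.1 q.2)
    (L t : ℝ) {ε : ℝ} (hε : 0 < ε) :
    ∃ δ > 0, ∀ s, |s - t| < δ → ∀ x ∈ Icc 0 L, ‖g s x - g t x‖ ≤ ε := by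
  obtain ⟨δ, hδ, h⟩ := Metric.uniformContinuousOn_iff.mp
    ((isCompact_Icc.prod isCompact_Icc).uniformContinuousOn_of_continuous
      (s := Icc (t - 1) (t + 1) ×ˢ Icc 0 L) hg.continuousOn) ε hε
  refine ⟨min δ 1, by positivity, fun s hs x hx => ?_⟩
  rw [lt_min_iff, abs_lt, abs_lt] at hs
  rw [← dist_eq_norm]
  refine (h (s, x) ⟨⟨?_, ?_⟩, hx⟩ (t, x) ⟨⟨?_, ?_⟩, hx⟩ ?_).le <;> simp only [Prod.dist_eq]
  · linarith [hs.2.1]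
  · linarith [hs.2.2]
  · linarith
  · linarith
  · rw [dist_self, Real.dist_eq, max_eq_left (abs_nonneg _), abs_lt]
    exact hs.1

/-- If `f` depends continuously on a parameter, then so does its class. -/
theorem continuous_cls {g : ℝ → ℝ → E} (hg : Continuous fun q : ℝ × ℝ => g q.1 q.2) :
    Continuous fun t => cls L (g t) := by
  have hgt : ∀ t, Continuous (g t) := fun t =>
    hg.comp (continuous_const.prodMk continuous_id)
  rw [Metric.continuous_iff]
  intro t ε hε
  obtain ⟨δ, hδ, h⟩ := exists_uniform_modulus hg L t (ε := ε / (1 + L ^ 2) / 2) (by positivity)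
  refine ⟨δ, hδ, fun s hs => ?_⟩
  rw [dist_eq_norm, ← cls_sub (hgt s) (hgt t)]
  refine (norm_cls_le (f := fun x => g s x - g t x) ((hgt s).sub (hgt t))
    (fun x hx => h s hs x hx)).trans_lt ?_
  rw [abs_of_pos (by positivity), div_div, mul_div_assoc']
  rw [div_lt_iff₀ (by positivity)]
  nlinarith [sq_nonneg L]

/-- Differentiation of the class of a function with respect to a parameter. -/
theorem hasDerivAt_cls {g g' : ℝ → ℝ → E} (hg : Continuous fun q : ℝ × ℝ => g q.1 q.2)
    (hg' : Continuous fun q : ℝ × ℝ => g' q.1 q.2)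
    (hd : ∀ t x, HasDerivAt (fun τ => g τ x) (g' t x) t) (t : ℝ) :
    HasDerivAt (fun τ => cls L (g τ)) (cls L (g' t)) t := by
  have hgt : ∀ t, Continuous (g t) := fun t => hg.comp (continuous_const.prodMk continuous_id)
  have hgt' : ∀ t, Continuous (g' t) := fun t => hg'.comp (continuous_const.prodMk continuous_id)
  rw [hasDerivAt_iff_isLittleO, Asymptotics.isLittleO_iff]
  intro ε hε
  obtain ⟨δ, hδ, h⟩ := exists_uniform_modulus hg' L t (ε := ε / (1 + L ^ 2)) (by positivity)
  filter_upwards [Metric.ball_mem_nhds t hδ] with s hs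
  rw [← cls_smul _ (hgt' t), ← cls_sub (hgt s) (hgt t),
    ← cls_sub (f := fun x => g s x - g t x) (g := fun x => (s - t) • g' t x)
      ((hgt s).sub (hgt t)) ((hgt' t).const_smul _)]
  refine (norm_cls_le (f := fun x => g s x - g t x - (s - t) • g' t x)
    (C := ε / (1 + L ^ 2) * ‖s - t‖) (((hgt s).sub (hgt t)).sub ((hgt' t).const_smul _)) fun x hx => ?_).trans_eq ?_
  -- Mean value inequality for `g τ x - τ • g' t x`, whose derivative `g' τ x - g' t x` is small
  -- uniformly in `x`.
  · have hm := (convex_ball t δ).norm_image_sub_le_of_norm_hasDerivWithin_le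
      (f := fun τ : ℝ => g τ x - τ • g' t x) (f' := fun τ => g' τ x - g' t x)
      (C := ε / (1 + L ^ 2)) (x := t) (y := s)
      (fun τ _ => by
        have h1 := (hd τ x).fun_sub ((hasDerivAt_id' τ).smul_const (g' t x))
        rw [one_smul] at h1
        exact h1.hasDerivWithinAt)
      (fun τ hτ => h τ hτ x hx) (Metric.mem_ball_self hδ) hs
    refine le_of_eq_of_le (congrArg _ ?_) hm
    module
  · rw [abs_of_nonneg (by positivity)]
    field_simp

/-- Products of a smooth compactly supported scalar function with a fixed vector already detect a
locally integrable function. The test class is C¹ because Green's formula will be applied to it. -/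
theorem eq_zero_of_forall_inner_cls {z : L2 E L}
    (hz : ∀ ψ ψ' : ℝ → E, Continuous ψ' → (∀ x, HasDerivAt ψ (ψ' x) x) → ⟪cls L ψ, z⟫ = 0) :
    z = 0 := by
  rw [Lp.eq_zero_iff_ae_eq_zero]
  have hint : Integrable z (volume.restrict (Ioo 0 L)) := (Lp.memLp z).integrable one_le_two
  refine ae_eq_zero_of_integral_contDiff_smul_eq_zero hint.locallyIntegrable fun g hg hgc => ?_
  have hg1 : ContDiff ℝ 1 g := hg.of_le (by simp)
  obtain ⟨C, hC⟩ := hgc.exists_bound_of_continuous hg.continuous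
  have hgz : Integrable (fun x => g x • z x) (volume.restrict (Ioo 0 L)) :=
    hint.bdd_smul C hg.continuous.aestronglyMeasurable (.of_forall hC)
  refine ext_inner_left ℝ fun e => ?_
  rw [inner_zero_right, ← integral_inner hgz]
  have h := hz (fun x => g x • e) (fun x => deriv g x • e)
    ((hg1.continuous_deriv le_rfl).smul continuous_const)
    (fun x => ((hg1.differentiable one_ne_zero x).hasDerivAt).smul_const e)
  rw [inner_cls (f := fun x => g x • e) (hg.continuous.smul continuous_const)] at h
  refine Eq.trans ?_ h
  refine integral_congr_ae (.of_forall fun x => ?_)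
  simp only [inner_smul_left, inner_smul_right]
  rfl

/-- A closed subspace of `L²` which contains the continuous functions is everything. -/
theorem eq_top_of_cls_mem {K : Submodule ℝ (L2 E L)} (hK : IsClosed (K : Set (L2 E L)))
    (h : ∀ f : ℝ → E, Continuous f → cls L f ∈ K) : K = ⊤ := by
  have : CompleteSpace K := hK.completeSpace_coe
  rw [← Submodule.orthogonal_eq_bot_iff, Submodule.eq_bot_iff]
  intro z hz
  refine eq_zero_of_forall_inner_cls fun ψ ψ' _ hd => ?_
  exact hz _ (h ψ (continuous_iff_continuousAt.mpr fun x => (hd x).continuousAt))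

end StateSpace

/-! ### The boundary value problem of one mode: graph, resolvent, semigroup. -/

/-- Inhomogeneous linear differential equations with constant coefficients are solvable. -/
theorem exists_linear_ode {E : Type*} [NormedAddCommGroup E] [NormedSpace ℝ E] [CompleteSpace E]
    (N : E →L[ℝ] E) {g : ℝ → E} (hg : Continuous g) (x₀ : ℝ) (a : E) :
    ∃ z : ℝ → E, z x₀ = a ∧ ∀ x, HasDerivAt z (N (z x) + g x) x := by
  have hinv : ∀ (x : ℝ) v, NormedSpace.exp (x • N) (NormedSpace.exp ((-x) • N) v) = v := by
    intro x v
    let _ : NormedAlgebra ℚ (E →L[ℝ] E) := NormedAlgebra.restrictScalars ℚ ℝ _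
    have h := NormedSpace.exp_add_of_commute
      (((Commute.refl N).smul_left x).smul_right (-x))
    rw [← add_smul, add_neg_cancel, zero_smul, NormedSpace.exp_zero] at h
    have := congrArg (fun T : E →L[ℝ] E => T v) h
    simpa using this.symm
  have hexpc : Continuous fun x : ℝ => NormedSpace.exp (x • N) :=
    continuous_iff_continuousAt.mpr fun x => (hasDerivAt_exp_smul_const (𝕂 := ℝ) N x).continuousAt
  have hc : Continuous fun y : ℝ => NormedSpace.exp ((-y) • N) (g y) :=
    (hexpc.comp continuous_neg).clm_apply hg
  -- Variation of constants from the base point `x₀`.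
  refine ⟨fun x => NormedSpace.exp (x • N)
      (NormedSpace.exp ((-x₀) • N) a + ∫ y in x₀..x, NormedSpace.exp ((-y) • N) (g y)),
    by simp only [intervalIntegral.integral_same, add_zero, hinv], fun x => ?_⟩
  have h1 := (intervalIntegral.integral_hasDerivAt_right (hc.intervalIntegrable x₀ x)
      (hc.stronglyMeasurableAtFilter _ _) hc.continuousAt).const_add
        (NormedSpace.exp ((-x₀) • N) a)
  have h2 := (hasDerivAt_exp_smul_const' (𝕂 := ℝ) N x).clm_apply h1
  rw [hinv] at h2
  exact h2

/-- A hyperbolic boundary value problem `z_t + J z_x = S z` on `(0, L)` with constant coefficients,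
with a local boundary condition `bc₀ z(0) = 0` and a nonlocal one `bcL z(L) = κ z`. The field
`energy` is an energy estimate for smooth states in the equivalent norm `‖Φ z‖`. -/
structure HyperbolicBVP (E F : Type*) [NormedAddCommGroup E] [InnerProductSpace ℝ E]
    [FiniteDimensional ℝ E] [NormedAddCommGroup F] [NormedSpace ℝ F] [FiniteDimensional ℝ F]
    (L : ℝ) where
  /-- transport matrix -/
  J : E →L[ℝ] E
  /-- inverse of the transport matrix -/
  Jinv : E →L[ℝ] E
  /-- source matrix -/
  S : E →L[ℝ] E
  /-- boundary operator at `0` -/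
  bc₀ : E →L[ℝ] F
  /-- boundary functional at `L` -/
  bcL : E →L[ℝ] ℝ
  /-- nonlocal feedback -/
  κ : L2 E L →L[ℝ] ℝ
  /-- change of norm -/
  Φ : L2 E L ≃L[ℝ] L2 E L
  /-- growth rate -/
  ω : ℝ
  /-- strength of the boundary dissipation -/
  c : ℝ
  L_nonneg : 0 ≤ L
  J_Jinv : ∀ v, J (Jinv v) = v
  Jinv_J : ∀ v, Jinv (J v) = v
  finrank_eq : Module.finrank ℝ F + 1 = Module.finrank ℝ E
  ω_nonneg : 0 ≤ ω
  c_pos : 0 < c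
  energy : ∀ z z' : ℝ → E, Continuous z' → (∀ x, HasDerivAt z (z' x) x) →
    bc₀ (z 0) = 0 → bcL (z L) = κ (cls L z) →
    ⟪Φ (cls L z), Φ (cls L fun x => S (z x) - J (z' x))⟫
      ≤ ω * ‖Φ (cls L z)‖ ^ 2 - c * (‖z 0‖ ^ 2 + ‖z L‖ ^ 2)

namespace HyperbolicBVP

variable {E F : Type*} [NormedAddCommGroup E] [InnerProductSpace ℝ E]
    [FiniteDimensional ℝ E] [NormedAddCommGroup F] [NormedSpace ℝ F] [FiniteDimensional ℝ F]
    {L : ℝ} (M : HyperbolicBVP E F L)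

/-- The graph of the generator on smooth states, together with the boundary traces. -/
def classicalGraph : Submodule ℝ ((L2 E L × L2 E L) × (E × E)) where
  carrier := {q | ∃ z z' : ℝ → E, Continuous z' ∧ (∀ x, HasDerivAt z (z' x) x) ∧
    M.bc₀ (z 0) = 0 ∧ M.bcL (z L) = M.κ (cls L z) ∧
    q = ((cls L z, cls L fun x => M.S (z x) - M.J (z' x)), (z 0, z L))}
  zero_mem' := by
    refine ⟨fun _ => 0, fun _ => 0, continuous_const, fun x => hasDerivAt_const x 0, ?_, ?_, ?_⟩
    · simp
    · simp [cls_zero]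
    · simp only [map_zero, sub_zero, cls_zero]
      rfl
  add_mem' := by
    rintro _ _ ⟨z, z', hc, hd, h0, hL, rfl⟩ ⟨y, y', hc', hd', h0', hL', rfl⟩
    have hz : Continuous z := continuous_iff_continuousAt.mpr fun x => (hd x).continuousAt
    have hy : Continuous y := continuous_iff_continuousAt.mpr fun x => (hd' x).continuousAt
    refine ⟨fun x => z x + y x, fun x => z' x + y' x, hc.add hc', fun x => (hd x).add (hd' x),
      by rw [map_add, h0, h0', add_zero], by rw [map_add, hL, hL', cls_add hz hy, map_add], ?_⟩
    rw [cls_add hz hy]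
    have : (fun x => M.S (z x + y x) - M.J (z' x + y' x))
        = fun x => (M.S (z x) - M.J (z' x)) + (M.S (y x) - M.J (y' x)) := by
      funext x; rw [map_add, map_add]; abel
    rw [this, cls_add (by fun_prop) (by fun_prop)]
    rfl
  smul_mem' := by
    rintro r _ ⟨z, z', hc, hd, h0, hL, rfl⟩
    have hz : Continuous z := continuous_iff_continuousAt.mpr fun x => (hd x).continuousAt
    refine ⟨fun x => r • z x, fun x => r • z' x, hc.const_smul r, fun x => (hd x).const_smul r,
      by rw [map_smul, h0, smul_zero], by rw [map_smul, hL, cls_smul r hz, map_smul], ?_⟩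
    rw [cls_smul r hz]
    have : (fun x => M.S (r • z x) - M.J (r • z' x)) = fun x => r • (M.S (z x) - M.J (z' x)) := by
      funext x; rw [map_smul, map_smul, smul_sub]
    rw [this, cls_smul r (by fun_prop)]
    rfl

/-- The graph of the generator, together with the boundary traces: its elements are
`((z, A z), (z(0), z(L)))`. -/
noncomputable def graph : Submodule ℝ ((L2 E L × L2 E L) × (E × E)) := M.classicalGraph.topologicalClosure

theorem isClosed_graph : IsClosed (M.graph : Set ((L2 E L × L2 E L) × (E × E))) :=
  Submodule.isClosed_topologicalClosure _

theorem mem_graph_of_classical {z z' : ℝ → E} (hc : Continuous z')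
    (hd : ∀ x, HasDerivAt z (z' x) x) (h0 : M.bc₀ (z 0) = 0) (hL : M.bcL (z L) = M.κ (cls L z)) :
    ((cls L z, cls L fun x => M.S (z x) - M.J (z' x)), (z 0, z L)) ∈ M.graph :=
  M.classicalGraph.le_topologicalClosure ⟨z, z', hc, hd, h0, hL, rfl⟩

/-- The boundary conditions, the energy estimate and Green's formula are closed conditions once the
traces are coordinates of the graph, so it is enough to check them on smooth states. -/
theorem graph_induction {P : (L2 E L × L2 E L) × (E × E) → Prop} (hP : IsClosed {q | P q})
    (h : ∀ z z' : ℝ → E, Continuous z' → (∀ x, HasDerivAt z (z' x) x) → M.bc₀ (z 0) = 0 →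
      M.bcL (z L) = M.κ (cls L z) →
      P ((cls L z, cls L fun x => M.S (z x) - M.J (z' x)), (z 0, z L))) :
    ∀ q ∈ M.graph, P q := by
  intro q hq
  refine closure_minimal (s := (M.classicalGraph : Set ((L2 E L × L2 E L) × (E × E)))) ?_ hP hq
  rintro _ ⟨z, z', hc, hd, h0, hL, rfl⟩
  exact h z z' hc hd h0 hL

theorem graph_bc₀ : ∀ q ∈ M.graph, M.bc₀ q.2.1 = 0 :=
  M.graph_induction (isClosed_eq (by fun_prop) continuous_const) fun _ _ _ _ h _ => h

theorem graph_bcL : ∀ q ∈ M.graph, M.bcL q.2.2 = M.κ q.1.1 :=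
  M.graph_induction (isClosed_eq (by fun_prop) (by fun_prop)) fun _ _ _ _ _ h => h

theorem graph_energy : ∀ q ∈ M.graph, ⟪M.Φ q.1.1, M.Φ q.1.2⟫
    ≤ M.ω * ‖M.Φ q.1.1‖ ^ 2 - M.c * (‖q.2.1‖ ^ 2 + ‖q.2.2‖ ^ 2) :=
  M.graph_induction (isClosed_le (by fun_prop) (by fun_prop)) fun z z' hc hd h0 hL =>
    M.energy z z' hc hd h0 hL

/-- The adjoint differential expression, as an `L²` state. -/
noncomputable def adj (ψ ψ' : ℝ → E) : L2 E L :=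
  cls L fun x => M.J.adjoint (ψ' x) + M.S.adjoint (ψ x)

/-- Green's formula in space for smooth functions. -/
theorem green_classical {ψ ψ' z z' : ℝ → E} (hψ' : Continuous ψ')
    (hψ : ∀ x, HasDerivAt ψ (ψ' x) x) (hz' : Continuous z') (hz : ∀ x, HasDerivAt z (z' x) x) :
    ⟪M.adj ψ ψ', cls L z⟫ - ⟪cls L ψ, cls L fun x => M.S (z x) - M.J (z' x)⟫
      = ⟪ψ L, M.J (z L)⟫ - ⟪ψ 0, M.J (z 0)⟫ := by
  have hψc : Continuous ψ := continuous_iff_continuousAt.mpr fun x => (hψ x).continuousAt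
  have hzc : Continuous z := continuous_iff_continuousAt.mpr fun x => (hz x).continuousAt
  rw [adj, inner_cls (by fun_prop), inner_cls hψc, ← integral_sub
    (integrable_inner_of_continuous (by fun_prop) _) (integrable_inner_of_continuous hψc _)]
  -- The source terms cancel, and what remains is the derivative of `⟪ψ, J z⟫`.
  have h1 : ∫ x in Ioo 0 L, (⟪M.J.adjoint (ψ' x) + M.S.adjoint (ψ x), cls L z x⟫
      - ⟪ψ x, (cls L fun x => M.S (z x) - M.J (z' x)) x⟫)
      = ∫ x in Ioo 0 L, (⟪ψ x, M.J (z' x)⟫ + ⟪ψ' x, M.J (z x)⟫) := by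
    refine integral_congr_ae ?_
    filter_upwards [coeFn_cls (L := L) hzc, coeFn_cls (L := L)
      (f := fun x => M.S (z x) - M.J (z' x)) (by fun_prop)] with x h1 h2
    rw [h1, h2, inner_add_left, ContinuousLinearMap.adjoint_inner_left,
      ContinuousLinearMap.adjoint_inner_left, inner_sub_right]
    ring
  rw [h1, ← integral_Ioc_eq_integral_Ioo, ← intervalIntegral.integral_of_le M.L_nonneg]
  refine intervalIntegral.integral_eq_sub_of_hasDerivAt (f := fun x => ⟪ψ x, M.J (z x)⟫)
    (fun x _ => ?_) ((by fun_prop : Continuous _).intervalIntegrable _ _)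
  exact (hψ x).inner ℝ ((M.J.hasFDerivAt).comp_hasDerivAt x (hz x))

theorem graph_green {ψ ψ' : ℝ → E} (hψ' : Continuous ψ')
    (hψ : ∀ x, HasDerivAt ψ (ψ' x) x) : ∀ q ∈ M.graph,
    ⟪M.adj ψ ψ', q.1.1⟫ - ⟪cls L ψ, q.1.2⟫ = ⟪ψ L, M.J q.2.2⟫ - ⟪ψ 0, M.J q.2.1⟫ :=
  M.graph_induction (isClosed_eq (by fun_prop) (by fun_prop)) fun _ _ hc hd _ _ =>
    M.green_classical hψ' hψ hc hd

/-- Coercivity of the resolvent equation. -/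
theorem graph_coercive_inner {q : (L2 E L × L2 E L) × (E × E)} (hq : q ∈ M.graph) (μ : ℝ) :
    μ * ‖M.Φ q.1.1‖ ^ 2 + M.c * (‖q.2.1‖ ^ 2 + ‖q.2.2‖ ^ 2)
      ≤ ⟪M.Φ q.1.1, M.Φ ((μ + M.ω) • q.1.1 - q.1.2)⟫ := by
  rw [map_sub, map_smul, inner_sub_right, inner_smul_right, real_inner_self_eq_norm_sq]
  linarith [M.graph_energy q hq]

theorem graph_coercive {q : (L2 E L × L2 E L) × (E × E)} (hq : q ∈ M.graph) (μ : ℝ) :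
    μ * ‖M.Φ q.1.1‖ ^ 2 + M.c * (‖q.2.1‖ ^ 2 + ‖q.2.2‖ ^ 2)
      ≤ ‖M.Φ q.1.1‖ * ‖M.Φ ((μ + M.ω) • q.1.1 - q.1.2)‖ :=
  (M.graph_coercive_inner hq μ).trans (real_inner_le_norm _ _)

theorem graph_resolvent_le {q : (L2 E L × L2 E L) × (E × E)} (hq : q ∈ M.graph) (μ : ℝ) :
    μ * ‖M.Φ q.1.1‖ ≤ ‖M.Φ ((μ + M.ω) • q.1.1 - q.1.2)‖ := by
  have h := M.graph_coercive hq μ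
  have hc := M.c_pos
  rcases (norm_nonneg (M.Φ q.1.1)).eq_or_lt with h0 | h0
  · rw [← h0, mul_zero]; exact norm_nonneg _
  · refine le_of_mul_le_mul_left ?_ h0
    have : 0 ≤ M.c * (‖q.2.1‖ ^ 2 + ‖q.2.2‖ ^ 2) := by positivity
    nlinarith

/-- The dissipation term of `graph_coercive` controls the traces; its right-hand side is at most the
squared resolvent datum divided by `μ`, by `graph_resolvent_le`. -/
theorem graph_trace_le {q : (L2 E L × L2 E L) × (E × E)} (hq : q ∈ M.graph) {μ : ℝ}
    (hμ : 0 < μ) : M.c * μ * (‖q.2.1‖ ^ 2 + ‖q.2.2‖ ^ 2)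
      ≤ ‖M.Φ ((μ + M.ω) • q.1.1 - q.1.2)‖ ^ 2 := by
  have h := M.graph_coercive hq μ
  have h1 := M.graph_resolvent_le hq μ
  have h2 := norm_nonneg (M.Φ q.1.1)
  have h3 := norm_nonneg (M.Φ ((μ + M.ω) • q.1.1 - q.1.2))
  nlinarith [mul_le_mul_of_nonneg_right h1 h3, mul_nonneg hμ.le (sq_nonneg ‖M.Φ q.1.1‖)]

/-- The resolvent map on the graph. -/
noncomputable def resolventMap (μ : ℝ) : ((L2 E L × L2 E L) × (E × E)) →L[ℝ] L2 E L :=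
  (μ + M.ω) • (ContinuousLinearMap.fst ℝ _ _ ∘L ContinuousLinearMap.fst ℝ _ _)
    - ContinuousLinearMap.snd ℝ _ _ ∘L ContinuousLinearMap.fst ℝ _ _

theorem resolventMap_apply (μ : ℝ) (q : (L2 E L × L2 E L) × (E × E)) :
    M.resolventMap μ q = (μ + M.ω) • q.1.1 - q.1.2 := rfl

/-- Since all four coordinates are bounded, this one estimate yields injectivity and closed range of
the resolvent map and also the continuity in time of the traces. -/
theorem exists_norm_le_resolventMap {μ : ℝ} (hμ : 0 < μ) :
    ∃ C : NNReal, ∀ q ∈ M.graph, ‖q‖ ≤ C * ‖M.resolventMap μ q‖ := by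
  have hΦ : ∃ a : ℝ, 0 ≤ a ∧ ∀ z, ‖M.Φ z‖ ≤ a * ‖z‖ :=
    ⟨_, norm_nonneg _, (M.Φ : L2 E L →L[ℝ] L2 E L).le_opNorm⟩
  have hΦ' : ∃ a : ℝ, 0 ≤ a ∧ ∀ z, ‖z‖ ≤ a * ‖M.Φ z‖ :=
    ⟨_, norm_nonneg _, fun z => by
      simpa using (M.Φ.symm : L2 E L →L[ℝ] L2 E L).le_opNorm (M.Φ z)⟩
  obtain ⟨a, ha, hΦ⟩ := hΦ
  obtain ⟨b, hb, hΦ'⟩ := hΦ'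
  have hc := M.c_pos
  have hω := M.ω_nonneg
  -- The three summands bound the state, its image, and each of the two traces.
  set C : ℝ := b * (a / μ) + ((μ + M.ω) * (b * (a / μ)) + 1) + a / √(M.c * μ)
  have hC : 0 ≤ C := by positivity
  refine ⟨⟨C, hC⟩, fun q hq => ?_⟩
  change ‖q‖ ≤ C * _
  set f := M.resolventMap μ q with hf
  have hfn := norm_nonneg f
  rw [resolventMap_apply] at hf
  have h1 := M.graph_resolvent_le hq μ
  rw [← hf] at h1
  have hu : ‖q.1.1‖ ≤ b * (a / μ) * ‖f‖ := by
    refine (hΦ' _).trans ?_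
    rw [mul_assoc]
    gcongr
    rw [div_mul_eq_mul_div, le_div_iff₀ hμ, mul_comm]
    exact h1.trans (hΦ f)
  have hv : ‖q.1.2‖ ≤ ((μ + M.ω) * (b * (a / μ)) + 1) * ‖f‖ := by
    have : q.1.2 = (μ + M.ω) • q.1.1 - f := by rw [hf]; abel
    rw [this]
    refine (norm_sub_le _ _).trans ?_
    rw [norm_smul, Real.norm_of_nonneg (by positivity), add_mul _ 1, one_mul, mul_assoc]
    gcongr
  have hγ : ∀ g : E, ‖g‖ ^ 2 ≤ ‖q.2.1‖ ^ 2 + ‖q.2.2‖ ^ 2 → ‖g‖ ≤ a / √(M.c * μ) * ‖f‖ := by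
    intro g hg
    have h2 := M.graph_trace_le hq hμ
    rw [← hf] at h2
    rw [div_mul_eq_mul_div, le_div_iff₀ (by positivity)]
    refine le_of_sq_le_sq ?_ (by positivity)
    rw [mul_pow, Real.sq_sqrt (by positivity)]
    calc ‖g‖ ^ 2 * (M.c * μ) ≤ M.c * μ * (‖q.2.1‖ ^ 2 + ‖q.2.2‖ ^ 2) := by
          rw [mul_comm]; gcongr
      _ ≤ ‖M.Φ f‖ ^ 2 := h2
      _ ≤ (a * ‖f‖) ^ 2 := by gcongr; exact hΦ f
  have h3 : 0 ≤ b * (a / μ) * ‖f‖ := by positivity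
  have h4 : 0 ≤ ((μ + M.ω) * (b * (a / μ)) + 1) * ‖f‖ := by positivity
  have h5 : 0 ≤ a / √(M.c * μ) * ‖f‖ := by positivity
  have h6 := hγ q.2.1 (by nlinarith [sq_nonneg ‖q.2.2‖])
  have h7 := hγ q.2.2 (by nlinarith [sq_nonneg ‖q.2.1‖])
  have h8 : C * ‖f‖ = b * (a / μ) * ‖f‖ + ((μ + M.ω) * (b * (a / μ)) + 1) * ‖f‖
      + a / √(M.c * μ) * ‖f‖ := by simp only [C]; ring
  rw [h8, Prod.norm_def, Prod.norm_def, Prod.norm_def]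
  refine max_le (max_le ?_ ?_) (max_le ?_ ?_) <;> linarith

/-- The boundary value problem for the resolvent equation with a continuous right-hand side has a
smooth solution. -/
theorem exists_classical_resolvent {μ : ℝ} (hμ : 0 < μ) {f : ℝ → E} (hf : Continuous f) :
    ∃ q ∈ M.graph, M.resolventMap μ q = cls L f := by
  -- As `J` is invertible, the resolvent equation is the ordinary differential equation `z' = N z +
  -- Jinv f` in space.
  set N : E →L[ℝ] E := M.Jinv ∘L (M.S - (μ + M.ω) • ContinuousLinearMap.id ℝ E) with hN
  have hcont : ∀ {g z : ℝ → E}, (∀ x, HasDerivAt z (N (z x) + g x) x) → Continuous z :=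
    fun h => continuous_iff_continuousAt.mpr fun x => (h x).continuousAt
  have hval : ∀ {g z : ℝ → E}, Continuous g → (∀ x, HasDerivAt z (N (z x) + M.Jinv (g x)) x) →
      M.bc₀ (z 0) = 0 → M.bcL (z L) = M.κ (cls L z) → ∃ q ∈ M.graph,
        M.resolventMap μ q = cls L g ∧ q.2.1 = z 0 := by
    intro g z hg hd h0 hL
    have hz := hcont hd
    refine ⟨_, M.mem_graph_of_classical (by fun_prop) hd h0 hL, ?_, rfl⟩
    rw [resolventMap_apply, ← cls_smul _ hz,
      ← cls_sub (f := fun x => (μ + M.ω) • z x) (by fun_prop) (by fun_prop)]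
    congr 1
    funext x
    simp [hN, M.J_Jinv]
    module
  choose Y hY0 hYd using fun a => exists_linear_ode (E := E) N (g := fun _ => 0) continuous_const (0 : ℝ) a
  simp only [add_zero] at hYd
  have hYuniq : ∀ (z y : ℝ → E), (∀ x, HasDerivAt z (N (z x)) x) → (∀ x, HasDerivAt y (N (y x)) x) →
      z 0 = y 0 → z = y := fun z y hz hy h =>
    ODE_solution_unique_univ (v := fun _ => N) (s := fun _ => univ) (K := ‖N‖₊) (t₀ := 0)
      (fun _ => N.lipschitz.lipschitzOnWith) (fun x => ⟨hz x, mem_univ _⟩)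
      (fun x => ⟨hy x, mem_univ _⟩) h
  have hYadd : ∀ a b, Y (a + b) = fun x => Y a x + Y b x := fun a b =>
    hYuniq _ _ (hYd _) (fun x => by simpa using (hYd a x).fun_add (hYd b x)) (by simp [hY0])
  have hYsmul : ∀ (r : ℝ) a, Y (r • a) = fun x => r • Y a x := fun r a =>
    hYuniq _ _ (hYd _) (fun x => by simpa using (hYd a x).fun_const_smul r) (by simp [hY0])
  have hYc : ∀ a, Continuous (Y a) := fun a =>
    continuous_iff_continuousAt.mpr fun x => (hYd a x).continuousAt
  -- Shooting: `Λ` sends an initial value to the boundary defect of the homogeneous solution. A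
  -- kernel element gives a graph element with zero resolvent image, so the trace bound makes it
  -- vanish; `finrank_eq` then makes `Λ` onto, and a homogeneous solution repairs the defect of a
  -- particular one.
  let Λ : E →ₗ[ℝ] F × ℝ :=
    { toFun := fun a => (M.bc₀ a, M.bcL (Y a L) - M.κ (cls L (Y a)))
      map_add' := fun a b => by
        rw [hYadd, cls_add (hYc a) (hYc b)]
        simp only [map_add, Prod.mk_add_mk]
        congr 1; ring
      map_smul' := fun r a => by
        rw [hYsmul, cls_smul r (hYc a)]
        simp only [map_smul, Prod.smul_mk, RingHom.id_apply, smul_eq_mul]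
        congr 1; ring }
  have hΛ : Function.Injective Λ := by
    rw [injective_iff_map_eq_zero]
    intro a ha
    have h1 : M.bc₀ a = 0 := congrArg Prod.fst ha
    have h2 : M.bcL (Y a L) - M.κ (cls L (Y a)) = 0 := congrArg Prod.snd ha
    obtain ⟨q, hq, hqr, hq0⟩ := hval (g := fun _ => 0) (z := Y a) continuous_const
      (fun x => by simpa using hYd a x) (by rw [hY0, h1]) (sub_eq_zero.mp h2)
    rw [cls_zero] at hqr
    have h3 := M.graph_trace_le hq hμ
    rw [← resolventMap_apply, hqr, map_zero, norm_zero, hq0, hY0] at h3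
    have hc := M.c_pos
    have h4 : ‖a‖ ^ 2 ≤ 0 := by
      have h6 := mul_pos hc hμ
      have h7 : ‖a‖ ^ 2 + ‖q.2.2‖ ^ 2 ≤ 0 := by
        by_contra hcon
        push Not at hcon
        have := mul_pos h6 hcon
        norm_num at h3
        linarith
      linarith [sq_nonneg ‖q.2.2‖]
    exact norm_eq_zero.mp (pow_eq_zero_iff two_ne_zero |>.mp (le_antisymm h4 (sq_nonneg _)))
  have hΛs : Function.Surjective Λ := by
    refine (LinearMap.injective_iff_surjective_of_finrank_eq_finrank ?_).mp hΛ
    rw [Module.finrank_prod, Module.finrank_self, M.finrank_eq]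
  obtain ⟨y, hy0, hyd⟩ := exists_linear_ode N (g := fun x => M.Jinv (f x)) (by fun_prop) 0 0
  have hyc : Continuous y := hcont hyd
  obtain ⟨a, ha⟩ := hΛs (0, M.κ (cls L y) - M.bcL (y L))
  have h1 : M.bc₀ a = 0 := congrArg Prod.fst ha
  have h2 : M.bcL (Y a L) - M.κ (cls L (Y a)) = M.κ (cls L y) - M.bcL (y L) :=
    congrArg Prod.snd ha
  obtain ⟨q, hq, hqr, -⟩ := hval (g := f) (z := fun x => Y a x + y x) hf
    (fun x => by
      have := (hYd a x).fun_add (hyd x)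
      rwa [← add_assoc, ← map_add] at this) (by simp [hY0, hy0, h1]) (by
      rw [cls_add (hYc a) hyc, map_add, map_add]; linarith)
  exact ⟨q, hq, hqr⟩

/-- The range is closed by the lower bound and contains the classes of all continuous functions. -/
theorem exists_resolvent {μ : ℝ} (hμ : 0 < μ) (f : L2 E L) :
    ∃ q ∈ M.graph, M.resolventMap μ q = f := by
  obtain ⟨C, hC⟩ := M.exists_norm_le_resolventMap hμ
  have : CompleteSpace M.graph := M.isClosed_graph.completeSpace_coe
  let R : M.graph →L[ℝ] L2 E L := M.resolventMap μ ∘L M.graph.subtypeL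
  have hR : IsClosed (range R) :=
    (R.antilipschitz_of_bound (K := C) fun q => hC q q.2).isClosed_range R.uniformContinuous
  have htop : LinearMap.range (R : M.graph →ₗ[ℝ] L2 E L) = ⊤ := by
    refine eq_top_of_cls_mem hR fun g hg => ?_
    obtain ⟨q, hq, hqg⟩ := M.exists_classical_resolvent hμ hg
    exact ⟨⟨q, hq⟩, hqg⟩
  obtain ⟨q, hq⟩ := LinearMap.range_eq_top.mp htop f
  exact ⟨q, q.2, hq⟩

theorem eq_zero_of_resolventMap_eq_zero {q : (L2 E L × L2 E L) × (E × E)} (hq : q ∈ M.graph)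
    {μ : ℝ} (hμ : 0 < μ) (h : M.resolventMap μ q = 0) : q = 0 := by
  obtain ⟨C, hC⟩ := M.exists_norm_le_resolventMap hμ
  have := hC q hq
  rw [h, norm_zero, mul_zero] at this
  exact norm_le_zero_iff.mp this

/-- Weak solutions of the stationary problem belong to the graph of the generator. -/
theorem mem_graph_of_weak {y v : L2 E L} {γ₀ γL : E} (h0 : M.bc₀ γ₀ = 0) (hL : M.bcL γL = M.κ y)
    (hw : ∀ ψ ψ' : ℝ → E, Continuous ψ' → (∀ x, HasDerivAt ψ (ψ' x) x) →
      ⟪M.adj ψ ψ', y⟫ - ⟪cls L ψ, v⟫ = ⟪ψ L, M.J γL⟫ - ⟪ψ 0, M.J γ₀⟫) :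
    ((y, v), (γ₀, γL)) ∈ M.graph := by
  -- `q` is the graph element with the same resolvent datum, so the difference `d` weakly solves the
  -- homogeneous resolvent equation. The aim is to show that the two coincide.
  obtain ⟨q, hq, hqr⟩ := M.exists_resolvent one_pos ((1 + M.ω) • y - v)
  rw [resolventMap_apply] at hqr
  obtain ⟨d, hd⟩ : ∃ d, d = y - q.1.1 := ⟨_, rfl⟩
  have hvd : v - q.1.2 = (1 + M.ω) • d := by
    rw [hd, smul_sub, ← sub_eq_zero]
    rw [← sub_eq_zero] at hqr
    rw [← hqr]
    abel
  have hwd : ∀ ψ ψ' : ℝ → E, Continuous ψ' → (∀ x, HasDerivAt ψ (ψ' x) x) →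
      ⟪M.adj ψ ψ', d⟫ - ⟪cls L ψ, (1 + M.ω) • d⟫
        = ⟪ψ L, M.J (γL - q.2.2)⟫ - ⟪ψ 0, M.J (γ₀ - q.2.1)⟫ := by
    intro ψ ψ' hc hψ
    rw [← hvd, hd, inner_sub_right, inner_sub_right, map_sub, map_sub, inner_sub_right,
      inner_sub_right]
    linarith [hw ψ ψ' hc hψ, M.graph_green hc hψ q hq]
  set N : E →L[ℝ] E := M.Jinv ∘L (M.S - (1 + M.ω) • ContinuousLinearMap.id ℝ E) with hN
  -- `u` is the smooth homogeneous solution with the same trace at 0 as `d`; the boundary term at 0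
  -- disappears from the weak equation for `d - u`.
  obtain ⟨u, hu0, hud⟩ := exists_linear_ode (E := E) N (g := fun _ => 0) continuous_const (0 : ℝ)
    (γ₀ - q.2.1)
  simp only [add_zero] at hud
  have huc : Continuous u := continuous_iff_continuousAt.mpr fun x => (hud x).continuousAt
  have hAu : (cls L fun x => M.S (u x) - M.J (N (u x))) = (1 + M.ω) • cls L u := by
    rw [← cls_smul _ huc]
    congr 1
    funext x
    simp [hN, M.J_Jinv]
  have hwu : ∀ ψ ψ' : ℝ → E, Continuous ψ' → (∀ x, HasDerivAt ψ (ψ' x) x) →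
      ⟪M.adj ψ ψ', d - cls L u⟫ - (1 + M.ω) * ⟪cls L ψ, d - cls L u⟫
        = ⟪ψ L, M.J (γL - q.2.2 - u L)⟫ := by
    intro ψ ψ' hc hψ
    have h1 := hwd ψ ψ' hc hψ
    have h2 := M.green_classical hc hψ (by fun_prop) hud
    rw [hAu, hu0, inner_smul_right] at h2
    rw [inner_smul_right] at h1
    rw [inner_sub_right, inner_sub_right, map_sub M.J, inner_sub_right]
    linarith
  -- The adjoint equation is solved from the end `L` with arbitrary source `θ` and arbitrary end
  -- value `b`. Varying `b` identifies the trace at `L`, and varying `θ` identifies `d` with `u`.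
  have hadj : ∀ (θ : ℝ → E), Continuous θ → ∀ b : E, ∃ ψ : ℝ → E, ψ L = b ∧
      ⟪cls L θ, d - cls L u⟫ = ⟪b, M.J (γL - q.2.2 - u L)⟫ := by
    intro θ hθ b
    have hJad : ∀ w, M.J.adjoint (M.Jinv.adjoint w) = w := fun w => by
      refine ext_inner_right ℝ fun e => ?_
      rw [ContinuousLinearMap.adjoint_inner_left, ContinuousLinearMap.adjoint_inner_left, M.Jinv_J]
    obtain ⟨ψ, hψL, hψ⟩ := exists_linear_ode
      (M.Jinv.adjoint ∘L ((1 + M.ω) • ContinuousLinearMap.id ℝ E - M.S.adjoint))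
      (g := fun x => M.Jinv.adjoint (θ x)) (by fun_prop) L b
    have hψc : Continuous ψ := continuous_iff_continuousAt.mpr fun x => (hψ x).continuousAt
    refine ⟨ψ, hψL, ?_⟩
    rw [← hψL, ← hwu ψ _ (by fun_prop) hψ, adj, ← real_inner_smul_left, ← cls_smul _ hψc,
      ← inner_sub_left, ← cls_sub (by fun_prop) (by fun_prop)]
    congr 2
    funext x
    simp [hJad]
    abel
  have hLu : γL - q.2.2 = u L := by
    obtain ⟨ψ, -, h⟩ := hadj (fun _ => 0) continuous_const (M.J (γL - q.2.2 - u L))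
    rw [cls_zero, inner_zero_left, real_inner_self_eq_norm_sq, eq_comm, sq_eq_zero_iff,
      norm_eq_zero] at h
    have := congrArg M.Jinv h
    rw [M.Jinv_J, map_zero] at this
    exact sub_eq_zero.mp this
  have hdu : d = cls L u := by
    refine sub_eq_zero.mp (eq_zero_of_forall_inner_cls fun ψ ψ' _ hψ => ?_)
    obtain ⟨_, -, h⟩ := hadj ψ (continuous_iff_continuousAt.mpr fun x => (hψ x).continuousAt) 0
    simpa using h
  -- Now `u` is a smooth state satisfying both boundary conditions and lies in the kernel of the
  -- resolvent map, so it vanishes together with its traces.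
  have hmem := M.mem_graph_of_classical (z := u) (z' := fun x => N (u x)) (by fun_prop) hud
    (by rw [hu0, map_sub, h0, M.graph_bc₀ q hq, sub_zero])
    (by rw [← hLu, map_sub, hL, M.graph_bcL q hq, ← hdu, hd, map_sub])
  have hz := M.eq_zero_of_resolventMap_eq_zero hmem one_pos (by
    rw [resolventMap_apply, hAu, sub_self])
  rw [hAu, ← hdu, hu0, ← hLu, ← hvd, hd] at hz
  convert hq using 1
  have h3 := congrArg (· + q) hz
  simpa [Prod.ext_iff, sub_eq_zero] using h3

/-- A closure of a graph could be multivalued. At the zero state the energy estimate kills both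
traces, and Green's formula then makes `v` orthogonal to every C¹ function. -/
theorem snd_eq_zero_of_mem_graph {v : L2 E L} {γ : E × E} (h : ((0, v), γ) ∈ M.graph) : v = 0 := by
  have hc := M.c_pos
  have h1 := M.graph_energy _ h
  simp only [map_zero, inner_zero_left, norm_zero] at h1
  have h2 : ‖γ.1‖ ^ 2 + ‖γ.2‖ ^ 2 ≤ 0 := by
    by_contra hcon
    push Not at hcon
    have := mul_pos hc hcon
    linarith
  have h3 : γ.1 = 0 := by
    rw [← norm_eq_zero]; nlinarith [sq_nonneg ‖γ.1‖, sq_nonneg ‖γ.2‖]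
  have h4 : γ.2 = 0 := by
    rw [← norm_eq_zero]; nlinarith [sq_nonneg ‖γ.1‖, sq_nonneg ‖γ.2‖]
  refine eq_zero_of_forall_inner_cls fun ψ ψ' hψ' hψ => ?_
  have := M.graph_green hψ' hψ _ h
  simp only [h3, h4, inner_zero_right, map_zero] at this
  linarith

/-- The shifted generator in the coordinates given by `Φ`. -/
noncomputable def generator : Submodule ℝ (L2 E L × L2 E L) :=
  M.graph.map (((M.Φ : L2 E L →L[ℝ] L2 E L) ∘L ContinuousLinearMap.fst ℝ _ _ ∘L
      ContinuousLinearMap.fst ℝ _ (E × E)).prod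
    ((M.Φ : L2 E L →L[ℝ] L2 E L) ∘L (ContinuousLinearMap.snd ℝ _ _
      - M.ω • ContinuousLinearMap.fst ℝ _ _) ∘L ContinuousLinearMap.fst ℝ _ (E × E)) :
      ((L2 E L × L2 E L) × (E × E)) →ₗ[ℝ] L2 E L × L2 E L)

theorem mem_generator {a : L2 E L × L2 E L} : a ∈ M.generator ↔
    ∃ q ∈ M.graph, a = (M.Φ q.1.1, M.Φ (q.1.2 - M.ω • q.1.1)) := by
  constructor
  · rintro ⟨q, hq, rfl⟩
    exact ⟨q, hq, rfl⟩
  · rintro ⟨q, hq, rfl⟩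
    exact ⟨q, hq, rfl⟩

theorem isMDissipative_generator : IsMDissipative M.generator where
  dissipative := by
    intro a ha μ hμ
    obtain ⟨q, hq, rfl⟩ := M.mem_generator.mp ha
    refine (M.graph_resolvent_le hq μ).trans_eq ?_
    rw [← map_smul, ← map_sub]
    congr 2
    module
  range := by
    intro μ hμ f
    obtain ⟨q, hq, hqf⟩ := M.exists_resolvent hμ (M.Φ.symm f)
    refine ⟨_, M.mem_generator.mpr ⟨q, hq, rfl⟩, ?_⟩
    rw [← map_smul, ← map_sub, ← M.Φ.apply_symm_apply f, ← hqf, resolventMap_apply]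
    congr 1
    module

/-- For `y` orthogonal to the domain, solve the resolvent equation with datum `y` and pair it with
its solution: coercivity makes the solution zero, and single-valuedness makes `y` zero. -/
theorem dense_domain_generator : Dense {u : L2 E L | ∃ v, (u, v) ∈ M.generator} := by
  let D : Submodule ℝ (L2 E L) := M.generator.map (LinearMap.fst ℝ _ _)
  have hD : (D : Set (L2 E L)) = {u : L2 E L | ∃ v, (u, v) ∈ M.generator} := by
    ext u
    simp [D]
  rw [← hD, ← dense_closure, ← Submodule.topologicalClosure_coe]
  suffices h : D.topologicalClosure = ⊤ by rw [h]; exact dense_univ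
  rw [← Submodule.orthogonal_eq_bot_iff, Submodule.eq_bot_iff]
  intro y hy
  rw [Submodule.orthogonal_closure] at hy
  obtain ⟨a, ha, hay⟩ := M.isMDissipative_generator.range 1 one_pos y
  obtain ⟨q, hq, rfl⟩ := M.mem_generator.mp ha
  have h1 : ⟪M.Φ q.1.1, y⟫ = 0 := hy _ ⟨_, ha, rfl⟩
  have h2 : M.Φ ((1 + M.ω) • q.1.1 - q.1.2) = y := by
    rw [← hay, one_smul, ← map_sub]
    congr 1
    module
  have h3 := M.graph_coercive_inner hq 1
  rw [h2, h1, one_mul] at h3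
  have hc := M.c_pos
  have h4 : ‖M.Φ q.1.1‖ ^ 2 ≤ 0 := by
    have : 0 ≤ M.c * (‖q.2.1‖ ^ 2 + ‖q.2.2‖ ^ 2) := by positivity
    linarith
  have h5 : q.1.1 = 0 := by
    rw [← M.Φ.map_eq_zero_iff, ← norm_eq_zero]
    nlinarith [norm_nonneg (M.Φ q.1.1)]
  have h6 : q.1.2 = 0 := by
    refine M.snd_eq_zero_of_mem_graph (γ := q.2) ?_
    rw [← h5]
    exact hq
  rw [← h2, h5, h6, smul_zero, sub_zero, map_zero]

/-- The evolution operators of the boundary value problem, with the smooth solutions. -/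
theorem exists_semigroup : ∃ T : ℝ → L2 E L →L[ℝ] L2 E L,
    (∀ u, T 0 u = u) ∧ (∀ a b, 0 ≤ a → 0 ≤ b → ∀ u, T (a + b) u = T a (T b u)) ∧
    (∀ t, 0 ≤ t → ∀ u, ‖M.Φ (T t u)‖ ≤ Real.exp (M.ω * t) * ‖M.Φ u‖) ∧
    (∀ u, ContinuousOn (fun t => T t u) (Ici 0)) ∧
    (∀ q ∈ M.graph, ∀ t, 0 ≤ t → (∃ γ, ((T t q.1.1, T t q.1.2), γ) ∈ M.graph) ∧
      HasDerivWithinAt (fun t => T t q.1.1) (T t q.1.2) (Ici 0) t) ∧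
    Dense {u : L2 E L | ∃ q ∈ M.graph, q.1.1 = u} := by
  obtain ⟨S, hS, hSG⟩ := M.isMDissipative_generator.exists_semigroup M.dense_domain_generator
  -- Conjugation by `Φ` and, below, the factor `exp (ω t)` undo the two normalizations made in
  -- `generator`.
  let T₁ : ℝ → L2 E L →L[ℝ] L2 E L := fun t =>
    (M.Φ.symm : L2 E L →L[ℝ] L2 E L) ∘L S t ∘L (M.Φ : L2 E L →L[ℝ] L2 E L)
  have hT₁ : ∀ t u, T₁ t u = M.Φ.symm (S t (M.Φ u)) := fun _ _ => rfl
  have hT₁c : ∀ u, ContinuousOn (fun t => T₁ t u) (Ici 0) := fun u =>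
    M.Φ.symm.continuous.comp_continuousOn (hS.cont (M.Φ u))
  refine ⟨fun t => Real.exp (M.ω * t) • T₁ t, fun u => ?_, fun a b ha hb u => ?_,
    fun t ht u => ?_, fun u => ?_, fun q hq t ht => ?_, ?_⟩
  · simp [hT₁, hS.zero]
  · simp only [_root_.smul_apply, map_smul, smul_smul, ← Real.exp_add, mul_add, hT₁,
      hS.add a b ha hb, M.Φ.apply_symm_apply]
    rw [add_comm]
  · rw [_root_.smul_apply, map_smul, norm_smul, Real.norm_of_nonneg (Real.exp_pos _).le, hT₁,
      M.Φ.apply_symm_apply]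
    gcongr
    exact hS.norm_le t ht _
  · exact ContinuousOn.smul (f := fun t => Real.exp (M.ω * t)) (by fun_prop) (hT₁c u)
  · obtain ⟨hmem, hder⟩ := hSG _ (M.mem_generator.mpr ⟨q, hq, rfl⟩) t ht
    have hval : M.Φ.symm (S t (M.Φ (q.1.2 - M.ω • q.1.1))) = T₁ t q.1.2 - M.ω • T₁ t q.1.1 := by
      rw [map_sub, map_sub, map_sub, map_smul, map_smul, map_smul]
      rfl
    constructor
    · obtain ⟨q', hq', he⟩ := M.mem_generator.mp hmem
      rw [Prod.ext_iff] at he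
      have h1 : T₁ t q.1.1 = q'.1.1 := by
        rw [hT₁]; exact (M.Φ.symm_apply_eq).mpr he.1
      have h2 : T₁ t q.1.2 = q'.1.2 := by
        have := (M.Φ.symm_apply_eq).mpr he.2
        rw [hval, h1] at this
        exact sub_left_injective this
      refine ⟨Real.exp (M.ω * t) • q'.2, ?_⟩
      rw [_root_.smul_apply, _root_.smul_apply, h1, h2]
      exact M.graph.smul_mem _ hq'
    · have h1 : HasDerivWithinAt (fun t => T₁ t q.1.1) (T₁ t q.1.2 - M.ω • T₁ t q.1.1) (Ici 0) t := by
        rw [← hval]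
        exact (M.Φ.symm : L2 E L →L[ℝ] L2 E L).hasFDerivAt.comp_hasDerivWithinAt t hder
      have h2 : HasDerivAt (fun t : ℝ => Real.exp (M.ω * t)) (Real.exp (M.ω * t) * M.ω) t := by
        simpa using ((hasDerivAt_id t).const_mul M.ω).exp
      have h3 := h2.hasDerivWithinAt (s := Ici 0) |>.fun_smul h1
      refine h3.congr_deriv ?_
      rw [_root_.smul_apply]
      module
  · have h1 : {u : L2 E L | ∃ q ∈ M.graph, q.1.1 = u}
        = M.Φ ⁻¹' {u : L2 E L | ∃ v, (u, v) ∈ M.generator} := by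
      ext u
      simp only [mem_ofPred_eq, mem_preimage, mem_generator]
      constructor
      · rintro ⟨q, hq, rfl⟩
        exact ⟨_, q, hq, rfl⟩
      · rintro ⟨v, q, hq, h⟩
        exact ⟨q, hq, (M.Φ.injective (congrArg Prod.fst h)).symm⟩
    rw [h1]
    exact M.dense_domain_generator.preimage M.Φ.toHomeomorph.isOpenMap

end HyperbolicBVP

/-! ### Weak solutions with traces, for data in the domain. -/

namespace HyperbolicBVP

variable {E F : Type*} [NormedAddCommGroup E] [InnerProductSpace ℝ E]
    [FiniteDimensional ℝ E] [NormedAddCommGroup F] [NormedSpace ℝ F] [FiniteDimensional ℝ F]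
    {L : ℝ} (M : HyperbolicBVP E F L)

/-- The representative of the interior terms of Green's formula with the test function `φ`. -/
noncomputable def testInterior (φ : ℝ → ℝ → E) (τ : ℝ) : L2 E L :=
  cls L (fun x => deriv (fun s => φ s x) τ) + M.adj (φ τ) (fun x => deriv (φ τ) x)

/-- The integrand of Green's formula with the test function `φ`. -/
noncomputable def greenRate (φ : ℝ → ℝ → E) (τ : ℝ) (z : L2 E L) (γ₀ γL : E) : ℝ :=
  ⟪M.testInterior φ τ, z⟫ - (⟪M.J.adjoint (φ τ L), γL⟫ - ⟪M.J.adjoint (φ τ 0), γ₀⟫)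

/-- Weak solutions, on the time interval `[a, b]`, of a boundary value problem whose coefficients
depend on time, with boundary traces `h₀` and `hL`. -/
structure IsWeakSolutionOn (M : ℝ → HyperbolicBVP E F L) (a b : ℝ) (z : ℝ → L2 E L)
    (h₀ hL : ℝ → E) : Prop where
  memLp₀ : MemLp h₀ 2 (volume.restrict (Ioc a b))
  memLpL : MemLp hL 2 (volume.restrict (Ioc a b))
  bc : ∀ᵐ t ∂(volume.restrict (Ioc a b)),
    (M t).bc₀ (h₀ t) = 0 ∧ (M t).bcL (hL t) = (M t).κ (z t)
  -- For an arbitrary dependence of `M` on time integrability is not automatic, and restriction and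
  -- concatenation have to split the integral in `green`.
  integrable : ∀ φ : ℝ → ℝ → E, ContDiff ℝ 1 (fun q : ℝ × ℝ => φ q.1 q.2) →
    IntegrableOn (fun τ => (M τ).greenRate φ τ (z τ) (h₀ τ) (hL τ)) (Ioc a b)
  green : ∀ φ : ℝ → ℝ → E, ContDiff ℝ 1 (fun q : ℝ × ℝ => φ q.1 q.2) → ∀ t ∈ Icc a b,
    ⟪cls L (φ t), z t⟫ - ⟪cls L (φ a), z a⟫
      = ∫ τ in a..t, (M τ).greenRate φ τ (z τ) (h₀ τ) (hL τ)

section TestFunctions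

variable {φ : ℝ → ℝ → E} (hφ : ContDiff ℝ 1 (fun q : ℝ × ℝ => φ q.1 q.2))

include hφ

omit [FiniteDimensional ℝ E] in
theorem hasDerivAt_time (t x : ℝ) :
    HasDerivAt (fun s => φ s x) (fderiv ℝ (fun q : ℝ × ℝ => φ q.1 q.2) (t, x) (1, 0)) t := by
  have h1 : HasFDerivAt (fun q : ℝ × ℝ => φ q.1 q.2) _ (t, x) :=
    (hφ.differentiable one_ne_zero (t, x)).hasFDerivAt
  exact h1.comp_hasDerivAt t ((hasDerivAt_id t).prodMk (hasDerivAt_const t x))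

omit [FiniteDimensional ℝ E] in
theorem hasDerivAt_space (t x : ℝ) :
    HasDerivAt (φ t) (fderiv ℝ (fun q : ℝ × ℝ => φ q.1 q.2) (t, x) (0, 1)) x := by
  have h1 : HasFDerivAt (fun q : ℝ × ℝ => φ q.1 q.2) _ (t, x) :=
    (hφ.differentiable one_ne_zero (t, x)).hasFDerivAt
  exact h1.comp_hasDerivAt x ((hasDerivAt_const x t).prodMk (hasDerivAt_id x))

omit [FiniteDimensional ℝ E] in
theorem continuous_deriv_time :
    Continuous fun q : ℝ × ℝ => deriv (fun s => φ s q.2) q.1 := by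
  have : (fun q : ℝ × ℝ => deriv (fun s => φ s q.2) q.1)
      = fun q => fderiv ℝ (fun q : ℝ × ℝ => φ q.1 q.2) q (1, 0) :=
    funext fun q => (hasDerivAt_time hφ q.1 q.2).deriv
  rw [this]
  exact (hφ.continuous_fderiv one_ne_zero).clm_apply continuous_const

omit [FiniteDimensional ℝ E] in
theorem continuous_deriv_space : Continuous fun q : ℝ × ℝ => deriv (φ q.1) q.2 := by
  have : (fun q : ℝ × ℝ => deriv (φ q.1) q.2)
      = fun q => fderiv ℝ (fun q : ℝ × ℝ => φ q.1 q.2) q (0, 1) :=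
    funext fun q => (hasDerivAt_space hφ q.1 q.2).deriv
  rw [this]
  exact (hφ.continuous_fderiv one_ne_zero).clm_apply continuous_const

theorem hasDerivAt_cls_test (t : ℝ) : HasDerivAt (fun s => cls L (φ s))
    (cls L fun x => deriv (fun s => φ s x) t) t :=
  hasDerivAt_cls hφ.continuous (continuous_deriv_time hφ)
    (fun t x => (hasDerivAt_time hφ t x).differentiableAt.hasDerivAt) t

theorem continuous_testInterior : Continuous (M.testInterior φ) := by
  refine (continuous_cls (g := fun t x => deriv (fun s => φ s x) t)
    (continuous_deriv_time hφ)).add ?_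
  refine continuous_cls (g := fun t x => M.J.adjoint (deriv (φ t) x) + M.S.adjoint (φ t x)) ?_
  have h1 := continuous_deriv_space hφ
  have h2 := hφ.continuous
  fun_prop

theorem continuous_testBoundary (x : ℝ) : Continuous fun τ => M.J.adjoint (φ τ x) := by
  have h2 : Continuous fun τ => φ τ x := hφ.continuous.comp (continuous_id.prodMk continuous_const)
  fun_prop

end TestFunctions

omit [FiniteDimensional ℝ E] in
theorem integrableOn_inner_of_memLp {f h : ℝ → E} (hf : Continuous f) {a b : ℝ}
    (hh : MemLp h 2 (volume.restrict (Ioc a b))) :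
    IntegrableOn (fun τ => ⟪f τ, h τ⟫) (Ioc a b) := by
  obtain ⟨C, hC⟩ := isCompact_Icc.exists_bound_of_continuousOn (s := Icc a b) hf.continuousOn
  have hf2 : MemLp f 2 (volume.restrict (Ioc a b)) :=
    MemLp.of_bound hf.aestronglyMeasurable C
      ((ae_restrict_mem measurableSet_Ioc).mono fun x hx => hC x (Ioc_subset_Icc_self hx))
  refine (L2.integrable_inner (𝕜 := ℝ) (hf2.toLp f) (hh.toLp h)).congr ?_
  filter_upwards [hf2.coeFn_toLp, hh.coeFn_toLp] with x h1 h2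
  rw [h1, h2]

theorem integrableOn_greenRate {φ : ℝ → ℝ → E} (hφ : ContDiff ℝ 1 (fun q : ℝ × ℝ => φ q.1 q.2))
    {a b : ℝ} {z : ℝ → L2 E L} (hz : ContinuousOn z (Icc a b)) {h₀ hL : ℝ → E}
    (hh₀ : MemLp h₀ 2 (volume.restrict (Ioc a b))) (hhL : MemLp hL 2 (volume.restrict (Ioc a b))) :
    IntegrableOn (fun τ => M.greenRate φ τ (z τ) (h₀ τ) (hL τ)) (Ioc a b) := by
  refine IntegrableOn.sub ?_ (IntegrableOn.sub ?_ ?_)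
  · refine IntegrableOn.mono_set ?_ Ioc_subset_Icc_self
    exact ((M.continuous_testInterior hφ).continuousOn.inner hz).integrableOn_Icc
  · exact integrableOn_inner_of_memLp (M.continuous_testBoundary hφ L) hhL
  · exact integrableOn_inner_of_memLp (M.continuous_testBoundary hφ 0) hh₀

/-- The evolution operators of a boundary value problem, see `exists_semigroup`. -/
structure IsEvolution (T : ℝ → L2 E L →L[ℝ] L2 E L) : Prop where
  zero : ∀ u, T 0 u = u
  add : ∀ a b, 0 ≤ a → 0 ≤ b → ∀ u, T (a + b) u = T a (T b u)
  norm_le : ∀ t, 0 ≤ t → ∀ u, ‖M.Φ (T t u)‖ ≤ Real.exp (M.ω * t) * ‖M.Φ u‖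
  cont : ∀ u, ContinuousOn (fun t => T t u) (Ici 0)
  graph : ∀ q ∈ M.graph, ∀ t, 0 ≤ t → (∃ γ, ((T t q.1.1, T t q.1.2), γ) ∈ M.graph) ∧
      HasDerivWithinAt (fun t => T t q.1.1) (T t q.1.2) (Ici 0) t
  dense : Dense {u : L2 E L | ∃ q ∈ M.graph, q.1.1 = u}

namespace IsEvolution

variable {M} {T : ℝ → L2 E L →L[ℝ] L2 E L} (hT : M.IsEvolution T)

include hT

/-- The difference of two graph elements is bounded by its resolvent image, which involves only the
states and their images; so the traces inherit their continuity in time. -/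
theorem exists_traces {q : (L2 E L × L2 E L) × (E × E)} (hq : q ∈ M.graph) :
    ∃ γ : ℝ → E × E, ContinuousOn γ (Ici 0) ∧
      ∀ t, 0 ≤ t → ((T t q.1.1, T t q.1.2), γ t) ∈ M.graph := by
  choose! γ hγ using fun t ht => (hT.graph q hq t ht).1
  refine ⟨γ, fun t ht => ?_, hγ⟩
  obtain ⟨C, hC⟩ := M.exists_norm_le_resolventMap one_pos
  rw [ContinuousWithinAt, tendsto_iff_norm_sub_tendsto_zero]
  refine squeeze_zero' (g := fun s => C * ‖M.resolventMap 1
      (((T s q.1.1, T s q.1.2), γ s) - ((T t q.1.1, T t q.1.2), γ t))‖)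
    (.of_forall fun _ => norm_nonneg _) ?_ ?_
  · filter_upwards [self_mem_nhdsWithin] with s hs
    have h := hC _ (M.graph.sub_mem (hγ s hs) (hγ t ht))
    exact (norm_snd_le (((T s q.1.1, T s q.1.2), γ s) - ((T t q.1.1, T t q.1.2), γ t))).trans h
  · have h1 : Tendsto (fun s => (C : ℝ) * ‖(1 + M.ω) • (T s q.1.1 - T t q.1.1)
        - (T s q.1.2 - T t q.1.2)‖) (𝓝[Ici 0] t)
        (𝓝 (C * ‖(1 + M.ω) • (T t q.1.1 - T t q.1.1) - (T t q.1.2 - T t q.1.2)‖)) :=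
      ((((hT.cont q.1.1 t ht).sub_const _).const_smul _).sub
        ((hT.cont q.1.2 t ht).sub_const _)).norm.const_mul _
    simpa [resolventMap_apply] using h1

/-- Hidden regularity: integrating the derivative of `exp (-2 ω t) ‖Φ z‖²` leaves the boundary
dissipation, which bounds the traces in L² of time by the norm of the initial state alone, with no
derivative. -/
theorem integral_traces_le {q : (L2 E L × L2 E L) × (E × E)} {γ : ℝ → E × E}
    (hγc : ContinuousOn γ (Ici 0)) (hq : q ∈ M.graph)
    (hγ : ∀ t, 0 ≤ t → ((T t q.1.1, T t q.1.2), γ t) ∈ M.graph) {b : ℝ} (hb : 0 ≤ b) :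
    2 * M.c * Real.exp (-(2 * M.ω * b)) * ∫ t in (0 : ℝ)..b, (‖(γ t).1‖ ^ 2 + ‖(γ t).2‖ ^ 2)
      ≤ ‖M.Φ q.1.1‖ ^ 2 := by
  have hsub : Icc 0 b ⊆ Ici (0 : ℝ) := Icc_subset_Ici_self
  have hΦc : ∀ u, ContinuousOn (fun t => M.Φ (T t u)) (Ici 0) := fun u =>
    M.Φ.continuous.comp_continuousOn (hT.cont u)
  have hΦd : ∀ t, 0 ≤ t → HasDerivWithinAt (fun t => M.Φ (T t q.1.1)) (M.Φ (T t q.1.2)) (Ici 0) t :=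
    fun t ht => (M.Φ : L2 E L →L[ℝ] L2 E L).hasFDerivAt.comp_hasDerivWithinAt t
      (hT.graph q hq t ht).2
  have hnc : ContinuousOn (fun t => ‖(γ t).1‖ ^ 2 + ‖(γ t).2‖ ^ 2) (Ici 0) := by fun_prop
  let g : ℝ → ℝ := fun t => -(Real.exp (-(2 * M.ω * t)) * ‖M.Φ (T t q.1.1)‖ ^ 2)
  let g' : ℝ → ℝ := fun t => -(-(2 * M.ω) * Real.exp (-(2 * M.ω * t)) * ‖M.Φ (T t q.1.1)‖ ^ 2
    + Real.exp (-(2 * M.ω * t)) * (2 * ⟪M.Φ (T t q.1.1), M.Φ (T t q.1.2)⟫))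
  have hg : ∀ t, 0 ≤ t → HasDerivWithinAt g (g' t) (Ici 0) t := by
    intro t ht
    have h1 : HasDerivAt (fun t : ℝ => Real.exp (-(2 * M.ω * t)))
        (-(2 * M.ω) * Real.exp (-(2 * M.ω * t))) t := by
      have := ((hasDerivAt_id t).const_mul (2 * M.ω)).neg.exp
      convert! this using 1
      simp [mul_comm]
    exact (h1.hasDerivWithinAt.mul (hΦd t ht).norm_sq).neg
  have hle : ∀ t ∈ Ioo 0 b,
      2 * M.c * Real.exp (-(2 * M.ω * b)) * (‖(γ t).1‖ ^ 2 + ‖(γ t).2‖ ^ 2) ≤ g' t := by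
    intro t ht
    have h1 := M.graph_energy _ (hγ t ht.1.le)
    have hc := M.c_pos
    have hω := M.ω_nonneg
    have h2 : Real.exp (-(2 * M.ω * b)) ≤ Real.exp (-(2 * M.ω * t)) := by
      apply Real.exp_le_exp.mpr
      nlinarith [ht.2]
    have h3 : 0 < Real.exp (-(2 * M.ω * t)) := Real.exp_pos _
    have h4 : 0 ≤ ‖(γ t).1‖ ^ 2 + ‖(γ t).2‖ ^ 2 := by positivity
    calc 2 * M.c * Real.exp (-(2 * M.ω * b)) * (‖(γ t).1‖ ^ 2 + ‖(γ t).2‖ ^ 2)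
        ≤ 2 * M.c * Real.exp (-(2 * M.ω * t)) * (‖(γ t).1‖ ^ 2 + ‖(γ t).2‖ ^ 2) := by gcongr
      _ ≤ g' t := by
        simp only [g']
        nlinarith
  have h5 := intervalIntegral.integral_le_sub_of_hasDeriv_right_of_le hb (g := g) (g' := g')
    (φ := fun t => 2 * M.c * Real.exp (-(2 * M.ω * b)) * (‖(γ t).1‖ ^ 2 + ‖(γ t).2‖ ^ 2))
    (fun t ht => ((hg t ht.1).continuousWithinAt).mono hsub)
    (fun t ht => (hg t ht.1.le).mono fun s hs => ht.1.le.trans (le_of_lt hs))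
    ((hnc.mono hsub).const_smul (2 * M.c * Real.exp (-(2 * M.ω * b)))).integrableOn_Icc hle
  rw [intervalIntegral.integral_const_mul] at h5
  refine h5.trans ?_
  simp only [g, hT.zero]
  have : 0 ≤ Real.exp (-(2 * M.ω * b)) * ‖M.Φ (T b q.1.1)‖ ^ 2 := by positivity
  simp
  linarith

/-- In the domain the pairing with a test function is differentiable in time, and Green's formula in
space identifies its derivative with `greenRate`. -/
theorem isWeakSolutionOn_of_graph {q : (L2 E L × L2 E L) × (E × E)} {γ : ℝ → E × E}
    (hγc : ContinuousOn γ (Ici 0)) (hq : q ∈ M.graph)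
    (hγ : ∀ t, 0 ≤ t → ((T t q.1.1, T t q.1.2), γ t) ∈ M.graph) (b : ℝ) :
    IsWeakSolutionOn (fun _ => M) 0 b (fun t => T t q.1.1) (fun t => (γ t).1) (fun t => (γ t).2) := by
  have hsub : Icc 0 b ⊆ Ici (0 : ℝ) := Icc_subset_Ici_self
  have hmem : ∀ {h : ℝ → E}, ContinuousOn h (Ici 0) → MemLp h 2 (volume.restrict (Ioc 0 b)) := by
    intro h hh
    obtain ⟨C, hC⟩ := isCompact_Icc.exists_bound_of_continuousOn (hh.mono hsub)
    refine MemLp.of_bound ((hh.mono (Ioc_subset_Icc_self.trans hsub)).aestronglyMeasurable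
      measurableSet_Ioc) C ?_
    exact (ae_restrict_mem measurableSet_Ioc).mono fun x hx => hC x (Ioc_subset_Icc_self hx)
  have h1 : MemLp (fun t => (γ t).1) 2 (volume.restrict (Ioc 0 b)) := hmem (by fun_prop)
  have h2 : MemLp (fun t => (γ t).2) 2 (volume.restrict (Ioc 0 b)) := hmem (by fun_prop)
  refine ⟨h1, h2, ?_, fun φ hφ => M.integrableOn_greenRate hφ ((hT.cont _).mono hsub) h1 h2,
    fun φ hφ t ht => ?_⟩
  · filter_upwards [ae_restrict_mem measurableSet_Ioc] with t ht
    exact ⟨M.graph_bc₀ _ (hγ t ht.1.le), M.graph_bcL _ (hγ t ht.1.le)⟩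
  · have hd : ∀ τ, 0 ≤ τ → HasDerivWithinAt (fun τ => ⟪cls L (φ τ), T τ q.1.1⟫)
        (M.greenRate φ τ (T τ q.1.1) (γ τ).1 (γ τ).2) (Ici 0) τ := by
      intro τ hτ
      have h3 := ((hasDerivAt_cls_test (L := L) hφ τ).hasDerivWithinAt).inner ℝ
        (hT.graph q hq τ hτ).2
      refine h3.congr_deriv ?_
      have hsp : ∀ x, HasDerivAt (φ τ) (deriv (φ τ) x) x := fun x =>
        (hasDerivAt_space hφ τ x).differentiableAt.hasDerivAt
      have h4 := M.graph_green (ψ := φ τ) (ψ' := fun x => deriv (φ τ) x) ((continuous_deriv_space hφ).comp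
        (continuous_const.prodMk continuous_id)) hsp _ (hγ τ hτ)
      rw [greenRate, testInterior, inner_add_left, ContinuousLinearMap.adjoint_inner_left,
        ContinuousLinearMap.adjoint_inner_left]
      simp only at h4
      linarith
    rw [intervalIntegral.integral_eq_sub_of_hasDeriv_right_of_le ht.1
      (f := fun τ => ⟪cls L (φ τ), T τ q.1.1⟫)
      (fun τ hτ => ((hd τ hτ.1).continuousWithinAt).mono Icc_subset_Ici_self)
      (fun τ hτ => (hd τ hτ.1.le).mono fun s hs => hτ.1.le.trans (le_of_lt hs))]
    rw [intervalIntegrable_iff_integrableOn_Ioc_of_le ht.1]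
    exact (M.integrableOn_greenRate hφ ((hT.cont _).mono hsub) h1 h2).mono_set
      (Ioc_subset_Ioc_right ht.2)

end IsEvolution

end HyperbolicBVP

/-! ### Weak solutions for L² data: existence, gluing, uniqueness. -/

namespace HyperbolicBVP

variable {E F : Type*} [NormedAddCommGroup E] [InnerProductSpace ℝ E]
    [FiniteDimensional ℝ E] [NormedAddCommGroup F] [NormedSpace ℝ F] [FiniteDimensional ℝ F]
    {L : ℝ} (M : HyperbolicBVP E F L)

-- The integral up to `t` is the inner product with the test function truncated at `t`.
omit [FiniteDimensional ℝ E] in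
theorem tendsto_integral_inner_of_tendsto_Lp {a b t : ℝ} (ht : t ≤ b) {f : ℝ → E}
    (hf : Continuous f) {G : ℕ → Lp E 2 (volume.restrict (Ioc a b))}
    {G' : Lp E 2 (volume.restrict (Ioc a b))} (hG : Tendsto G atTop (𝓝 G')) :
    Tendsto (fun n => ∫ τ in Ioc a t, ⟪f τ, G n τ⟫) atTop (𝓝 (∫ τ in Ioc a t, ⟪f τ, G' τ⟫)) := by
  obtain ⟨C, hC⟩ := isCompact_Icc.exists_bound_of_continuousOn (s := Icc a b) hf.continuousOn
  have hf2 : MemLp f 2 (volume.restrict (Ioc a b)) :=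
    MemLp.of_bound hf.aestronglyMeasurable C
      ((ae_restrict_mem measurableSet_Ioc).mono fun x hx => hC x (Ioc_subset_Icc_self hx))
  have hf3 : MemLp ((Ioc a t).indicator f) 2 (volume.restrict (Ioc a b)) :=
    hf2.indicator measurableSet_Ioc
  have key : ∀ g : Lp E 2 (volume.restrict (Ioc a b)),
      ∫ τ in Ioc a t, ⟪f τ, g τ⟫ = ⟪hf3.toLp _, g⟫ := by
    intro g
    have hsub : volume.restrict (Ioc a t) = (volume.restrict (Ioc a b)).restrict (Ioc a t) := by
      rw [Measure.restrict_restrict measurableSet_Ioc, Ioc_inter_Ioc, max_self, min_eq_left ht]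
    rw [L2.inner_def, hsub, ← integral_indicator measurableSet_Ioc]
    refine integral_congr_ae ?_
    filter_upwards [hf3.coeFn_toLp] with x hx
    rw [hx]
    by_cases hxt : x ∈ Ioc a t
    · rw [indicator_of_mem hxt, indicator_of_mem hxt]
    · rw [indicator_of_notMem hxt, indicator_of_notMem hxt, inner_zero_left]
  simp only [key]
  exact Tendsto.inner tendsto_const_nhds hG

theorem integral_greenRate {φ : ℝ → ℝ → E} (hφ : ContDiff ℝ 1 (fun q : ℝ × ℝ => φ q.1 q.2))
    {a b : ℝ} {z : ℝ → L2 E L} (hz : ContinuousOn z (Icc a b)) {h₀ hL : ℝ → E}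
    (hh₀ : MemLp h₀ 2 (volume.restrict (Ioc a b))) (hhL : MemLp hL 2 (volume.restrict (Ioc a b)))
    {t : ℝ} (ht : t ∈ Icc a b) :
    ∫ τ in a..t, M.greenRate φ τ (z τ) (h₀ τ) (hL τ)
      = (∫ τ in a..t, ⟪M.testInterior φ τ, z τ⟫)
        - ((∫ τ in Ioc a t, ⟪M.J.adjoint (φ τ L), hL τ⟫)
          - ∫ τ in Ioc a t, ⟪M.J.adjoint (φ τ 0), h₀ τ⟫) := by
  have i1 := (integrableOn_inner_of_memLp (M.continuous_testBoundary hφ L) hhL).mono_set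
    (Ioc_subset_Ioc_right ht.2)
  have i2 := (integrableOn_inner_of_memLp (M.continuous_testBoundary hφ 0) hh₀).mono_set
    (Ioc_subset_Ioc_right ht.2)
  have i3 : IntegrableOn (fun τ => ⟪M.testInterior φ τ, z τ⟫) (Ioc a t) :=
    (((M.continuous_testInterior hφ).continuousOn.inner
      hz).integrableOn_Icc).mono_set (Ioc_subset_Icc_self.trans (Icc_subset_Icc_right ht.2))
  rw [intervalIntegral.integral_of_le ht.1, intervalIntegral.integral_of_le ht.1,
    ← integral_sub i1 i2]
  exact integral_sub i3 (i1.sub i2)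

theorem cauchySeq_of_norm_sub_le {X Y : Type*} [NormedAddCommGroup X] [NormedAddCommGroup Y]
    {u : ℕ → X} {v : ℕ → Y} {K : ℝ} (hv : CauchySeq v)
    (h : ∀ m n, ‖u m - u n‖ ≤ K * ‖v m - v n‖) : CauchySeq u := by
  rw [Metric.cauchySeq_iff] at hv ⊢
  intro ε hε
  obtain ⟨N, hN⟩ := hv (ε / (|K| + 1)) (by positivity)
  refine ⟨N, fun m hm n hn => ?_⟩
  have h1 := hN m hm n hn
  rw [dist_eq_norm, lt_div_iff₀ (by positivity)] at h1
  rw [dist_eq_norm]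
  have h2 := mul_le_mul_of_nonneg_right (le_abs_self K) (norm_nonneg (v m - v n))
  nlinarith [h m n, norm_nonneg (v m - v n)]

theorem exists_norm_Φ_le : ∃ a : ℝ, 0 ≤ a ∧ ∀ z, ‖M.Φ z‖ ≤ a * ‖z‖ :=
  ⟨_, norm_nonneg _, (M.Φ : L2 E L →L[ℝ] L2 E L).le_opNorm⟩

theorem exists_le_norm_Φ : ∃ a : ℝ, 0 ≤ a ∧ ∀ z, ‖z‖ ≤ a * ‖M.Φ z‖ :=
  ⟨_, norm_nonneg _, fun z => by
    simpa using (M.Φ.symm : L2 E L →L[ℝ] L2 E L).le_opNorm (M.Φ z)⟩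

namespace IsEvolution

variable {M} {T : ℝ → L2 E L →L[ℝ] L2 E L} (hT : M.IsEvolution T)

include hT

theorem exists_bound (b : ℝ) : ∃ K : ℝ, 0 ≤ K ∧ ∀ t ∈ Icc 0 b, ∀ u, ‖T t u‖ ≤ K * ‖u‖ := by
  obtain ⟨a, ha, h1⟩ := M.exists_norm_Φ_le
  obtain ⟨a', ha', h2⟩ := M.exists_le_norm_Φ
  refine ⟨a' * (Real.exp (M.ω * b) * a), by positivity, fun t ht u => ?_⟩
  have hω := M.ω_nonneg
  calc ‖T t u‖ ≤ a' * ‖M.Φ (T t u)‖ := h2 _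
    _ ≤ a' * (Real.exp (M.ω * t) * ‖M.Φ u‖) := by gcongr; exact hT.norm_le t ht.1 u
    _ ≤ a' * (Real.exp (M.ω * b) * (a * ‖u‖)) := by
        gcongr
        · exact ht.2
        · exact h1 u
    _ = a' * (Real.exp (M.ω * b) * a) * ‖u‖ := by ring

/-- Every initial state has a weak solution. -/
theorem exists_isWeakSolutionOn_zero (u : L2 E L) {b : ℝ} (hb : 0 ≤ b) :
    ∃ h₀ hL, IsWeakSolutionOn (fun _ => M) 0 b (fun t => T t u) h₀ hL := by
  obtain ⟨v, hv, hvu⟩ := mem_closure_iff_seq_limit.mp (hT.dense u)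
  choose q hq hqv using hv
  choose γ hγc hγ using fun n => hT.exists_traces (hq n)
  have hsol := fun n => hT.isWeakSolutionOn_of_graph (hγc n) (hq n) (hγ n) b
  obtain ⟨a, ha, hΦ⟩ := M.exists_norm_Φ_le
  have hc := M.c_pos
  set K : ℝ := 2 * M.c * Real.exp (-(2 * M.ω * b)) with hK
  have hKpos : 0 < K := by positivity
  -- The trace estimate applied to differences of the approximating solutions makes their traces
  -- Cauchy in L²; `p` stands for either projection.
  have hcomp : ∀ (p : E × E → E), Continuous p → (∀ x y, p (x - y) = p x - p y) →
      (∀ x, ‖p x‖ ^ 2 ≤ ‖x.1‖ ^ 2 + ‖x.2‖ ^ 2) →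
      (hm : ∀ n, MemLp (fun t => p (γ n t)) 2 (volume.restrict (Ioc 0 b))) →
      CauchySeq fun n => (hm n).toLp (fun t => p (γ n t)) := by
    intro p hpc hp hpn hm
    refine cauchySeq_of_norm_sub_le (K := a / √K) hvu.cauchySeq fun m n => ?_
    have h1 := hT.integral_traces_le (q := q m - q n) (γ := fun t => γ m t - γ n t)
      ((hγc m).sub (hγc n)) (M.graph.sub_mem (hq m) (hq n)) (fun t ht => by
        have := M.graph.sub_mem (hγ m t ht) (hγ n t ht)
        simpa using this) hb
    rw [← hK] at h1
    have h2 : ‖(hm m).toLp (fun t => p (γ m t)) - (hm n).toLp (fun t => p (γ n t))‖ ^ 2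
        ≤ ∫ t in (0 : ℝ)..b, (‖(γ m t - γ n t).1‖ ^ 2 + ‖(γ m t - γ n t).2‖ ^ 2) := by
      rw [← MemLp.toLp_sub, ← real_inner_self_eq_norm_sq, L2.inner_def,
        intervalIntegral.integral_of_le hb]
      refine integral_mono_ae (L2.integrable_inner _ _) ?_ ?_
      · refine IntegrableOn.mono_set (ContinuousOn.integrableOn_Icc ?_) Ioc_subset_Icc_self
        have h3 := (hγc m).mono (Icc_subset_Ici_self (a := b) (b := 0))
        have h4 := (hγc n).mono (Icc_subset_Ici_self (a := b) (b := 0))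
        fun_prop
      · filter_upwards [((hm m).sub (hm n)).coeFn_toLp] with t ht
        rw [ht, Pi.sub_apply, ← hp, real_inner_self_eq_norm_sq]
        exact hpn _
    have h5 : ‖M.Φ (q m - q n).1.1‖ ≤ a * ‖v m - v n‖ := by
      rw [← hqv m, ← hqv n]; exact hΦ _
    rw [div_mul_eq_mul_div, le_div_iff₀ (by positivity)]
    refine le_of_sq_le_sq ?_ (by positivity)
    rw [mul_pow, Real.sq_sqrt hKpos.le, mul_comm]
    calc K * _ ≤ K * _ := by gcongr
      _ ≤ _ := h1
      _ ≤ _ := by gcongr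
  have hm₀ := fun n => (hsol n).memLp₀
  have hmL := fun n => (hsol n).memLpL
  obtain ⟨H₀, hH₀⟩ := cauchySeq_tendsto_of_complete (hcomp Prod.fst continuous_fst
    (fun _ _ => rfl) (fun x => by linarith [sq_nonneg ‖x.2‖]) hm₀)
  obtain ⟨HL, hHL⟩ := cauchySeq_tendsto_of_complete (hcomp Prod.snd continuous_snd
    (fun _ _ => rfl) (fun x => by linarith [sq_nonneg ‖x.1‖]) hmL)
  have hcont : ContinuousOn (fun t => T t u) (Icc 0 b) := (hT.cont u).mono Icc_subset_Ici_self
  have hTv : ∀ t, Tendsto (fun n => T t (v n)) atTop (𝓝 (T t u)) := fun t =>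
    ((T t).continuous.tendsto u).comp hvu
  refine ⟨H₀, HL, Lp.memLp H₀, Lp.memLp HL, ?_, fun φ hφ =>
    M.integrableOn_greenRate hφ hcont (Lp.memLp H₀) (Lp.memLp HL), fun φ hφ t ht => ?_⟩
  -- Convergence in L² gives convergence almost everywhere along subsequences. They may differ at
  -- the two ends, since no boundary condition couples the two traces.
  · obtain ⟨n₀, -, hn₀⟩ := (tendstoInMeasure_of_tendsto_Lp hH₀).exists_seq_tendsto_ae
    obtain ⟨nL, hnLm, hnL⟩ := (tendstoInMeasure_of_tendsto_Lp hHL).exists_seq_tendsto_ae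
    have hb' : ∀ n, ∀ᵐ t ∂(volume.restrict (Ioc 0 b)),
        M.bc₀ ((hm₀ n).toLp _ t) = 0 ∧ M.bcL ((hmL n).toLp _ t) = M.κ (T t (v n)) := by
      intro n
      filter_upwards [(hsol n).bc, (hm₀ n).coeFn_toLp, (hmL n).coeFn_toLp] with t h1 h2 h3
      rw [h2, h3, ← hqv n]
      exact h1
    filter_upwards [hn₀, hnL, ae_all_iff.mpr hb'] with t h1 h2 h3
    constructor
    · refine tendsto_nhds_unique ((M.bc₀.continuous.tendsto _).comp h1) ?_
      exact tendsto_const_nhds.congr fun n => ((h3 (n₀ n)).1).symm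
    · refine tendsto_nhds_unique ((M.bcL.continuous.tendsto _).comp h2) ?_
      refine ((M.κ.continuous.tendsto _).comp ((hTv t).comp hnLm.tendsto_atTop)).congr fun n => ?_
      exact ((h3 (nL n)).2).symm
  · have hlhs : Tendsto (fun n => ⟪cls L (φ t), T t (v n)⟫ - ⟪cls L (φ 0), T 0 (v n)⟫) atTop
        (𝓝 (⟪cls L (φ t), T t u⟫ - ⟪cls L (φ 0), T 0 u⟫)) :=
      (tendsto_const_nhds.inner (hTv t)).sub (tendsto_const_nhds.inner (hTv 0))
    refine tendsto_nhds_unique hlhs ?_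
    rw [M.integral_greenRate hφ hcont (Lp.memLp H₀) (Lp.memLp HL) ht]
    have heq : ∀ n, ⟪cls L (φ t), T t (v n)⟫ - ⟪cls L (φ 0), T 0 (v n)⟫
        = (∫ τ in (0 : ℝ)..t, ⟪M.testInterior φ τ, T τ (v n)⟫)
            - ((∫ τ in Ioc 0 t, ⟪M.J.adjoint (φ τ L), (hmL n).toLp _ τ⟫)
              - ∫ τ in Ioc 0 t, ⟪M.J.adjoint (φ τ 0), (hm₀ n).toLp _ τ⟫) := by
      intro n
      have h1 := (hsol n).green φ hφ t ht
      simp only [hqv] at h1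
      rw [h1, ← M.integral_greenRate hφ ((hT.cont (v n)).mono Icc_subset_Ici_self) (Lp.memLp _)
        (Lp.memLp _) ht, intervalIntegral.integral_of_le ht.1,
        intervalIntegral.integral_of_le ht.1]
      refine integral_congr_ae ?_
      refine ae_restrict_of_ae_restrict_of_subset (Ioc_subset_Ioc_right ht.2) ?_
      filter_upwards [(hm₀ n).coeFn_toLp, (hmL n).coeFn_toLp] with τ h2 h3
      rw [h2, h3]
    simp only [heq]
    refine Tendsto.sub ?_ (Tendsto.sub ?_ ?_)
    · obtain ⟨K', hK', hKT⟩ := hT.exists_bound t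
      obtain ⟨A, hA⟩ := isCompact_Icc.exists_bound_of_continuousOn (s := Icc 0 t)
        (M.continuous_testInterior hφ).continuousOn
      obtain ⟨R, hR⟩ := (Metric.isBounded_range_of_tendsto v hvu).exists_norm_le
      refine intervalIntegral.tendsto_integral_filter_of_dominated_convergence
        (fun _ => A * (K' * R)) (.of_forall fun n => ?_) (.of_forall fun n => .of_forall
          fun τ hτ => ?_) (by simp) (.of_forall fun τ _ => tendsto_const_nhds.inner (hTv τ))
      · rw [uIoc_of_le ht.1]
        refine ContinuousOn.aestronglyMeasurable ?_ measurableSet_Ioc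
        exact (M.continuous_testInterior hφ).continuousOn.inner
          ((hT.cont (v n)).mono fun x hx => hx.1.le)
      · rw [uIoc_of_le ht.1] at hτ
        have hτ' := Ioc_subset_Icc_self hτ
        refine (norm_inner_le_norm _ _).trans ?_
        have h1 : ‖T τ (v n)‖ ≤ K' * R :=
          (hKT τ hτ' _).trans (mul_le_mul_of_nonneg_left (hR _ ⟨n, rfl⟩) hK')
        exact mul_le_mul (hA τ hτ') h1 (norm_nonneg _) ((norm_nonneg _).trans (hA τ hτ'))
    · exact tendsto_integral_inner_of_tendsto_Lp ht.2 (M.continuous_testBoundary hφ L) hHL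
    · exact tendsto_integral_inner_of_tendsto_Lp ht.2 (M.continuous_testBoundary hφ 0) hH₀

end IsEvolution

namespace IsWeakSolutionOn

variable {N : ℝ → HyperbolicBVP E F L} {M}

/-- Restriction of a weak solution to a smaller time interval. -/
theorem mono {a b a' b' : ℝ} {z : ℝ → L2 E L} {h₀ hL : ℝ → E} (h : IsWeakSolutionOn N a b z h₀ hL)
    (ha : a ≤ a') (hab : a' ≤ b') (hb : b' ≤ b) : IsWeakSolutionOn N a' b' z h₀ hL := by
  have hsub : Ioc a' b' ⊆ Ioc a b := Ioc_subset_Ioc ha hb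
  refine ⟨h.memLp₀.mono_measure (Measure.restrict_mono hsub le_rfl),
    h.memLpL.mono_measure (Measure.restrict_mono hsub le_rfl),
    ae_restrict_of_ae_restrict_of_subset hsub h.bc, fun φ hφ => (h.integrable φ hφ).mono_set hsub,
    fun φ hφ t ht => ?_⟩
  have h1 := h.green φ hφ t ⟨ha.trans ht.1, ht.2.trans hb⟩
  have h2 := h.green φ hφ a' ⟨ha, hab.trans hb⟩
  have i1 : IntervalIntegrable (fun τ => (N τ).greenRate φ τ (z τ) (h₀ τ) (hL τ)) volume a a' :=
    (intervalIntegrable_iff_integrableOn_Ioc_of_le ha).mpr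
      ((h.integrable φ hφ).mono_set (Ioc_subset_Ioc_right (hab.trans hb)))
  have i2 : IntervalIntegrable (fun τ => (N τ).greenRate φ τ (z τ) (h₀ τ) (hL τ)) volume a' t :=
    (intervalIntegrable_iff_integrableOn_Ioc_of_le ht.1).mpr
      ((h.integrable φ hφ).mono_set (Ioc_subset_Ioc ha (ht.2.trans hb)))
  rw [← intervalIntegral.integral_add_adjacent_intervals i1 i2, ← h2] at h1
  linarith

/-- Weak solutions depend only on the values in the interior of the time interval. -/
theorem congr {N' : ℝ → HyperbolicBVP E F L} {a b : ℝ} {z z' : ℝ → L2 E L} {h₀ hL h₀' hL' : ℝ → E}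
    (h : IsWeakSolutionOn N a b z h₀ hL) (hN : ∀ t ∈ Ioo a b, N t = N' t)
    (hz : ∀ t ∈ Icc a b, z t = z' t) (hh₀ : ∀ t ∈ Ioo a b, h₀ t = h₀' t)
    (hhL : ∀ t ∈ Ioo a b, hL t = hL' t) : IsWeakSolutionOn N' a b z' h₀' hL' := by
  have hae : ∀ᵐ t ∂(volume.restrict (Ioc a b)), t ∈ Ioo a b := by
    rw [← restrict_Ioo_eq_restrict_Ioc]
    exact ae_restrict_mem measurableSet_Ioo
  have hrate : ∀ φ : ℝ → ℝ → E, ∀ t ∈ Ioo a b, (N t).greenRate φ t (z t) (h₀ t) (hL t)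
      = (N' t).greenRate φ t (z' t) (h₀' t) (hL' t) := fun φ t ht => by
    rw [hN t ht, hz t (Ioo_subset_Icc_self ht), hh₀ t ht, hhL t ht]
  refine ⟨h.memLp₀.ae_eq (hae.mono hh₀), h.memLpL.ae_eq (hae.mono hhL), ?_, fun φ hφ => ?_,
    fun φ hφ t ht => ?_⟩
  · filter_upwards [hae, h.bc] with t ht h1
    rwa [← hN t ht, ← hh₀ t ht, ← hhL t ht, ← hz t (Ioo_subset_Icc_self ht)]
  · exact (h.integrable φ hφ).congr (hae.mono (hrate φ))
  · rw [← hz t ht, ← hz a ⟨le_rfl, ht.1.trans ht.2⟩, h.green φ hφ t ht,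
      intervalIntegral.integral_of_le ht.1, intervalIntegral.integral_of_le ht.1]
    exact integral_congr_ae (ae_restrict_of_ae_restrict_of_subset (Ioc_subset_Ioc_right ht.2)
      (hae.mono (hrate φ)))

/-- Concatenation of weak solutions. -/
theorem trans {a b c : ℝ} (hab : a ≤ b) (hbc : b ≤ c) {z : ℝ → L2 E L} {h₀ hL : ℝ → E}
    (h1 : IsWeakSolutionOn N a b z h₀ hL) (h2 : IsWeakSolutionOn N b c z h₀ hL) :
    IsWeakSolutionOn N a c z h₀ hL := by
  have hU : Ioc a c = Ioc a b ∪ Ioc b c := (Ioc_union_Ioc_eq_Ioc hab hbc).symm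
  have hmem : ∀ {h : ℝ → E}, MemLp h 2 (volume.restrict (Ioc a b)) →
      MemLp h 2 (volume.restrict (Ioc b c)) → MemLp h 2 (volume.restrict (Ioc a c)) := by
    intro h h1 h2
    have hm : AEStronglyMeasurable h (volume.restrict (Ioc a c)) := by
      rw [hU]
      exact (aestronglyMeasurable_union_iff).mpr ⟨h1.1, h2.1⟩
    refine (memLp_two_iff_integrable_sq_norm hm).mpr ?_
    rw [hU]
    exact IntegrableOn.union ((memLp_two_iff_integrable_sq_norm h1.1).mp h1)
      ((memLp_two_iff_integrable_sq_norm h2.1).mp h2)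
  refine ⟨hmem h1.memLp₀ h2.memLp₀, hmem h1.memLpL h2.memLpL, ?_, fun φ hφ => ?_,
    fun φ hφ t ht => ?_⟩
  · rw [hU, ae_restrict_union_iff]
    exact ⟨h1.bc, h2.bc⟩
  · rw [hU]
    exact (h1.integrable φ hφ).union (h2.integrable φ hφ)
  · rcases le_total t b with htb | htb
    · exact h1.green φ hφ t ⟨ht.1, htb⟩
    · have h3 := h1.green φ hφ b ⟨hab, le_rfl⟩
      have h4 := h2.green φ hφ t ⟨htb, ht.2⟩
      rw [← intervalIntegral.integral_add_adjacent_intervals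
        ((intervalIntegrable_iff_integrableOn_Ioc_of_le hab).mpr (h1.integrable φ hφ))
        ((intervalIntegrable_iff_integrableOn_Ioc_of_le htb).mpr
          ((h2.integrable φ hφ).mono_set (Ioc_subset_Ioc_right ht.2))), ← h3, ← h4]
      ring

theorem shift {b a : ℝ} {z : ℝ → L2 E L} {h₀ hL : ℝ → E}
    (h : IsWeakSolutionOn (fun _ => M) 0 (b - a) z h₀ hL) :
    IsWeakSolutionOn (fun _ => M) a b (fun t => z (t - a)) (fun t => h₀ (t - a))
      (fun t => hL (t - a)) := by
  have hmp : MeasurePreserving (fun t : ℝ => t - a) (volume.restrict (Ioc a b))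
      (volume.restrict (Ioc 0 (b - a))) := by
    have h1 := (measurePreserving_sub_right volume a).restrict_preimage
      (s := Ioc 0 (b - a)) measurableSet_Ioc
    have h2 : (fun t : ℝ => t - a) ⁻¹' Ioc 0 (b - a) = Ioc a b := by simp
    rwa [h2] at h1
  have hrate : ∀ φ : ℝ → ℝ → E, ∀ t, M.greenRate (fun s x => φ (s + a) x) (t - a) (z (t - a))
      (h₀ (t - a)) (hL (t - a)) = M.greenRate φ t (z (t - a)) (h₀ (t - a)) (hL (t - a)) := by
    intro φ t
    simp only [greenRate, testInterior, sub_add_cancel]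
    have : ∀ x, deriv (fun s => φ (s + a) x) (t - a) = deriv (fun s => φ s x) t := fun x => by
      rw [deriv_comp_add_const (fun s => φ s x), sub_add_cancel]
    simp only [this]
  have hφ' : ∀ φ : ℝ → ℝ → E, ContDiff ℝ 1 (fun q : ℝ × ℝ => φ q.1 q.2) →
      ContDiff ℝ 1 (fun q : ℝ × ℝ => φ (q.1 + a) q.2) := fun φ hφ =>
    hφ.comp (f := fun q : ℝ × ℝ => (q.1 + a, q.2)) (by fun_prop)
  refine ⟨h.memLp₀.comp_measurePreserving hmp, h.memLpL.comp_measurePreserving hmp,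
    hmp.quasiMeasurePreserving.ae h.bc, fun φ hφ => ?_, fun φ hφ t ht => ?_⟩
  · have h1 := hmp.integrable_comp_of_integrable (h.integrable (fun s x => φ (s + a) x) (hφ' φ hφ))
    exact h1.congr (.of_forall (hrate φ))
  · have h1 := h.green (fun s x => φ (s + a) x) (hφ' φ hφ) (t - a) ⟨by linarith [ht.1], by linarith [ht.2]⟩
    simp only [sub_add_cancel, zero_add] at h1
    rw [sub_self, h1, ← sub_self a, ← intervalIntegral.integral_comp_sub_right]
    simp only [hrate φ]

theorem sub {a b : ℝ} {z z' : ℝ → L2 E L} {h₀ hL h₀' hL' : ℝ → E}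
    (h : IsWeakSolutionOn N a b z h₀ hL) (h' : IsWeakSolutionOn N a b z' h₀' hL') :
    IsWeakSolutionOn N a b (fun t => z t - z' t) (fun t => h₀ t - h₀' t)
      (fun t => hL t - hL' t) := by
  have hrate : ∀ φ : ℝ → ℝ → E, ∀ t, (N t).greenRate φ t (z t) (h₀ t) (hL t)
      - (N t).greenRate φ t (z' t) (h₀' t) (hL' t)
      = (N t).greenRate φ t (z t - z' t) (h₀ t - h₀' t) (hL t - hL' t) := by
    intro φ t
    simp only [greenRate, inner_sub_right]
    ring
  refine ⟨h.memLp₀.sub h'.memLp₀, h.memLpL.sub h'.memLpL, ?_, fun φ hφ => ?_, fun φ hφ t ht => ?_⟩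
  · filter_upwards [h.bc, h'.bc] with t h1 h2
    rw [map_sub, map_sub, map_sub, h1.1, h1.2, h2.1, h2.2, sub_zero]
    exact ⟨rfl, rfl⟩
  · exact ((h.integrable φ hφ).sub (h'.integrable φ hφ)).congr (.of_forall (hrate φ))
  · have i : ∀ {y : ℝ → L2 E L} {g₀ gL : ℝ → E}, IsWeakSolutionOn N a b y g₀ gL →
        IntervalIntegrable (fun τ => (N τ).greenRate φ τ (y τ) (g₀ τ) (gL τ)) volume a t :=
      fun hy => (intervalIntegrable_iff_integrableOn_Ioc_of_le ht.1).mpr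
        ((hy.integrable φ hφ).mono_set (Ioc_subset_Ioc_right ht.2))
    simp only [← hrate φ]
    rw [intervalIntegral.integral_sub (i h) (i h'), ← h.green φ hφ t ht, ← h'.green φ hφ t ht,
      inner_sub_right, inner_sub_right]
    ring

/-- Uniqueness of weak solutions with zero initial state. -/
theorem eq_zero {a b : ℝ} {d : ℝ → L2 E L} {h₀ hL : ℝ → E}
    (h : IsWeakSolutionOn (fun _ => M) a b d h₀ hL) (hc : ContinuousOn d (Icc a b)) (hd : d a = 0) :
    ∀ t ∈ Icc a b, d t = 0 := by
  rcases lt_or_ge b a with hba | hab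
  · intro t ht
    exact absurd (ht.1.trans ht.2) (not_le.mpr hba)
  -- Constant extension outside `[a, b]`, so that the primitive is differentiable on the whole line.
  set dd : ℝ → L2 E L := fun τ => d (projIcc a b hab τ) with hdd
  have hddc : Continuous dd := hc.comp_continuous
    (continuous_subtype_val.comp continuous_projIcc) fun τ => (projIcc a b hab τ).2
  have hdeq : ∀ t ∈ Icc a b, dd t = d t := fun t ht => by simp [hdd, projIcc_of_mem hab ht]
  set y : ℝ → L2 E L := fun t => ∫ τ in a..t, dd τ with hy
  have hyd : ∀ t, HasDerivAt y (dd t) t := fun t =>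
    intervalIntegral.integral_hasDerivAt_right (hddc.intervalIntegrable _ _)
      (hddc.stronglyMeasurableAtFilter _ _) hddc.continuousAt
  -- The energy estimate holds only on the graph, where `d` itself need not lie. Test functions
  -- constant in time show that the primitive `y` solves the stationary problem weakly with image
  -- `d` and integrated traces, so `mem_graph_of_weak` applies.
  have hmem : ∀ t ∈ Icc a b,
      ((y t, d t), (∫ τ in Ioc a t, h₀ τ, ∫ τ in Ioc a t, hL τ)) ∈ M.graph := by
    intro t ht
    have hsub : Ioc a t ⊆ Ioc a b := Ioc_subset_Ioc_right ht.2
    have i₀ : IntegrableOn h₀ (Ioc a t) := IntegrableOn.mono_set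
      (h.memLp₀.integrable one_le_two) hsub
    have iL : IntegrableOn hL (Ioc a t) := IntegrableOn.mono_set
      (h.memLpL.integrable one_le_two) hsub
    have hbc := ae_restrict_of_ae_restrict_of_subset hsub h.bc
    refine M.mem_graph_of_weak ?_ ?_ fun ψ ψ' hψ' hψ => ?_
    · rw [← M.bc₀.integral_comp_comm i₀]
      exact integral_eq_zero_of_ae (hbc.mono fun τ hτ => hτ.1)
    · rw [← M.bcL.integral_comp_comm iL, hy]
      simp only
      rw [← M.κ.intervalIntegral_comp_comm (hddc.intervalIntegrable _ _),
        intervalIntegral.integral_of_le ht.1]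
      refine integral_congr_ae ?_
      filter_upwards [hbc, ae_restrict_mem measurableSet_Ioc] with τ h1 h2
      rw [h1.2, hdeq τ (Ioc_subset_Icc_self (hsub h2))]
    · have hψd : deriv ψ = ψ' := funext fun x => (hψ x).deriv
      have hφ : ContDiff ℝ 1 (fun q : ℝ × ℝ => (fun _ x => ψ x : ℝ → ℝ → E) q.1 q.2) := by
        have : ContDiff ℝ 1 ψ := contDiff_one_iff_deriv.mpr
          ⟨fun x => (hψ x).differentiableAt, by rwa [hψd]⟩
        exact this.comp contDiff_snd
      have h1 := h.green (fun _ x => ψ x) hφ t ht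
      rw [hd, inner_zero_right, sub_zero, M.integral_greenRate hφ hc h.memLp₀ h.memLpL ht] at h1
      have h2 : ∀ τ, M.testInterior (fun _ x => ψ x) τ = M.adj ψ ψ' := by
        intro τ
        simp [testInterior, hψd, cls_zero]
      have h3 : ∫ τ in a..t, ⟪M.adj ψ ψ', d τ⟫ = ⟪M.adj ψ ψ', y t⟫ := by
        have := (innerSL ℝ (M.adj ψ ψ')).intervalIntegral_comp_comm
          (hddc.intervalIntegrable (μ := volume) a t)
        simp only [innerSL_apply_apply] at this
        rw [hy, ← this]
        refine intervalIntegral.integral_congr fun τ hτ => ?_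
        rw [uIcc_of_le ht.1] at hτ
        simp only [hdeq τ ⟨hτ.1, hτ.2.trans ht.2⟩]
      simp only [h2] at h1
      rw [h3, integral_inner iL, integral_inner i₀, ContinuousLinearMap.adjoint_inner_left,
        ContinuousLinearMap.adjoint_inner_left] at h1
      linarith
  have hy0 : ∀ t ∈ Icc a b, y t = 0 := by
    have hΦd : ∀ t, HasDerivAt (fun t => M.Φ (y t)) (M.Φ (dd t)) t := fun t =>
      (M.Φ : L2 E L →L[ℝ] L2 E L).hasFDerivAt.comp_hasDerivAt t (hyd t)
    have hgd : ∀ t, HasDerivAt (fun t => Real.exp (-(2 * M.ω * t)) * ‖M.Φ (y t)‖ ^ 2)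
        (-(2 * M.ω) * Real.exp (-(2 * M.ω * t)) * ‖M.Φ (y t)‖ ^ 2
          + Real.exp (-(2 * M.ω * t)) * (2 * ⟪M.Φ (y t), M.Φ (dd t)⟫)) t := by
      intro t
      have h1 : HasDerivAt (fun t : ℝ => Real.exp (-(2 * M.ω * t)))
          (-(2 * M.ω) * Real.exp (-(2 * M.ω * t))) t := by
        have := ((hasDerivAt_id t).const_mul (2 * M.ω)).neg.exp
        convert! this using 1
        simp [mul_comm]
      exact h1.mul (hΦd t).norm_sq
    -- Grönwall's argument for `y' = d`: the energy estimate makes this quantity nonincreasing, and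
    -- it starts at zero.
    have hanti : AntitoneOn (fun t => Real.exp (-(2 * M.ω * t)) * ‖M.Φ (y t)‖ ^ 2) (Icc a b) := by
      refine antitoneOn_of_deriv_nonpos (convex_Icc a b)
        (fun t _ => (hgd t).continuousAt.continuousWithinAt)
        (fun t _ => (hgd t).differentiableAt.differentiableWithinAt) fun t ht => ?_
      rw [interior_Icc] at ht
      have ht' := Ioo_subset_Icc_self ht
      rw [(hgd t).deriv, hdeq t ht']
      have h1 := M.graph_energy _ (hmem t ht')
      simp only at h1
      have hcp := M.c_pos
      have h2 : 0 ≤ M.c * (‖∫ τ in Ioc a t, h₀ τ‖ ^ 2 + ‖∫ τ in Ioc a t, hL τ‖ ^ 2) := by positivity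
      have h3 : 0 < Real.exp (-(2 * M.ω * t)) := Real.exp_pos _
      nlinarith
    intro t ht
    have h1 := hanti ⟨le_rfl, hab⟩ ht ht.1
    have h2 : y a = 0 := intervalIntegral.integral_same
    simp only [h2, map_zero, norm_zero] at h1
    have h3 : 0 < Real.exp (-(2 * M.ω * t)) := Real.exp_pos _
    have h4 : ‖M.Φ (y t)‖ ^ 2 ≤ 0 := by
      by_contra hcon
      push Not at hcon
      have := mul_pos h3 hcon
      norm_num at h1
      linarith
    have h5 : ‖M.Φ (y t)‖ = 0 := pow_eq_zero_iff two_ne_zero |>.mp (le_antisymm h4 (sq_nonneg _))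
    exact (M.Φ.map_eq_zero_iff).mp (norm_eq_zero.mp h5)
  intro t ht
  have h1 := hmem t ht
  rw [hy0 t ht] at h1
  exact M.snd_eq_zero_of_mem_graph h1

end IsWeakSolutionOn

namespace IsEvolution

variable {M} {T : ℝ → L2 E L →L[ℝ] L2 E L} (hT : M.IsEvolution T)

include hT

theorem exists_isWeakSolutionOn (u : L2 E L) {a b : ℝ} (hab : a ≤ b) :
    ∃ h₀ hL, IsWeakSolutionOn (fun _ => M) a b (fun t => T (t - a) u) h₀ hL := by
  obtain ⟨h₀, hL, h⟩ := hT.exists_isWeakSolutionOn_zero u (sub_nonneg.mpr hab)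
  exact ⟨_, _, h.shift⟩

theorem continuousOn_sub (u : L2 E L) (a : ℝ) : ContinuousOn (fun t => T (t - a) u) (Ici a) :=
  (hT.cont u).comp (f := fun t : ℝ => t - a) (by fun_prop) fun t ht =>
    mem_Ici.mpr (sub_nonneg.mpr ht)

/-- Weak solutions are given by the evolution operators. -/
theorem eq_of_isWeakSolutionOn {a b : ℝ} {z : ℝ → L2 E L} {h₀ hL : ℝ → E}
    (hc : ContinuousOn z (Icc a b)) (h : IsWeakSolutionOn (fun _ => M) a b z h₀ hL) :
    ∀ t ∈ Icc a b, z t = T (t - a) (z a) := by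
  intro t ht
  obtain ⟨g₀, gL, hg⟩ := hT.exists_isWeakSolutionOn (z a) (ht.1.trans ht.2)
  refine sub_eq_zero.mp ((h.sub hg).eq_zero
    (hc.sub ((hT.continuousOn_sub (z a) a).mono Icc_subset_Ici_self)) ?_ t ht)
  simp only [sub_self, hT.zero]

end IsEvolution

end HyperbolicBVP

/-! ### Paths of modes, and the switched system along one path. -/

/-- Right-continuity on `[0, ∞)` of a path with values in a discrete set. -/
def IsRightCont {ι : Type*} (x : ℝ → ι) : Prop := ∀ t, 0 ≤ t → ∀ᶠ u in 𝓝[≥] t, x u = x t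

/-- Existence of left limits of a path with values in a discrete set. -/
def HasLeftLimits {ι : Type*} (x : ℝ → ι) : Prop := ∀ t, 0 < t → ∃ i, ∀ᶠ u in 𝓝[<] t, x u = i

theorem IsRightCont.exists_gt {ι : Type*} {x : ℝ → ι} (hx : IsRightCont x) {t c : ℝ} (ht : 0 ≤ t)
    (htc : t < c) : ∃ b, t < b ∧ b ≤ c ∧ ∀ u ∈ Ico t b, x u = x t := by
  obtain ⟨v, hv, h⟩ := mem_nhdsGE_iff_exists_Ico_subset.mp (hx t ht)
  exact ⟨min v c, lt_min hv htc, min_le_right _ _,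
    fun u hu => h ⟨hu.1, hu.2.trans_le (min_le_left _ _)⟩⟩

/-- Induction along a path without discontinuities of the second kind. -/
theorem path_induction {ι : Type*} {x : ℝ → ι} (hx : IsRightCont x) (hx' : HasLeftLimits x)
    {P : ℝ → ℝ → Prop} (refl : ∀ a, 0 ≤ a → P a a)
    (step : ∀ a b i, 0 ≤ a → a < b → (∀ t ∈ Ico a b, x t = i) → P a b)
    (trans : ∀ a b c, 0 ≤ a → a ≤ b → b ≤ c → P a b → P b c → P a c) {a b : ℝ} (ha : 0 ≤ a)
    (hab : a ≤ b) : P a b := by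
  set S : Set ℝ := {t | t ∈ Icc a b ∧ P a t} with hS
  have haS : a ∈ S := ⟨⟨le_rfl, hab⟩, refl a ha⟩
  have hbdd : BddAbove S := ⟨b, fun t ht => ht.1.2⟩
  -- The supremum is attained because the path is constant just before `s`; right-continuity would
  -- move past `s` if `s < b`.
  set s := sSup S with hs
  have has : a ≤ s := le_csSup hbdd haS
  have hsb : s ≤ b := csSup_le ⟨a, haS⟩ fun t ht => ht.1.2
  have hsS : P a s := by
    rcases has.eq_or_lt with h | h
    · rw [← h]; exact refl a ha
    · obtain ⟨i, hi⟩ := hx' s (ha.trans_lt h)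
      obtain ⟨v, hv, hvs⟩ := mem_nhdsLT_iff_exists_Ioo_subset.mp hi
      obtain ⟨t, htS, hvt⟩ := exists_lt_of_lt_csSup ⟨a, haS⟩ hv
      have hts : t ≤ s := le_csSup hbdd htS
      rcases hts.eq_or_lt with h1 | h1
      · rw [← h1]; exact htS.2
      · refine trans a t s ha htS.1.1 hts htS.2 (step t s i (ha.trans htS.1.1) h1 fun u hu => ?_)
        exact hvs ⟨hvt.trans_le hu.1, hu.2⟩
  rcases hsb.eq_or_lt with h | h
  · rwa [← h]
  · obtain ⟨c, hsc, hcb, hc⟩ := hx.exists_gt (ha.trans has) h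
    have h1 := trans a s c ha has hsc.le hsS (step s c _ (ha.trans has) hsc hc)
    exact absurd (le_csSup hbdd ⟨⟨has.trans hsc.le, hcb⟩, h1⟩) (not_le.mpr hsc)

/-- Sampling at the first grid point strictly to the right of `t` gives measurable functions, and
right-continuity makes them converge. -/
theorem IsRightCont.measurable {r : ℕ} {x : ℝ → Fin r} (hx : IsRightCont x) :
    Measurable fun t => x (max t 0) := by
  refine measurable_of_tendsto_metrizable
    (f := fun (n : ℕ) (t : ℝ) => x (max ((⌊((n : ℝ) + 1) * t⌋ + 1) / ((n : ℝ) + 1)) 0))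
    (fun n => ?_) (tendsto_pi_nhds.mpr fun t => ?_)
  · have : Measurable fun t : ℝ => ⌊((n : ℝ) + 1) * t⌋ :=
      Int.measurable_floor.comp (measurable_const_mul _)
    exact (measurable_from_top (f := fun k : ℤ => x (max (((k : ℝ) + 1) / ((n : ℝ) + 1)) 0))).comp
      this
  · have h1 : Tendsto (fun n : ℕ => ((⌊((n : ℝ) + 1) * t⌋ : ℝ) + 1) / ((n : ℝ) + 1)) atTop (𝓝 t) := by
      refine tendsto_of_tendsto_of_tendsto_of_le_of_le (g := fun _ => t)
        (h := fun n : ℕ => t + 1 / ((n : ℝ) + 1)) tendsto_const_nhds ?_ (fun n => ?_) (fun n => ?_)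
      · simpa using tendsto_one_div_add_atTop_nhds_zero_nat.const_add t
      · have hn : (0 : ℝ) < (n : ℝ) + 1 := by positivity
        simp only
        rw [le_div_iff₀ hn]
        linarith [Int.lt_floor_add_one (((n : ℝ) + 1) * t)]
      · have hn : (0 : ℝ) < (n : ℝ) + 1 := by positivity
        simp only
        have hn' : 1 / ((n : ℝ) + 1) * ((n : ℝ) + 1) = 1 := by field_simp
        rw [div_le_iff₀ hn, add_mul t, hn']
        linarith [Int.floor_le (((n : ℝ) + 1) * t)]
    have h2 : Tendsto (fun n : ℕ => max (((⌊((n : ℝ) + 1) * t⌋ : ℝ) + 1) / ((n : ℝ) + 1)) 0) atTop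
        (𝓝[≥] (max t 0)) := by
      refine tendsto_nhdsWithin_iff.mpr ⟨h1.max tendsto_const_nhds, .of_forall fun n => ?_⟩
      have hn : (0 : ℝ) < (n : ℝ) + 1 := by positivity
      refine mem_Ici.mpr (max_le_max ?_ le_rfl)
      rw [le_div_iff₀ hn]
      linarith [Int.lt_floor_add_one (((n : ℝ) + 1) * t)]
    exact tendsto_const_nhds.congr' ((h2.eventually (hx _ (le_max_right _ _))).mono
      fun n hn => hn.symm)

namespace HyperbolicBVP

variable {E F : Type*} [NormedAddCommGroup E] [InnerProductSpace ℝ E]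
    [FiniteDimensional ℝ E] [NormedAddCommGroup F] [NormedSpace ℝ F] [FiniteDimensional ℝ F]
    {L : ℝ}

/-- Joint continuity: strong continuity in time together with a bound uniform on bounded times. -/
theorem IsEvolution.tendsto_apply {M : HyperbolicBVP E F L} {T : ℝ → L2 E L →L[ℝ] L2 E L}
    (hT : M.IsEvolution T) {s : ℕ → ℝ} {s' : ℝ} {w : ℕ → L2 E L} {w' : L2 E L} (hs' : 0 ≤ s')
    (hs : Tendsto s atTop (𝓝 s')) (hs0 : ∀ᶠ n in atTop, 0 ≤ s n) (hw : Tendsto w atTop (𝓝 w')) :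
    Tendsto (fun n => T (s n) (w n)) atTop (𝓝 (T s' w')) := by
  obtain ⟨K, hK, hb⟩ := hT.exists_bound (s' + 1)
  have h1 : Tendsto (fun n => T (s n) w') atTop (𝓝 (T s' w')) :=
    (hT.cont w' s' hs').tendsto.comp (tendsto_nhdsWithin_iff.mpr ⟨hs, hs0⟩)
  have h2 : Tendsto (fun n => T (s n) (w n - w')) atTop (𝓝 0) := by
    refine squeeze_zero_norm' (a := fun n => K * ‖w n - w'‖) ?_ ?_
    · filter_upwards [hs0, hs.eventually_le_const (lt_add_one s')] with n hn hn'
      exact hb _ ⟨hn, hn'⟩ _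
    · have := (hw.sub_const w').norm.const_mul K
      simpa using this
  have h3 := h1.add h2
  rw [add_zero] at h3
  refine h3.congr fun n => ?_
  rw [← map_add]
  congr 1
  abel

variable {r : ℕ} (T : Fin r → ℝ → L2 E L →L[ℝ] L2 E L)

/-- States at the times `k h` when the mode is frozen on every interval `[k h, (k + 1) h)`. -/
noncomputable def gridState (x : ℝ → Fin r) (z₀ : L2 E L) (h : ℝ) : ℕ → L2 E L
  | 0 => z₀
  | k + 1 => T (x (k * h)) h (gridState x z₀ h k)

/-- The evolution when the mode is frozen on every interval `[k h, (k + 1) h)`. -/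
noncomputable def approx (x : ℝ → Fin r) (z₀ : L2 E L) (h t : ℝ) : L2 E L :=
  T (x (⌊t / h⌋₊ * h)) (t - ⌊t / h⌋₊ * h) (gridState T x z₀ h ⌊t / h⌋₊)

variable {T} {M : Fin r → HyperbolicBVP E F L} (hT : ∀ i, (M i).IsEvolution (T i))

include hT

theorem gridState_eq_of_const {x : ℝ → Fin r} {z₀ : L2 E L} {h a b : ℝ} {i : Fin r} (hh : 0 < h)
    (hi : ∀ t ∈ Ico a b, x t = i) {k₀ : ℕ} (hk₀ : a ≤ k₀ * h) (n : ℕ) (hn : (k₀ + n : ℕ) * h ≤ b) :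
    gridState T x z₀ h (k₀ + n) = T i (n * h) (gridState T x z₀ h k₀) := by
  induction n with
  | zero => simp [(hT i).zero]
  | succ n ih =>
    push_cast at hn
    rw [← add_assoc, gridState, ih (by push_cast; nlinarith), hi, ← (hT i).add _ _ hh.le (by positivity)]
    · push_cast
      congr 2
      ring
    · push_cast
      exact ⟨by nlinarith [mul_nonneg (Nat.cast_nonneg (α := ℝ) n) hh.le], by nlinarith⟩

/-- Between `a` and the next grid point the frozen mode may be outdated; afterwards it is `i`, and
the steps telescope by the semigroup law. If the last grid point is not before `b`, it equals `t`,
and the mode found there acts for zero time. -/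
theorem approx_eq_of_const {x : ℝ → Fin r} {z₀ : L2 E L} {h a b : ℝ} {i : Fin r} (hh : 0 < h)
    (ha : 0 ≤ a) (hi : ∀ t ∈ Ico a b, x t = i) {t : ℝ} (hat : a + h ≤ t) (htb : t ≤ b) :
    approx T x z₀ h t = T i (t - (⌊a / h⌋₊ + 1) * h) (T (x (⌊a / h⌋₊ * h))
      ((⌊a / h⌋₊ + 1) * h - a) (approx T x z₀ h a)) := by
  have hfl : ∀ s, 0 ≤ s → ⌊s / h⌋₊ * h ≤ s ∧ s < (⌊s / h⌋₊ + 1) * h := fun s hs =>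
    ⟨(le_div_iff₀ hh).mp (Nat.floor_le (div_nonneg hs hh.le)),
      (div_lt_iff₀ hh).mp (Nat.lt_floor_add_one _)⟩
  obtain ⟨ha1, ha2⟩ := hfl a ha
  have ht0 : 0 ≤ t := by linarith
  obtain ⟨ht1, ht2⟩ := hfl t ht0
  have hgrid : gridState T x z₀ h (⌊a / h⌋₊ + 1)
      = T (x (⌊a / h⌋₊ * h)) ((⌊a / h⌋₊ + 1) * h - a) (approx T x z₀ h a) := by
    rw [approx, ← (hT _).add _ _ (by linarith) (by linarith), gridState]
    congr 2
    ring
  rw [← hgrid, approx]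
  have hle : ⌊a / h⌋₊ + 1 ≤ ⌊t / h⌋₊ := by
    rw [Nat.le_floor_iff (by positivity), le_div_iff₀ hh]
    push_cast
    linarith
  obtain ⟨n, hn⟩ := Nat.exists_eq_add_of_le hle
  rw [hn] at ht1 ht2 ⊢
  rw [gridState_eq_of_const hT hh hi (by push_cast; linarith) n (ht1.trans htb)]
  have hn0 : 0 ≤ (n : ℝ) * h := by positivity
  push_cast at ht1 ⊢
  rcases lt_or_ge (((⌊a / h⌋₊ : ℝ) + 1 + n) * h) b with hb | hb
  · rw [hi _ ⟨by nlinarith, hb⟩, ← (hT i).add _ _ (by linarith) hn0]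
    congr 2
    ring
  · have h1 : t - ((⌊a / h⌋₊ : ℝ) + 1 + n) * h = 0 := by linarith
    have h2 : t - ((⌊a / h⌋₊ : ℝ) + 1) * h = n * h := by linarith
    rw [h1, h2, (hT _).zero]

/-- On an interval where the mode is constant, convergence of the approximations propagates. -/
theorem tendsto_approx_of_const {x : ℝ → Fin r} {z₀ : L2 E L} {h : ℕ → ℝ} (hh : ∀ n, 0 < h n)
    (hh0 : Tendsto h atTop (𝓝 0)) {a b : ℝ} {i : Fin r} (ha : 0 ≤ a)
    (hi : ∀ t ∈ Ico a b, x t = i) {w : L2 E L}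
    (hw : Tendsto (fun n => approx T x z₀ (h n) a) atTop (𝓝 w)) {t : ℝ} (ht : t ∈ Icc a b) :
    Tendsto (fun n => approx T x z₀ (h n) t) atTop (𝓝 (T i (t - a) w)) := by
  rcases ht.1.eq_or_lt with rfl | hat
  · rwa [sub_self, (hT i).zero]
  have hfl : ∀ n, ⌊a / h n⌋₊ * h n ≤ a ∧ a < (⌊a / h n⌋₊ + 1) * h n := fun n =>
    ⟨(le_div_iff₀ (hh n)).mp (Nat.floor_le (div_nonneg ha (hh n).le)),
      (div_lt_iff₀ (hh n)).mp (Nat.lt_floor_add_one _)⟩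
  set δ : ℕ → ℝ := fun n => (⌊a / h n⌋₊ + 1) * h n - a with hδ
  have hδ0 : ∀ n, 0 ≤ δ n := fun n => by
    have := (hfl n).2
    simp only [hδ]; linarith
  have hδh : ∀ n, δ n ≤ h n := fun n => by
    have := (hfl n).1
    simp only [hδ]; linarith
  have hδlim : Tendsto δ atTop (𝓝 0) := squeeze_zero hδ0 hδh hh0
  -- The outdated mode acts for the vanishing time `δ n`. It may vary with `n`, so its effect is
  -- bounded by the sum over all modes.
  have h1 : Tendsto (fun n => T (x (⌊a / h n⌋₊ * h n)) (δ n) (approx T x z₀ (h n) a)) atTop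
      (𝓝 w) := by
    have h2 : ∀ j, Tendsto (fun n => ‖T j (δ n) (approx T x z₀ (h n) a) - w‖) atTop (𝓝 0) := by
      intro j
      have := (hT j).tendsto_apply le_rfl hδlim (.of_forall hδ0) hw
      rw [(hT j).zero] at this
      exact tendsto_iff_norm_sub_tendsto_zero.mp this
    have h3 : Tendsto (fun n => ∑ j, ‖T j (δ n) (approx T x z₀ (h n) a) - w‖) atTop (𝓝 0) := by
      simpa using tendsto_finsetSum Finset.univ fun j _ => h2 j
    refine tendsto_iff_norm_sub_tendsto_zero.mpr (squeeze_zero (fun _ => norm_nonneg _)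
      (fun n => ?_) h3)
    exact Finset.single_le_sum (f := fun j => ‖T j (δ n) (approx T x z₀ (h n) a) - w‖)
      (fun j _ => norm_nonneg _) (Finset.mem_univ (x (⌊a / h n⌋₊ * h n)))
  have h4 : Tendsto (fun n => t - (⌊a / h n⌋₊ + 1) * h n) atTop (𝓝 (t - a)) := by
    have := (tendsto_const_nhds (x := t - a)).sub hδlim
    rw [sub_zero] at this
    refine this.congr fun n => ?_
    simp only [hδ]; ring
  have h5 : ∀ᶠ n in atTop, a + h n ≤ t := by
    filter_upwards [hh0.eventually_le_const (sub_pos.mpr hat)] with n hn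
    linarith
  have h6 := (hT i).tendsto_apply (sub_nonneg.mpr ht.1) h4
    (h5.mono fun n hn => by
      have := hδh n
      simp only [hδ] at this
      linarith) h1
  refine h6.congr' (h5.mono fun n hn => ?_)
  exact (approx_eq_of_const hT (hh n) ha hi hn ht.2).symm

/-- Convergence of the approximations along a path. -/
theorem exists_tendsto_approx {x : ℝ → Fin r} (hx : IsRightCont x) (hx' : HasLeftLimits x)
    (z₀ : L2 E L) {h : ℕ → ℝ} (hh : ∀ n, 0 < h n) (hh0 : Tendsto h atTop (𝓝 0)) {t : ℝ}
    (ht : 0 ≤ t) : ∃ w, Tendsto (fun n => approx T x z₀ (h n) t) atTop (𝓝 w) := by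
  refine path_induction hx hx' (P := fun a b =>
    (∃ w, Tendsto (fun n => approx T x z₀ (h n) a) atTop (𝓝 w)) →
      ∃ w, Tendsto (fun n => approx T x z₀ (h n) b) atTop (𝓝 w)) (fun _ _ => id)
    (fun a b i ha hab hi ⟨w, hw⟩ => ⟨_, tendsto_approx_of_const hT hh hh0 ha hi hw ⟨hab.le, le_rfl⟩⟩)
    (fun _ _ _ _ _ _ h1 h2 => h2 ∘ h1) le_rfl ht ⟨z₀, ?_⟩
  refine tendsto_const_nhds.congr fun n => ?_
  simp [approx, (hT _).zero, gridState]

variable {x : ℝ → Fin r} {z : ℝ → L2 E L}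

/-- A function which follows the mode along a path is continuous and solves the switched system. -/
theorem exists_isWeakSolutionOn_path (hx : IsRightCont x) (hx' : HasLeftLimits x)
    (hz : ∀ a b i, 0 ≤ a → (∀ t ∈ Ico a b, x t = i) → ∀ t ∈ Icc a b, z t = T i (t - a) (z a))
    {a b : ℝ} (ha : 0 ≤ a) (hab : a ≤ b) :
    ContinuousOn z (Icc a b) ∧ ∃ h₀ hL, IsWeakSolutionOn (fun t => M (x t)) a b z h₀ hL := by
  refine path_induction hx hx' (P := fun a b => ContinuousOn z (Icc a b) ∧
    ∃ h₀ hL, IsWeakSolutionOn (fun t => M (x t)) a b z h₀ hL) (fun a _ => ?_)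
    (fun a b i ha hab hi => ?_) (fun a b c _ hab hbc h1 h2 => ?_) ha hab
  · refine ⟨by rw [Icc_self]; exact continuousOn_singleton _ _, 0, 0, by simp, by simp, by simp,
      fun φ _ => by simp, fun φ _ t ht => ?_⟩
    obtain rfl : t = a := le_antisymm ht.2 ht.1
    simp
  · obtain ⟨h₀, hL, h⟩ := (hT i).exists_isWeakSolutionOn (z a) hab.le
    have hzi : ∀ t ∈ Icc a b, T i (t - a) (z a) = z t := fun t ht => (hz a b i ha hi t ht).symm
    refine ⟨?_, h₀, hL, h.congr (fun t ht => by rw [hi t (Ioo_subset_Ico_self ht)]) hzi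
      (fun _ _ => rfl) fun _ _ => rfl⟩
    exact (((hT i).continuousOn_sub (z a) a).mono Icc_subset_Ici_self).congr
      fun t ht => (hzi t ht).symm
  · obtain ⟨hc1, h₀, hL, h1⟩ := h1
    obtain ⟨hc2, g₀, gL, h2⟩ := h2
    refine ⟨?_, fun t => if t ≤ b then h₀ t else g₀ t, fun t => if t ≤ b then hL t else gL t, ?_⟩
    · rw [← Icc_union_Icc_eq_Icc hab hbc]
      exact hc1.union_of_isClosed hc2 isClosed_Icc isClosed_Icc
    · refine IsWeakSolutionOn.trans hab hbc
        (h1.congr (fun _ _ => rfl) (fun _ _ => rfl) (fun t ht => ?_) fun t ht => ?_)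
        (h2.congr (fun _ _ => rfl) (fun _ _ => rfl) (fun t ht => ?_) fun t ht => ?_)
      · rw [if_pos ht.2.le]
      · rw [if_pos ht.2.le]
      · rw [if_neg (not_le.mpr ht.1)]
      · rw [if_neg (not_le.mpr ht.1)]

/-- Existence of global boundary traces. -/
theorem exists_global_traces (hx : IsRightCont x) (hx' : HasLeftLimits x)
    (hz : ∀ a b i, 0 ≤ a → (∀ t ∈ Ico a b, x t = i) → ∀ t ∈ Icc a b, z t = T i (t - a) (z a)) :
    ContinuousOn z (Ici 0) ∧
      ∃ h₀ hL, ∀ b, 0 ≤ b → IsWeakSolutionOn (fun t => M (x t)) 0 b z h₀ hL := by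
  constructor
  · intro t ht
    have h1 := (exists_isWeakSolutionOn_path hT hx hx' hz le_rfl
      (by linarith [mem_Ici.mp ht] : (0 : ℝ) ≤ t + 1)).1 t ⟨ht, by linarith⟩
    refine h1.mono_of_mem_nhdsWithin ?_
    rw [← Ici_inter_Iic]
    exact inter_mem_nhdsWithin _ (Iic_mem_nhds (lt_add_one t))
  · choose h₀ hL hw using fun n : ℕ => (exists_isWeakSolutionOn_path hT hx hx' hz
      (Nat.cast_nonneg n) (by linarith : (n : ℝ) ≤ n + 1)).2
    -- The traces were chosen separately on unit intervals; `⌈t⌉₊ - 1` selects the interval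
    -- containing `t` and so glues them.
    have hceil : ∀ (n : ℕ), ∀ t ∈ Ioo (n : ℝ) (n + 1), ⌈t⌉₊ - 1 = n := by
      intro n t ht
      have : ⌈t⌉₊ = n + 1 := by
        rw [Nat.ceil_eq_iff (by omega)]
        push_cast
        exact ⟨by simpa using ht.1, ht.2.le⟩
      omega
    have hpiece : ∀ n : ℕ, IsWeakSolutionOn (fun t => M (x t)) n (n + 1) z
        (fun t => h₀ (⌈t⌉₊ - 1) t) (fun t => hL (⌈t⌉₊ - 1) t) := fun n =>
      (hw n).congr (fun _ _ => rfl) (fun _ _ => rfl) (fun t ht => by rw [hceil n t ht])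
        (fun t ht => by rw [hceil n t ht])
    have hall : ∀ n : ℕ, IsWeakSolutionOn (fun t => M (x t)) 0 (n + 1) z
        (fun t => h₀ (⌈t⌉₊ - 1) t) (fun t => hL (⌈t⌉₊ - 1) t) := by
      intro n
      induction n with
      | zero => simpa using hpiece 0
      | succ n ih =>
        have := hpiece (n + 1)
        push_cast at this ⊢
        exact IsWeakSolutionOn.trans (by positivity) (by linarith) ih this
    refine ⟨_, _, fun b hb => (hall ⌈b⌉₊).mono le_rfl hb ((Nat.le_ceil b).trans (by linarith))⟩

/-- Uniqueness of the solution of the switched system along a right-continuous path. -/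
theorem eq_of_isWeakSolutionOn_path (hx : IsRightCont x) {z' : ℝ → L2 E L}
    {h₀ hL h₀' hL' : ℝ → E} (hc : ContinuousOn z (Ici 0)) (hc' : ContinuousOn z' (Ici 0))
    (hw : ∀ b, 0 ≤ b → IsWeakSolutionOn (fun t => M (x t)) 0 b z h₀ hL)
    (hw' : ∀ b, 0 ≤ b → IsWeakSolutionOn (fun t => M (x t)) 0 b z' h₀' hL') (h0 : z' 0 = z 0)
    {t : ℝ} (ht : 0 ≤ t) : z' t = z t := by
  -- Continuous induction: the set of agreement is closed, and just after any time the mode is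
  -- constant and the evolution operator determines both solutions. Left limits play no role.
  have hmain : Icc 0 t ⊆ {u | z' u = z u} := by
    refine IsClosed.Icc_subset_of_forall_mem_nhdsWithin ?_ h0 fun a ha => ?_
    · have h1 : ContinuousOn (fun u => z' u - z u) (Icc 0 t) :=
        (hc'.sub hc).mono Icc_subset_Ici_self
      have h2 := h1.preimage_isClosed_of_isClosed isClosed_Icc (isClosed_singleton (x := 0))
      rw [inter_comm] at h2
      convert h2 using 2
      ext u
      simp [sub_eq_zero]
    · have ha0 : 0 ≤ a := ha.2.1
      obtain ⟨b, hab, -, hb⟩ := hx.exists_gt ha0 (lt_add_one a)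
      have hb0 : 0 ≤ b := ha0.trans hab.le
      have key : ∀ {y : ℝ → L2 E L} {g₀ gL : ℝ → E}, ContinuousOn y (Ici 0) →
          (∀ b, 0 ≤ b → IsWeakSolutionOn (fun t => M (x t)) 0 b y g₀ gL) →
          ∀ u ∈ Icc a b, y u = T (x a) (u - a) (y a) := fun hyc hy =>
        (hT (x a)).eq_of_isWeakSolutionOn
          (hyc.mono (Icc_subset_Ici_self.trans (Ici_subset_Ici.mpr ha0)))
          (((hy b hb0).mono ha0 hab.le le_rfl).congr
            (fun u hu => by rw [hb u (Ioo_subset_Ico_self hu)]) (fun _ _ => rfl) (fun _ _ => rfl)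
            fun _ _ => rfl)
      filter_upwards [Ioo_mem_nhdsGT hab] with u hu
      have hu' := Ioo_subset_Icc_self hu
      have haz : z' a = z a := ha.1
      change z' u = z u
      rw [key hc hw u hu', key hc' hw' u hu', haz]
  exact hmain ⟨ht, le_rfl⟩

-- Splitting by the current mode gives a finite sum of integrable functions, each cut off to a
-- measurable set of times.
omit hT in
theorem integrableOn_greenRate_path (hx : IsRightCont x) {φ : ℝ → ℝ → E}
    (hφ : ContDiff ℝ 1 (fun q : ℝ × ℝ => φ q.1 q.2)) {b : ℝ} (hc : ContinuousOn z (Icc 0 b))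
    {h₀ hL : ℝ → E} (hh₀ : MemLp h₀ 2 (volume.restrict (Ioc 0 b)))
    (hhL : MemLp hL 2 (volume.restrict (Ioc 0 b))) :
    IntegrableOn (fun τ => (M (x τ)).greenRate φ τ (z τ) (h₀ τ) (hL τ)) (Ioc 0 b) := by
  have h1 : IntegrableOn (fun τ => ∑ i, {τ | x (max τ 0) = i}.indicator
      (fun τ => (M i).greenRate φ τ (z τ) (h₀ τ) (hL τ)) τ) (Ioc 0 b) := by
    refine integrable_finsetSum _ fun i _ => ?_
    exact ((M i).integrableOn_greenRate hφ hc hh₀ hhL).indicator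
      (hx.measurable (measurableSet_singleton i))
  refine IntegrableOn.congr_fun h1 (fun τ hτ => ?_) measurableSet_Ioc
  rw [Finset.sum_eq_single (x τ)]
  · rw [indicator_of_mem]
    simp [max_eq_left hτ.1.le]
  · intro i _ hi
    rw [indicator_of_notMem]
    simpa [max_eq_left hτ.1.le] using hi.symm
  · simp

omit hT in
/-- The norms adapted to finitely many modes are uniformly equivalent. -/
theorem exists_uniform_constants (M : Fin r → HyperbolicBVP E F L) :
    ∃ C ω : ℝ, 1 ≤ C ∧ 0 ≤ ω ∧ (∀ i, (M i).ω ≤ ω) ∧ (∀ i z, ‖z‖ ≤ C * ‖(M i).Φ z‖) ∧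
      (∀ i z, ‖(M i).Φ z‖ ≤ C * ‖z‖) ∧ ∀ i j z, ‖(M i).Φ z‖ ≤ C * ‖(M j).Φ z‖ := by
  choose a ha h1 using fun i => (M i).exists_norm_Φ_le
  choose a' ha' h2 using fun i => (M i).exists_le_norm_Φ
  set A := ∑ i, a i with hA
  set A' := ∑ i, a' i with hA'
  have hA0 : 0 ≤ A := Finset.sum_nonneg fun i _ => ha i
  have hA'0 : 0 ≤ A' := Finset.sum_nonneg fun i _ => ha' i
  have hai : ∀ i, a i ≤ A := fun i => Finset.single_le_sum (fun i _ => ha i) (Finset.mem_univ i)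
  have hai' : ∀ i, a' i ≤ A' := fun i =>
    Finset.single_le_sum (fun i _ => ha' i) (Finset.mem_univ i)
  have g1 : ∀ i z, ‖(M i).Φ z‖ ≤ A * ‖z‖ := fun i z => (h1 i z).trans (by gcongr; exact hai i)
  have g2 : ∀ i z, ‖z‖ ≤ A' * ‖(M i).Φ z‖ := fun i z => (h2 i z).trans (by gcongr; exact hai' i)
  -- One constant above 1, `A`, `A'` and `A * A'`; the product is the cost of passing from one
  -- adapted norm to another through the L² norm.
  refine ⟨1 + A + A' + A * A', ∑ i, (M i).ω, by nlinarith [mul_nonneg hA0 hA'0],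
    Finset.sum_nonneg fun i _ => (M i).ω_nonneg,
    fun i => Finset.single_le_sum (fun i _ => (M i).ω_nonneg) (Finset.mem_univ i),
    fun i z => (g2 i z).trans ?_, fun i z => (g1 i z).trans ?_, fun i j z => ?_⟩
  · gcongr
    nlinarith [mul_nonneg hA0 hA'0]
  · gcongr
    nlinarith [mul_nonneg hA0 hA'0]
  · calc ‖(M i).Φ z‖ ≤ A * (A' * ‖(M j).Φ z‖) := (g1 i z).trans (by gcongr; exact g2 j z)
      _ = A * A' * ‖(M j).Φ z‖ := by ring
      _ ≤ _ := by gcongr; nlinarith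

end HyperbolicBVP

/-! ### Mode changes on grids, their exponential moments, and left limits. -/

/-- The weight `C ^ N`, where `N` is the number of mode changes seen at the first `k` grid
points. -/
noncomputable def jumpWeight {ι : Type*} [DecidableEq ι] (C : ℝ) (x : ℕ → ι) (k : ℕ) : ℝ :=
  ∏ j ∈ Finset.range k, if x j = x (j + 1) then 1 else C

theorem jumpWeight_succ {ι : Type*} [DecidableEq ι] (C : ℝ) (x : ℕ → ι) (k : ℕ) :
    jumpWeight C x (k + 1) = jumpWeight C x k * if x k = x (k + 1) then 1 else C :=
  Finset.prod_range_succ _ _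

theorem jumpWeight_nonneg {ι : Type*} [DecidableEq ι] {C : ℝ} (hC : 0 ≤ C) (x : ℕ → ι) (k : ℕ) :
    0 ≤ jumpWeight C x k :=
  Finset.prod_nonneg fun j _ => by split_ifs <;> positivity

namespace HyperbolicBVP

variable {E F : Type*} [NormedAddCommGroup E] [InnerProductSpace ℝ E]
    [FiniteDimensional ℝ E] [NormedAddCommGroup F] [NormedSpace ℝ F] [FiniteDimensional ℝ F]
    {L : ℝ} {r : ℕ} {T : Fin r → ℝ → L2 E L →L[ℝ] L2 E L} {M : Fin r → HyperbolicBVP E F L}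

/-- Growth of the approximations in terms of the number of mode changes. -/
theorem norm_approx_le (hT : ∀ i, (M i).IsEvolution (T i)) {C ω : ℝ} (hC : 1 ≤ C)
    (hωi : ∀ i, (M i).ω ≤ ω) (h1 : ∀ i z, ‖z‖ ≤ C * ‖(M i).Φ z‖)
    (h2 : ∀ i z, ‖(M i).Φ z‖ ≤ C * ‖z‖) (h3 : ∀ i j z, ‖(M i).Φ z‖ ≤ C * ‖(M j).Φ z‖)
    (x : ℝ → Fin r) (z₀ : L2 E L) {h t : ℝ} (hh : 0 < h) (ht : 0 ≤ t) :
    ‖approx T x z₀ h t‖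
      ≤ C ^ 2 * Real.exp (ω * t) * ‖z₀‖ * jumpWeight C (fun j => x (j * h)) ⌊t / h⌋₊ := by
  have hC0 : 0 ≤ C := zero_le_one.trans hC
  have hstep : ∀ i s z, 0 ≤ s → ‖(M i).Φ (T i s z)‖ ≤ Real.exp (ω * s) * ‖(M i).Φ z‖ := by
    intro i s z hs
    refine ((hT i).norm_le s hs z).trans ?_
    gcongr
    exact hωi i
  -- The state at a grid point is measured in the norm of the mode about to act, so a factor `C` is
  -- paid only when that mode differs from the previous one. The two remaining factors `C` convert
  -- from and to the L² norm.
  have hgrid : ∀ k : ℕ, ‖(M (x (k * h))).Φ (gridState T x z₀ h k)‖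
      ≤ C * Real.exp (ω * (k * h)) * ‖z₀‖ * jumpWeight C (fun j => x (j * h)) k := by
    intro k
    induction k with
    | zero => simpa [gridState, jumpWeight] using h2 _ z₀
    | succ k ih =>
      have h4 : ‖(M (x (k * h))).Φ (gridState T x z₀ h (k + 1))‖
          ≤ C * Real.exp (ω * ((k + 1 : ℕ) * h)) * ‖z₀‖ * jumpWeight C (fun j => x (j * h)) k := by
        refine (hstep _ _ _ hh.le).trans ((mul_le_mul_of_nonneg_left ih (Real.exp_pos _).le).trans_eq ?_)
        have : Real.exp (ω * ((k + 1 : ℕ) * h)) = Real.exp (ω * h) * Real.exp (ω * (k * h)) := by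
          rw [← Real.exp_add]; push_cast; ring_nf
        rw [this]; ring
      rw [jumpWeight_succ]
      split_ifs with hx
      · rw [mul_one, ← hx]
        exact h4
      · refine (h3 _ (x (k * h)) _).trans ((mul_le_mul_of_nonneg_left h4 hC0).trans_eq ?_)
        ring
  have hfl : ⌊t / h⌋₊ * h ≤ t := (le_div_iff₀ hh).mp (Nat.floor_le (div_nonneg ht hh.le))
  set k := ⌊t / h⌋₊ with hk
  calc ‖approx T x z₀ h t‖ ≤ C * ‖(M (x (k * h))).Φ (approx T x z₀ h t)‖ := h1 _ _
    _ ≤ C * (Real.exp (ω * (t - k * h)) * ‖(M (x (k * h))).Φ (gridState T x z₀ h k)‖) := by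
        gcongr
        exact hstep _ _ _ (sub_nonneg.mpr hfl)
    _ ≤ C * (Real.exp (ω * (t - k * h)) * (C * Real.exp (ω * (k * h)) * ‖z₀‖
          * jumpWeight C (fun j => x (j * h)) k)) := by
        gcongr
        exact hgrid k
    _ = _ := by
        have : Real.exp (ω * t) = Real.exp (ω * (t - k * h)) * Real.exp (ω * (k * h)) := by
          rw [← Real.exp_add]; ring_nf
        rw [this]; ring

end HyperbolicBVP

section JumpWeight

variable {ι : Type*} [DecidableEq ι] {y : ℕ → ι}

theorem jumpWeight_mono {C : ℝ} (hC : 1 ≤ C) (y : ℕ → ι) : Monotone (jumpWeight C y) := by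
  refine monotone_nat_of_le_succ fun k => ?_
  rw [jumpWeight_succ]
  refine le_mul_of_one_le_right (jumpWeight_nonneg (zero_le_one.trans hC) y k) ?_
  split_ifs
  · exact le_rfl
  · exact hC

/-- Different end values force a change at some intermediate step: either the last step is one, or
the induction hypothesis applies before it. -/
theorem mul_jumpWeight_le {C : ℝ} (hC : 1 ≤ C) {a b : ℕ} (hab : a ≤ b) (h : y a ≠ y b) :
    C * jumpWeight C y a ≤ jumpWeight C y b := by
  induction b, hab using Nat.le_induction with
  | base => exact absurd rfl h
  | succ b hab ih =>
    rw [jumpWeight_succ]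
    split_ifs with hb
    · rw [mul_one]
      exact ih (by rwa [hb])
    · rw [mul_comm]
      have := jumpWeight_mono hC y hab
      gcongr

theorem pow_le_jumpWeight {C : ℝ} (hC : 1 ≤ C) {j : ℕ → ℕ} (hj : Monotone j) {m : ℕ}
    (h : ∀ k < m, y (j k) ≠ y (j (k + 1))) : C ^ m ≤ jumpWeight C y (j m) := by
  induction m with
  | zero =>
    rw [pow_zero]
    simpa [jumpWeight] using jumpWeight_mono hC y (Nat.zero_le (j 0))
  | succ m ih =>
    have h1 := ih fun k hk => h k (hk.trans (Nat.lt_succ_self m))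
    have h2 := mul_jumpWeight_le hC (hj (Nat.le_succ m)) (h m (Nat.lt_succ_self m))
    rw [pow_succ']
    exact (mul_le_mul_of_nonneg_left h1 (zero_le_one.trans hC)).trans h2

end JumpWeight

/-- A right-continuous path whose number of changes along infinitely many of the grids is bounded
on every bounded interval has left limits. -/
theorem hasLeftLimits_of_jumpWeight {r : ℕ} {x : ℝ → Fin r} (hx : IsRightCont x) {h : ℕ → ℝ}
    (hh : ∀ n, 0 < h n) (hh0 : Tendsto h atTop (𝓝 0))
    (hb : ∀ N : ℕ, ∃ V : ℝ, ∃ᶠ n in atTop,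
      jumpWeight 2 (fun j => x (j * h n)) ⌊(N : ℝ) / h n⌋₊ ≤ V) : HasLeftLimits x := by
  intro t ht
  by_contra! hcon
  -- Without a left limit at `t`, every earlier time is followed, still before `t`, by one with
  -- another mode. Iteration produces arbitrarily many changes before `t`.
  have hnext : ∀ u : ℝ, ∃ v, u < t → u < v ∧ v < t ∧ x u ≠ x v := by
    intro u
    by_cases hu : u < t
    · obtain ⟨v, hv, hv'⟩ := ((hcon (x u)).and_eventually (Ioo_mem_nhdsLT hu)).exists
      exact ⟨v, fun _ => ⟨hv'.1, hv'.2, fun he => hv he.symm⟩⟩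
    · exact ⟨0, fun h => absurd h hu⟩
  choose f hf using hnext
  let u : ℕ → ℝ := fun k => f^[k] 0
  have hu0 : u 0 = 0 := rfl
  have husucc : ∀ k, u (k + 1) = f (u k) := fun k => Function.iterate_succ_apply' f k 0
  have hut : ∀ k, u k < t := by
    intro k
    induction k with
    | zero => exact ht
    | succ k ih => rw [husucc]; exact (hf _ ih).2.1
  have hmono : StrictMono u := strictMono_nat_of_lt_succ fun k => by
    rw [husucc]; exact (hf _ (hut k)).1
  have hne : ∀ k, x (u k) ≠ x (u (k + 1)) := fun k => by
    rw [husucc]; exact (hf _ (hut k)).2.2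
  have hunn : ∀ k, 0 ≤ u k := fun k => by rw [← hu0]; exact hmono.monotone (Nat.zero_le k)
  -- The extra unit of time leaves room for the grid point following `u m`, once the step is at most
  -- 1.
  obtain ⟨V, hV⟩ := hb (⌈t⌉₊ + 1)
  obtain ⟨m, hm⟩ := pow_unbounded_of_one_lt V (one_lt_two (α := ℝ))
  -- By right-continuity a fine grid sees the mode of `u k` at the first grid point after it. Hence
  -- it sees `m` changes, although `2 ^ m` exceeds `V`.
  have hgrid : ∀ k, ∀ᶠ n in atTop, x ((⌊u k / h n⌋₊ + 1 : ℕ) * h n) = x (u k) := by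
    intro k
    have h1 : ∀ n, u k ≤ (⌊u k / h n⌋₊ + 1 : ℕ) * h n := fun n => by
      push_cast
      exact ((div_lt_iff₀ (hh n)).mp (Nat.lt_floor_add_one _)).le
    have h2 : ∀ n, (⌊u k / h n⌋₊ + 1 : ℕ) * h n ≤ u k + h n := fun n => by
      have := (le_div_iff₀ (hh n)).mp (Nat.floor_le (div_nonneg (hunn k) (hh n).le))
      push_cast
      linarith
    have h3 : Tendsto (fun n => ((⌊u k / h n⌋₊ + 1 : ℕ) : ℝ) * h n) atTop (𝓝[≥] (u k)) := by
      refine tendsto_nhdsWithin_iff.mpr ⟨?_, .of_forall h1⟩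
      refine tendsto_of_tendsto_of_tendsto_of_le_of_le tendsto_const_nhds ?_ h1 h2
      simpa using hh0.const_add (u k)
    exact h3.eventually (hx _ (hunn k))
  have hall : ∀ᶠ n in atTop, ∀ k ∈ Finset.range (m + 1),
      x ((⌊u k / h n⌋₊ + 1 : ℕ) * h n) = x (u k) :=
    (Filter.eventually_all_finset _).mpr fun k _ => hgrid k
  obtain ⟨n, hnV, hn1, hn2⟩ := (hV.and_eventually (hall.and (hh0.eventually_le_const one_pos))).exists
  have h1 := pow_le_jumpWeight (y := fun j => x (j * h n)) one_le_two
    (j := fun k => ⌊u k / h n⌋₊ + 1) (m := m) (fun k l hkl => by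
      have := hmono.monotone hkl
      have := hh n
      dsimp only
      gcongr) (fun k hk => by
      rw [hn1 k (Finset.mem_range.mpr (by omega)), hn1 (k + 1) (Finset.mem_range.mpr (by omega))]
      exact hne k)
  have h2 : ⌊u m / h n⌋₊ + 1 ≤ ⌊((⌈t⌉₊ + 1 : ℕ) : ℝ) / h n⌋₊ := by
    have := hh n
    rw [Nat.le_floor_iff (by positivity), le_div_iff₀ (hh n)]
    have h3 := (le_div_iff₀ (hh n)).mp (Nat.floor_le (div_nonneg (hunn m) (hh n).le))
    push_cast
    linarith [hut m, Nat.le_ceil t]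
  have h3 := jumpWeight_mono one_le_two (fun j : ℕ => x (j * h n)) h2
  linarith

/-- The total mass of a product of kernels with row sums at most `q`. -/
theorem sum_prod_kernel_le {r : ℕ} {q : ℝ} (hq : 0 ≤ q) (a : Fin r → ℝ) (ha : ∀ i, 0 ≤ a i)
    (K : ℕ → Fin r → Fin r → ℝ) (hK : ∀ m i j, 0 ≤ K m i j) (hKq : ∀ m i, ∑ j, K m i j ≤ q) (k : ℕ) :
    ∑ i : Fin (k + 1) → Fin r, a (i 0) * ∏ m : Fin k, K m (i m.castSucc) (i m.succ)
      ≤ (∑ i, a i) * q ^ k := by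
  induction k with
  | zero =>
    simp only [Finset.univ_eq_empty, Finset.prod_empty, mul_one, pow_zero]
    rw [← (Equiv.funUnique (Fin 1) (Fin r)).symm.sum_comp]
    simp
  | succ k ih =>
    -- The last coordinate is summed out first; it contributes one row sum, at most `q`.
    rw [← (Fin.snocEquiv fun _ : Fin (k + 2) => Fin r).sum_comp, Fintype.sum_prod_type_right]
    have h1 : ∀ i : Fin (k + 1) → Fin r, ∑ j : Fin r,
        a ((Fin.snocEquiv fun _ : Fin (k + 2) => Fin r) (j, i) 0) * ∏ m : Fin (k + 1), K m
          ((Fin.snocEquiv fun _ : Fin (k + 2) => Fin r) (j, i) m.castSucc)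
          ((Fin.snocEquiv fun _ : Fin (k + 2) => Fin r) (j, i) m.succ)
        ≤ (a (i 0) * ∏ m : Fin k, K m (i m.castSucc) (i m.succ)) * q := by
      intro i
      have h2 : ∀ j : Fin r, a ((Fin.snocEquiv fun _ : Fin (k + 2) => Fin r) (j, i) 0)
          * ∏ m : Fin (k + 1), K m
          ((Fin.snocEquiv fun _ : Fin (k + 2) => Fin r) (j, i) m.castSucc)
          ((Fin.snocEquiv fun _ : Fin (k + 2) => Fin r) (j, i) m.succ)
          = (a (i 0) * ∏ m : Fin k, K m (i m.castSucc) (i m.succ)) * K k (i (Fin.last k)) j := by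
        intro j
        rw [Fin.prod_univ_castSucc, ← mul_assoc]
        simp only [Fin.snocEquiv_apply, Fin.snoc_castSucc, Fin.succ_last, Fin.snoc_last,
          Fin.val_last, Fin.val_castSucc, Fin.succ_castSucc]
        congr 2
      simp only [h2]
      rw [← Finset.mul_sum]
      refine mul_le_mul_of_nonneg_left (hKq _ _) (mul_nonneg (ha _) ?_)
      exact Finset.prod_nonneg fun m _ => hK _ _ _
    refine (Finset.sum_le_sum fun i _ => h1 i).trans ?_
    rw [← Finset.sum_mul, pow_succ, ← mul_assoc]
    gcongr

namespace IsTransitionFamily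

variable {r : ℕ} {τ : Fin r → Fin r → ℝ → ℝ} {τmax : ℝ} {P : Fin r → Fin r → ℝ → ℝ → ℝ}
  (hP : IsTransitionFamily τ τmax P)

include hP

theorem mul_rate_nonneg : 0 ≤ r * τmax := by
  rcases Nat.eq_zero_or_pos r with h | h
  · simp [h]
  · exact mul_nonneg (Nat.cast_nonneg r)
      ((hP.rate_nonneg ⟨0, h⟩ ⟨0, h⟩ 0 le_rfl).trans (hP.rate_le _ _ 0 le_rfl))

/-- The total exit rate is at most `r * τmax` and the return terms are nonnegative, so adding `r *
τmax * t` makes the probability of being at `i` nondecreasing. -/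
theorem one_sub_le (i : Fin r) {ϱ t : ℝ} (hϱ : 0 ≤ ϱ) (ht : ϱ ≤ t) :
    1 - r * τmax * (t - ϱ) ≤ P i i ϱ t := by
  have hmono : MonotoneOn (fun t => P i i ϱ t + r * τmax * t) (Ici ϱ) := by
    have hd : ∀ t, ϱ < t → HasDerivAt (fun t => P i i ϱ t + r * τmax * t)
        (-(∑ k, τ i k t) * P i i ϱ t + ∑ k, P i k ϱ t * τ k i t + r * τmax) t := fun t ht => by
      have := (hP.forward i i ϱ t hϱ ht).fun_add ((hasDerivAt_id t).const_mul ((r : ℝ) * τmax))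
      simpa using this
    refine monotoneOn_of_deriv_nonneg (convex_Ici ϱ) ((hP.prob_cont i i ϱ hϱ).add (by fun_prop))
      (fun t ht => ?_) fun t ht => ?_
    · rw [interior_Ici] at ht
      exact (hd t ht).differentiableAt.differentiableWithinAt
    · rw [interior_Ici] at ht
      rw [(hd t ht).deriv]
      have ht0 : 0 ≤ t := hϱ.trans (le_of_lt ht)
      have hm := fun k => hP.prob_mem i k ϱ t hϱ (le_of_lt ht)
      have h1 : ∑ k, τ i k t ≤ r * τmax := by
        refine (Finset.sum_le_sum fun k _ => hP.rate_le i k t ht0).trans_eq ?_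
        simp
      have h2 : 0 ≤ ∑ k, τ i k t := Finset.sum_nonneg fun k _ => hP.rate_nonneg i k t ht0
      have h3 : 0 ≤ ∑ k, P i k ϱ t * τ k i t :=
        Finset.sum_nonneg fun k _ => mul_nonneg (hm k).1 (hP.rate_nonneg k i t ht0)
      nlinarith [mul_le_mul_of_nonneg_left (hm i).2 h2]
  have h := hmono (mem_Ici.mpr le_rfl) (mem_Ici.mpr ht) ht
  simp only [hP.prob_self i i ϱ hϱ, if_true] at h
  linarith

/-- As rows sum to 1, the weighted sum is `C - (C - 1) * P i i ϱ t`, and the lower bound on the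
diagonal suffices. -/
theorem sum_weight_le {C : ℝ} (hC : 1 ≤ C) (i : Fin r) {ϱ t : ℝ} (hϱ : 0 ≤ ϱ) (ht : ϱ ≤ t) :
    ∑ j, P i j ϱ t * (if i = j then 1 else C) ≤ 1 + (C - 1) * (r * τmax * (t - ϱ)) := by
  have h1 : ∀ j, P i j ϱ t * (if i = j then 1 else C)
      = C * P i j ϱ t - (C - 1) * (if i = j then P i j ϱ t else 0) := fun j => by
    split_ifs <;> ring
  simp only [h1]
  rw [Finset.sum_sub_distrib, ← Finset.mul_sum, ← Finset.mul_sum, hP.prob_sum i ϱ t hϱ ht,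
    Finset.sum_ite_eq]
  simp only [Finset.mem_univ, if_true]
  have := hP.one_sub_le i hϱ ht
  nlinarith

end IsTransitionFamily

namespace IsMarkovChain

variable {Ω : Type*} [MeasurableSpace Ω] {μ : Measure Ω} [IsProbabilityMeasure μ] {r : ℕ}
  {τ : Fin r → Fin r → ℝ → ℝ} {τmax : ℝ} {P : Fin r → Fin r → ℝ → ℝ → ℝ} {X : ℝ → Ω → Fin r}

/-- Exponential moments of the number of mode changes along a grid. -/
theorem lintegral_jumpWeight_le (hX : IsMarkovChain μ P X) (hP : IsTransitionFamily τ τmax P)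
    {C : ℝ} (hC : 1 ≤ C) {h : ℝ} (hh : 0 ≤ h) (k : ℕ) :
    ∫⁻ ω, ENNReal.ofReal (jumpWeight C (fun j => X (j * h) ω) k) ∂μ
      ≤ ENNReal.ofReal ((1 + (C - 1) * (r * τmax * h)) ^ k) := by
  -- The weight depends on the path only through `k + 1` values, so its expectation is a finite sum
  -- against their joint law. That law is a product of kernels, into which the weight is absorbed
  -- factor by factor.
  let Y : Ω → Fin (k + 1) → Fin r := fun ω m => X (m * h) ω
  have hY : Measurable Y := measurable_pi_lambda _ fun m => hX.measurable _ (by positivity)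
  let w : (Fin (k + 1) → Fin r) → ℝ := fun i =>
    ∏ m : Fin k, if i m.castSucc = i m.succ then 1 else C
  have hC0 : 0 ≤ C := zero_le_one.trans hC
  have hw0 : ∀ i, 0 ≤ w i := fun i =>
    Finset.prod_nonneg fun m _ => by split_ifs <;> positivity
  have hwY : ∀ ω, jumpWeight C (fun j => X (j * h) ω) k = w (Y ω) := by
    intro ω
    rw [jumpWeight, Finset.prod_range]
    refine Finset.prod_congr rfl fun m _ => ?_
    simp [Y]
  simp only [hwY]
  rw [← lintegral_map (f := fun i => ENNReal.ofReal (w i)) (measurable_of_countable _) hY,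
    lintegral_fintype]
  have hlaw : ∀ i, (μ.map Y) {i} = ENNReal.ofReal (μ.real {ω | X 0 ω = i 0}
      * ∏ m : Fin k, P (i m.castSucc) (i m.succ) (m * h) ((m + 1 : ℕ) * h)) := by
    intro i
    rw [Measure.map_apply hY (measurableSet_singleton i), ← ofReal_measureReal]
    congr 1
    have := hX.markov k (fun m => (m : ℕ) * h) i (by simp) (fun m n hmn => by
      dsimp only
      gcongr
      exact hmn)
    simp only [Fin.val_zero, Nat.cast_zero, zero_mul, Fin.val_castSucc, Fin.val_succ] at this
    rw [← this]
    congr 1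
    ext ω
    simp [Y, funext_iff]
  simp only [hlaw]
  have hPnn : ∀ (m : ℕ) i j, 0 ≤ P i j (m * h) ((m + 1 : ℕ) * h) := fun m i j =>
    (hP.prob_mem i j _ _ (by positivity) (by push_cast; nlinarith)).1
  have hq : 0 ≤ 1 + (C - 1) * (r * τmax * h) := by
    have := hP.mul_rate_nonneg
    have := sub_nonneg.mpr hC
    positivity
  have hsum := sum_prod_kernel_le (q := 1 + (C - 1) * (r * τmax * h)) ?_
    (fun i => μ.real {ω | X 0 ω = i}) (fun i => measureReal_nonneg)
    (fun m i j => P i j (m * h) ((m + 1 : ℕ) * h) * if i = j then 1 else C)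
    (fun m i j => mul_nonneg (hPnn m i j) (by split_ifs <;> positivity))
    (fun m i => by
      have := hP.sum_weight_le hC i (ϱ := m * h) (t := (m + 1 : ℕ) * h) (by positivity)
        (by push_cast; nlinarith)
      refine this.trans_eq ?_
      push_cast
      ring) k
  · have hmass : ∑ i, μ.real {ω | X 0 ω = i} ≤ 1 := by
      have hX0 := hX.measurable 0 le_rfl
      have := measureReal_biUnion_finset (μ := μ) (s := Finset.univ)
        (f := fun i => {ω | X 0 ω = i})
        (fun i _ j _ hij => Set.disjoint_left.mpr fun ω h1 h2 => hij (Eq.trans (Eq.symm h1) h2))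
        fun i _ => hX0 (measurableSet_singleton i)
      exact this.symm.trans_le measureReal_le_one
    calc ∑ i, ENNReal.ofReal (w i) * ENNReal.ofReal (μ.real {ω | X 0 ω = i 0}
          * ∏ m : Fin k, P (i m.castSucc) (i m.succ) (m * h) ((m + 1 : ℕ) * h))
        = ENNReal.ofReal (∑ i : Fin (k + 1) → Fin r, μ.real {ω | X 0 ω = i 0} * ∏ m : Fin k,
          (P (i m.castSucc) (i m.succ) (m * h) ((m + 1 : ℕ) * h)
            * if i m.castSucc = i m.succ then 1 else C)) := by
          rw [ENNReal.ofReal_sum_of_nonneg]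
          · refine Finset.sum_congr rfl fun i _ => ?_
            rw [← ENNReal.ofReal_mul (hw0 i), Finset.prod_mul_distrib]
            congr 1
            simp only [w]
            ring
          · intro i _
            refine mul_nonneg measureReal_nonneg (Finset.prod_nonneg fun m _ => ?_)
            exact mul_nonneg (hPnn _ _ _) (by split_ifs <;> positivity)
      _ ≤ _ := by
          refine ENNReal.ofReal_le_ofReal (hsum.trans ?_)
          refine mul_le_of_le_one_left (pow_nonneg ?_ _) hmass
          exact hq
  · exact hq

end IsMarkovChain

theorem one_add_mul_pow_floor_le {R t h : ℝ} (hR : 0 ≤ R) (ht : 0 ≤ t) (hh : 0 < h) :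
    (1 + R * h) ^ ⌊t / h⌋₊ ≤ Real.exp (R * t) := by
  have h1 : (1 + R * h) ^ ⌊t / h⌋₊ ≤ Real.exp (R * h) ^ ⌊t / h⌋₊ := by
    gcongr
    linarith [Real.add_one_le_exp (R * h)]
  refine h1.trans ?_
  rw [← Real.exp_nat_mul]
  have h2 := (le_div_iff₀ hh).mp (Nat.floor_le (div_nonneg ht hh.le))
  refine Real.exp_le_exp.mpr ?_
  nlinarith

/-- Measurability of a random switch between finitely many functions. -/
theorem stronglyMeasurable_switch {Ω G : Type*} [MeasurableSpace Ω] [NormedAddCommGroup G] {r : ℕ}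
    {Y : Ω → Fin r} (hY : Measurable Y) {f : Fin r → Ω → G} (hf : ∀ i, StronglyMeasurable (f i)) :
    StronglyMeasurable fun ω => f (Y ω) ω := by
  have h1 : StronglyMeasurable fun ω => ∑ i, {ω | Y ω = i}.indicator (f i) ω :=
    Finset.stronglyMeasurable_fun_sum _ fun i _ =>
      (hf i).indicator (hY (measurableSet_singleton i))
  convert h1 using 2 with ω
  rw [Finset.sum_eq_single (Y ω)]
  · exact (indicator_of_mem (s := {ω' | Y ω' = Y ω}) rfl _).symm
  · intro i _ hi
    exact indicator_of_notMem (s := {ω' | Y ω' = i}) (fun h => hi h.symm) _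
  · simp

namespace IsMarkovChain

variable {Ω : Type*} [MeasurableSpace Ω] {μ : Measure Ω} [IsProbabilityMeasure μ] {r : ℕ}
  {τ : Fin r → Fin r → ℝ → ℝ} {τmax : ℝ} {P : Fin r → Fin r → ℝ → ℝ → ℝ} {X : ℝ → Ω → Fin r}

/-- The bound does not depend on the step, which is what allows refinement of the grid. -/
theorem lintegral_jumpWeight_floor_le (hX : IsMarkovChain μ P X)
    (hP : IsTransitionFamily τ τmax P) {C : ℝ} (hC : 1 ≤ C) {h t : ℝ} (hh : 0 < h) (ht : 0 ≤ t) :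
    ∫⁻ ω, ENNReal.ofReal (jumpWeight C (fun j => X (j * h) ω) ⌊t / h⌋₊) ∂μ
      ≤ ENNReal.ofReal (Real.exp ((C - 1) * (r * τmax) * t)) := by
  refine (hX.lintegral_jumpWeight_le hP hC hh.le _).trans (ENNReal.ofReal_le_ofReal ?_)
  have := one_add_mul_pow_floor_le (R := (C - 1) * (r * τmax))
    (mul_nonneg (sub_nonneg.mpr hC) hP.mul_rate_nonneg) ht hh
  rwa [mul_assoc (C - 1)] at this

omit [IsProbabilityMeasure μ] in
theorem measurable_jumpWeight (hX : IsMarkovChain μ P X) (C : ℝ) {h : ℝ} (hh : 0 ≤ h) (k : ℕ) :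
    Measurable fun ω => jumpWeight C (fun j => X (j * h) ω) k := by
  refine Finset.measurable_fun_prod _ fun j _ => ?_
  exact Measurable.ite (measurableSet_eq_fun (hX.measurable _ (by positivity))
    (hX.measurable _ (by positivity))) measurable_const measurable_const

/-- Almost all paths of a Markov chain with bounded rates have left limits. -/
theorem ae_hasLeftLimits (hX : IsMarkovChain μ P X) (hP : IsTransitionFamily τ τmax P) :
    ∀ᵐ ω ∂μ, HasLeftLimits fun t => X t ω := by
  let h : ℕ → ℝ := fun n => 1 / ((n : ℝ) + 1)
  have hh : ∀ n, 0 < h n := fun n => Nat.one_div_pos_of_nat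
  -- By Fatou's lemma the lower limit of the weights has finite expectation, so almost surely, for
  -- every horizon `N`, infinitely many grids see boundedly many changes.
  have hb : ∀ᵐ ω ∂μ, ∀ N : ℕ, liminf (fun n => ENNReal.ofReal
      (jumpWeight 2 (fun j => X (j * h n) ω) ⌊(N : ℝ) / h n⌋₊)) atTop < ⊤ := by
    refine ae_all_iff.mpr fun N => ?_
    have hmeas : ∀ n, Measurable fun ω => ENNReal.ofReal
        (jumpWeight 2 (fun j => X (j * h n) ω) ⌊(N : ℝ) / h n⌋₊) := fun n =>
      (hX.measurable_jumpWeight 2 (hh n).le _).ennreal_ofReal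
    refine ae_lt_top (.liminf hmeas) (ne_of_lt ?_)
    refine ((lintegral_liminf_le hmeas).trans ?_).trans_lt
      (ENNReal.ofReal_lt_top (r := Real.exp ((2 - 1) * (r * τmax) * N)))
    refine liminf_le_of_frequently_le' (.of_forall fun n => ?_)
    exact hX.lintegral_jumpWeight_floor_le hP one_le_two (hh n) (Nat.cast_nonneg N)
  filter_upwards [hX.rightCont, hb] with ω hω hω'
  refine hasLeftLimits_of_jumpWeight hω hh tendsto_one_div_add_atTop_nhds_zero_nat fun N => ?_
  obtain ⟨V, hV, -⟩ := ENNReal.lt_iff_exists_nnreal_btwn.mp (hω' N)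
  refine ⟨V, (frequently_lt_of_liminf_lt (by isBoundedDefault) hV).mono fun n hn => ?_⟩
  have := ENNReal.ofReal_le_iff_le_toReal ENNReal.coe_ne_top |>.mp hn.le
  simpa using this

end IsMarkovChain

/-! ### The solution process: measurability and finite mean. -/

namespace HyperbolicBVP

variable {E F : Type*} [NormedAddCommGroup E] [InnerProductSpace ℝ E]
    [FiniteDimensional ℝ E] [NormedAddCommGroup F] [NormedSpace ℝ F] [FiniteDimensional ℝ F]
    {L : ℝ} {r : ℕ} {T : Fin r → ℝ → L2 E L →L[ℝ] L2 E L} {M : Fin r → HyperbolicBVP E F L}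

-- Only finitely many values of the chain enter, and each selects one of finitely many continuous
-- operators.
omit [FiniteDimensional ℝ E] in
theorem stronglyMeasurable_approx {Ω : Type*} [MeasurableSpace Ω] {X : ℝ → Ω → Fin r}
    (hX : ∀ t, 0 ≤ t → Measurable (X t)) (z₀ : L2 E L) {h : ℝ} (hh : 0 ≤ h) (t : ℝ) :
    StronglyMeasurable fun ω => approx T (fun t => X t ω) z₀ h t := by
  have h1 : ∀ k, StronglyMeasurable fun ω => gridState T (fun t => X t ω) z₀ h k := by
    intro k
    induction k with
    | zero => exact stronglyMeasurable_const
    | succ k ih =>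
      exact stronglyMeasurable_switch (hX _ (by positivity)) fun i =>
        (T i h).continuous.comp_stronglyMeasurable ih
  exact stronglyMeasurable_switch (f := fun i ω => T i (t - ⌊t / h⌋₊ * h) _)
    (hX _ (by positivity)) fun i => (T i _).continuous.comp_stronglyMeasurable (h1 _)

/-- The solution process of a boundary value problem with Markovian coefficients. -/
theorem exists_process {Ω : Type*} [MeasurableSpace Ω] {μ : Measure Ω} [IsProbabilityMeasure μ]
    {τ : Fin r → Fin r → ℝ → ℝ} {τmax : ℝ} {P : Fin r → Fin r → ℝ → ℝ → ℝ} {X : ℝ → Ω → Fin r}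
    (hP : IsTransitionFamily τ τmax P) (hX : IsMarkovChain μ P X)
    (hT : ∀ i, (M i).IsEvolution (T i)) (z₀ : L2 E L) :
    ∃ Z : ℝ → Ω → L2 E L,
      (∀ᵐ ω ∂μ, Z 0 ω = z₀ ∧ ∀ a b i, 0 ≤ a → (∀ t ∈ Ico a b, X t ω = i) →
        ∀ t ∈ Icc a b, Z t ω = T i (t - a) (Z a ω)) ∧
      ∀ t, 0 ≤ t → AEStronglyMeasurable (Z t) μ ∧ ∫⁻ ω, ‖Z t ω‖ₑ ∂μ < ⊤ := by
  let h : ℕ → ℝ := fun n => 1 / ((n : ℝ) + 1)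
  have hh : ∀ n, 0 < h n := fun n => Nat.one_div_pos_of_nat
  have hh0 : Tendsto h atTop (𝓝 0) := tendsto_one_div_add_atTop_nhds_zero_nat
  -- `Z` is defined for every outcome; where the approximations diverge it takes the value 0.
  have hlim : ∀ t ω, ∃ w, (∃ w, Tendsto (fun n => approx T (fun t => X t ω) z₀ (h n) t)
      atTop (𝓝 w)) → Tendsto (fun n => approx T (fun t => X t ω) z₀ (h n) t) atTop (𝓝 w) := by
    intro t ω
    by_cases hw : ∃ w, Tendsto (fun n => approx T (fun t => X t ω) z₀ (h n) t) atTop (𝓝 w)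
    · exact ⟨hw.choose, fun _ => hw.choose_spec⟩
    · exact ⟨0, fun hw' => absurd hw' hw⟩
  choose Z hZ using hlim
  have hZ' : ∀ᵐ ω ∂μ, ∀ t, 0 ≤ t →
      Tendsto (fun n => approx T (fun t => X t ω) z₀ (h n) t) atTop (𝓝 (Z t ω)) := by
    filter_upwards [hX.rightCont, hX.ae_hasLeftLimits hP] with ω h1 h2 t ht
    exact hZ t ω (exists_tendsto_approx hT h1 h2 z₀ hh hh0 ht)
  have hmeas : ∀ n t, StronglyMeasurable fun ω => approx T (fun t => X t ω) z₀ (h n) t :=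
    fun n t => stronglyMeasurable_approx hX.measurable z₀ (hh n).le t
  refine ⟨Z, ?_, fun t ht => ?_⟩
  · filter_upwards [hZ'] with ω hω
    refine ⟨tendsto_nhds_unique (hω 0 le_rfl) (tendsto_const_nhds.congr fun n => ?_),
      fun a b i ha hi t ht => ?_⟩
    · simp [approx, (hT _).zero, gridState]
    · exact tendsto_nhds_unique (hω t (ha.trans ht.1))
        (tendsto_approx_of_const hT hh hh0 ha hi (hω a ha) ht)
  · refine ⟨aestronglyMeasurable_of_tendsto_ae atTop
      (fun n => (hmeas n t).aestronglyMeasurable) (hZ'.mono fun ω hω => hω t ht), ?_⟩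
    obtain ⟨C, ω₀, hC, -, hω₀, h1, h2, h3⟩ := exists_uniform_constants M
    set A := C ^ 2 * Real.exp (ω₀ * t) * ‖z₀‖ with hA
    have hA0 : 0 ≤ A := by positivity
    -- Fatou's lemma transfers the bound, uniform in the grid, to the limit.
    calc ∫⁻ ω, ‖Z t ω‖ₑ ∂μ
        = ∫⁻ ω, liminf (fun n => ‖approx T (fun t => X t ω) z₀ (h n) t‖ₑ) atTop ∂μ := by
          refine lintegral_congr_ae (hZ'.mono fun ω hω => ?_)
          exact ((hω t ht).enorm.liminf_eq).symm
      _ ≤ liminf (fun n => ∫⁻ ω, ‖approx T (fun t => X t ω) z₀ (h n) t‖ₑ ∂μ) atTop :=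
          lintegral_liminf_le fun n => (hmeas n t).enorm
      _ ≤ ENNReal.ofReal A * ENNReal.ofReal (Real.exp ((C - 1) * (r * τmax) * t)) := by
          refine liminf_le_of_frequently_le' (.of_forall fun n => ?_)
          refine le_trans ?_ (mul_le_mul_right
            (hX.lintegral_jumpWeight_floor_le hP hC (hh n) ht) _)
          rw [← lintegral_const_mul _ (hX.measurable_jumpWeight C (hh n).le _).ennreal_ofReal]
          refine lintegral_mono fun ω => ?_
          rw [← ENNReal.ofReal_mul hA0, ← ofReal_norm]
          exact ENNReal.ofReal_le_ofReal
            (norm_approx_le hT hC hω₀ h1 h2 h3 (fun t => X t ω) z₀ (hh n) ht)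
      _ < ⊤ := ENNReal.mul_lt_top ENNReal.ofReal_lt_top ENNReal.ofReal_lt_top

theorem exists_isEvolution (M : HyperbolicBVP E F L) : ∃ T, M.IsEvolution T := by
  obtain ⟨T, h1, h2, h3, h4, h5, h6⟩ := M.exists_semigroup
  exact ⟨T, h1, h2, h3, h4, h5, h6⟩

end HyperbolicBVP

/-! ### Exponential weights and the energy estimate for diagonalizable systems. -/

section Multiplication

variable {E : Type*} [NormedAddCommGroup E] [InnerProductSpace ℝ E] [FiniteDimensional ℝ E]

omit [FiniteDimensional ℝ E] in
/-- Multiplication by a continuous operator-valued function is bounded on `L²((0, L); E)`. -/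
theorem exists_mulOperator (L : ℝ) {G : ℝ → E →L[ℝ] E} (hG : Continuous G) :
    ∃ N : L2 E L →L[ℝ] L2 E L, ∀ z : L2 E L, N z =ᵐ[volume.restrict (Ioo 0 L)] fun x => G x (z x) := by
  obtain ⟨C, hC⟩ := isCompact_Icc.exists_bound_of_continuousOn (s := Icc 0 L) hG.continuousOn
  have hb : ∀ z : L2 E L, ∀ᵐ x ∂(volume.restrict (Ioo 0 L)), ‖G x (z x)‖ ≤ |C| * ‖z x‖ := by
    intro z
    filter_upwards [ae_restrict_mem measurableSet_Ioo] with x hx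
    refine (G x).le_of_opNorm_le ?_ _
    exact (hC x (Ioo_subset_Icc_self hx)).trans (le_abs_self C)
  have hm : ∀ z : L2 E L, MemLp (fun x => G x (z x)) 2 (volume.restrict (Ioo 0 L)) := fun z =>
    (Lp.memLp z).of_le_mul (isBoundedBilinearMap_apply.continuous.comp_aestronglyMeasurable
      (hG.aestronglyMeasurable.prodMk (Lp.aestronglyMeasurable z))) (hb z)
  let N₀ : L2 E L →ₗ[ℝ] L2 E L :=
    { toFun := fun z => (hm z).toLp _
      map_add' := fun y z => by
        refine Lp.ext ?_
        filter_upwards [(hm (y + z)).coeFn_toLp, (hm y).coeFn_toLp, (hm z).coeFn_toLp,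
          Lp.coeFn_add y z, Lp.coeFn_add ((hm y).toLp _) ((hm z).toLp _)] with x h1 h2 h3 h4 h5
        rw [h1, h5, Pi.add_apply, h2, h3, h4, Pi.add_apply, map_add]
      map_smul' := fun r z => by
        refine Lp.ext ?_
        filter_upwards [(hm (r • z)).coeFn_toLp, (hm z).coeFn_toLp, Lp.coeFn_smul r z,
          Lp.coeFn_smul r ((hm z).toLp _)] with x h1 h2 h3 h4
        rw [h1, RingHom.id_apply, h4, Pi.smul_apply, h2, h3, Pi.smul_apply, map_smul] }
  refine ⟨N₀.mkContinuous |C| fun z => Lp.norm_le_mul_norm_of_ae_le_mul ?_,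
    fun z => (hm z).coeFn_toLp⟩
  filter_upwards [(hm z).coeFn_toLp, hb z] with x h1 h2
  exact (congrArg norm h1).trans_le h2

theorem mulOperator_cls {L : ℝ} {G : ℝ → E →L[ℝ] E} (hG : Continuous G) {N : L2 E L →L[ℝ] L2 E L}
    (hN : ∀ z : L2 E L, N z =ᵐ[volume.restrict (Ioo 0 L)] fun x => G x (z x)) {f : ℝ → E}
    (hf : Continuous f) : N (cls L f) = cls L fun x => G x (f x) := by
  refine Lp.ext ?_
  filter_upwards [hN (cls L f), coeFn_cls (L := L) hf, coeFn_cls (L := L) (hG.clm_apply hf)]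
    with x h1 h2 h3
  rw [h1, h2, h3]

/-- Multiplication by a continuous function with values in the invertible operators. -/
theorem exists_mulEquiv (L : ℝ) {G G' : ℝ → E →L[ℝ] E} (hG : Continuous G) (hG' : Continuous G')
    (h : ∀ x v, G' x (G x v) = v) (h' : ∀ x v, G x (G' x v) = v) :
    ∃ N : L2 E L ≃L[ℝ] L2 E L, ∀ f : ℝ → E, Continuous f →
      N (cls L f) = cls L fun x => G x (f x) := by
  obtain ⟨N, hN⟩ := exists_mulOperator L hG
  obtain ⟨N', hN'⟩ := exists_mulOperator L hG'
  refine ⟨ContinuousLinearEquiv.equivOfInverse N N' (fun z => Lp.ext ?_) (fun z => Lp.ext ?_),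
    fun f hf => mulOperator_cls hG hN hf⟩
  · filter_upwards [hN' (N z), hN z] with x h1 h2
    rw [h1, h2, h]
  · filter_upwards [hN (N' z), hN' z] with x h1 h2
    rw [h1, h2, h']

theorem inner_cls_cls {L : ℝ} {f g : ℝ → E} (hf : Continuous f) (hg : Continuous g) :
    ⟪cls L f, cls L g⟫ = ∫ x in Ioo 0 L, ⟪f x, g x⟫ := by
  rw [inner_cls hf]
  refine integral_congr_ae ?_
  filter_upwards [coeFn_cls (L := L) hg] with x hx
  rw [hx]

end Multiplication

section Diagonal

/-- The diagonal operator with entries `d`. -/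
noncomputable def diagOp (d : Fin 4 → ℝ) : EuclideanSpace ℝ (Fin 4) →L[ℝ] EuclideanSpace ℝ (Fin 4) :=
  Matrix.toEuclideanCLM (𝕜 := ℝ) (Matrix.diagonal d)

@[simp]
theorem diagOp_apply (d : Fin 4 → ℝ) (v : EuclideanSpace ℝ (Fin 4)) (k : Fin 4) :
    diagOp d v k = d k * v k := by
  simp [diagOp, Matrix.ofLp_toEuclideanCLM, Matrix.mulVec_diagonal]

theorem continuous_diagOp {d : ℝ → Fin 4 → ℝ} (hd : Continuous d) :
    Continuous fun x => diagOp (d x) := by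
  have h : Continuous (Matrix.toEuclideanCLM (𝕜 := ℝ) (n := Fin 4)) :=
    LinearMap.continuous_of_finiteDimensional
      ((Matrix.toEuclideanCLM (𝕜 := ℝ) (n := Fin 4)) : Matrix (Fin 4) (Fin 4) ℝ ≃⋆ₐ[ℝ] _).toAlgEquiv.toLinearMap
  exact h.comp hd.matrix_diagonal

/-- Dissipation through the boundary for sufficiently disparate weights. -/
theorem boundary_form_le {m Λ C K : ℝ} {l u v : Fin 4 → ℝ} {a : ℝ} (hK : 0 ≤ K) (hΛ : 0 ≤ Λ)
    (hl : ∀ k : Fin 3, m ≤ l k.castSucc ∧ l k.castSucc ≤ Λ) (hl₃ : m ≤ -l 3 ∧ -l 3 ≤ Λ)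
    (hKC : Λ * (6 * C + 1) ≤ K * m) (hu : ∀ k : Fin 3, u k.castSucc ^ 2 ≤ C * u 3 ^ 2)
    (hv : v 3 ^ 2 ≤ C * ((∑ k : Fin 3, v k.castSucc ^ 2) + a ^ 2)) (hC : 0 ≤ C) :
    (u 0 ^ 2 * l 0 + u 1 ^ 2 * l 1 + u 2 ^ 2 * l 2 + K * u 3 ^ 2 * l 3)
      - (K * v 0 ^ 2 * l 0 + K * v 1 ^ 2 * l 1 + K * v 2 ^ 2 * l 2 + v 3 ^ 2 * l 3)
      ≤ 2 * Λ * C * a ^ 2 - Λ * ((∑ k, u k ^ 2) + ∑ k, v k ^ 2) := by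
  -- Here `u` and `v` are the traces at 0 and `L` in Riemann coordinates, and `K` weights the
  -- outgoing components. At 0, `3 C` absorbs the incoming components and `3 C + 1` leaves `Λ` times
  -- all squares; at `L` the need is only `2 C + 1`. Hence the factor `6 C + 1`.
  rw [Fin.sum_univ_three] at hv
  rw [Fin.sum_univ_four, Fin.sum_univ_four]
  obtain ⟨a0, b0⟩ : m ≤ l 0 ∧ l 0 ≤ Λ := hl 0
  obtain ⟨a1, b1⟩ : m ≤ l 1 ∧ l 1 ≤ Λ := hl 1
  obtain ⟨a2, b2⟩ : m ≤ l 2 ∧ l 2 ≤ Λ := hl 2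
  have u0 : u 0 ^ 2 ≤ C * u 3 ^ 2 := hu 0
  have u1 : u 1 ^ 2 ≤ C * u 3 ^ 2 := hu 1
  have u2 : u 2 ^ 2 ≤ C * u 3 ^ 2 := hu 2
  change v 3 ^ 2 ≤ C * (v 0 ^ 2 + v 1 ^ 2 + v 2 ^ 2 + a ^ 2) at hv
  have U0 := mul_le_mul_of_nonneg_left b0 (sq_nonneg (u 0))
  have U1 := mul_le_mul_of_nonneg_left b1 (sq_nonneg (u 1))
  have U2 := mul_le_mul_of_nonneg_left b2 (sq_nonneg (u 2))
  have U3 := mul_le_mul_of_nonneg_left hl₃.1 (mul_nonneg hK (sq_nonneg (u 3)))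
  have V0 := mul_le_mul_of_nonneg_left a0 (mul_nonneg hK (sq_nonneg (v 0)))
  have V1 := mul_le_mul_of_nonneg_left a1 (mul_nonneg hK (sq_nonneg (v 1)))
  have V2 := mul_le_mul_of_nonneg_left a2 (mul_nonneg hK (sq_nonneg (v 2)))
  have V3 := mul_le_mul_of_nonneg_left hl₃.2 (sq_nonneg (v 3))
  have W0 := mul_le_mul_of_nonneg_left u0 hΛ
  have W1 := mul_le_mul_of_nonneg_left u1 hΛ
  have W2 := mul_le_mul_of_nonneg_left u2 hΛ
  have W3 := mul_le_mul_of_nonneg_left hv hΛ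
  have K3 := mul_le_mul_of_nonneg_left hKC (sq_nonneg (u 3))
  have K0 := mul_le_mul_of_nonneg_left hKC (sq_nonneg (v 0))
  have K1 := mul_le_mul_of_nonneg_left hKC (sq_nonneg (v 1))
  have K2 := mul_le_mul_of_nonneg_left hKC (sq_nonneg (v 2))
  have hΛC := mul_nonneg hΛ hC
  have Z0 := mul_nonneg hΛC (sq_nonneg (v 0))
  have Z1 := mul_nonneg hΛC (sq_nonneg (v 1))
  have Z2 := mul_nonneg hΛC (sq_nonneg (v 2))
  have Z3 := mul_nonneg hΛC (sq_nonneg (v 3))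
  have Z4 := mul_nonneg hΛC (sq_nonneg (u 3))
  linarith

end Diagonal

section Weighted

/-- The logarithms of the weights. -/
noncomputable def logWeight (θ L x : ℝ) : Fin 4 → ℝ :=
  ![θ / 2 * x, θ / 2 * x, θ / 2 * x, θ / 2 * (L - x)]

/-- The weights of the norm in which a diagonalizable system is dissipative. -/
noncomputable def weight (θ L x : ℝ) (k : Fin 4) : ℝ := Real.exp (logWeight θ L x k)

theorem weight_pos (θ L x : ℝ) (k : Fin 4) : 0 < weight θ L x k := Real.exp_pos _

theorem continuous_weight (θ L : ℝ) : Continuous (weight θ L) := by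
  refine continuous_pi fun k => ?_
  refine Real.continuous_exp.comp ?_
  fin_cases k <;> simp only [logWeight] <;> fun_prop

theorem hasDerivAt_weight_sq (θ L : ℝ) (k : Fin 4) (x : ℝ) :
    HasDerivAt (fun x => weight θ L x k ^ 2)
      ((if k = 3 then -θ else θ) * weight θ L x k ^ 2) x := by
  have h : HasDerivAt (fun x => logWeight θ L x k) (if k = 3 then -(θ / 2) else θ / 2) x := by
    fin_cases k
    · simpa [logWeight] using (hasDerivAt_id x).const_mul (θ / 2)
    · simpa [logWeight] using (hasDerivAt_id x).const_mul (θ / 2)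
    · simpa [logWeight] using (hasDerivAt_id x).const_mul (θ / 2)
    · simpa [logWeight] using ((hasDerivAt_id x).const_sub L).const_mul (θ / 2)
  refine (h.exp.fun_pow 2).congr_deriv ?_
  simp only [weight]
  split_ifs <;> push_cast <;> ring

variable {z w w' : ℝ → EuclideanSpace ℝ (Fin 4)} {l : Fin 4 → ℝ} {θ L : ℝ}

/-- The weighted energy identity for the transport part. -/
theorem integral_transport_eq (hL : 0 ≤ L) (hw' : Continuous w')
    (hw : ∀ x, HasDerivAt w (w' x) x) :
    ∫ x in Ioo 0 L, ∑ k, weight θ L x k ^ 2 * l k * (w x k * w' x k)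
      = (∑ k, weight θ L L k ^ 2 * l k * w L k ^ 2
          - ∑ k, weight θ L 0 k ^ 2 * l k * w 0 k ^ 2) / 2
        - ∫ x in Ioo 0 L, ∑ k, (if k = 3 then -θ else θ) * l k / 2 * (weight θ L x k * w x k) ^ 2 := by
  have hwc : Continuous w := continuous_iff_continuousAt.mpr fun x => (hw x).continuousAt
  have hwt := fun k => (continuous_apply k).comp (continuous_weight θ L)
  have hwk : ∀ k, Continuous fun x => w x k := fun k => by fun_prop
  have hwk' : ∀ k, Continuous fun x => w' x k := fun k => by fun_prop
  have hd : ∀ x, HasDerivAt (fun x => ∑ k, weight θ L x k ^ 2 * l k * w x k ^ 2)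
      (2 * (∑ k, weight θ L x k ^ 2 * l k * (w x k * w' x k))
        + 2 * ∑ k, (if k = 3 then -θ else θ) * l k / 2 * (weight θ L x k * w x k) ^ 2) x := by
    intro x
    have hk : ∀ k, HasDerivAt (fun x => w x k) (w' x k) x := fun k =>
      (EuclideanSpace.proj (𝕜 := ℝ) k).hasFDerivAt.comp_hasDerivAt x (hw x)
    have := HasDerivAt.fun_sum fun k (_ : k ∈ Finset.univ) =>
      (((hasDerivAt_weight_sq θ L k x).mul_const (l k)).fun_mul ((hk k).fun_pow 2))
    refine this.congr_deriv ?_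
    rw [Finset.mul_sum, Finset.mul_sum, ← Finset.sum_add_distrib]
    refine Finset.sum_congr rfl fun k _ => ?_
    push_cast
    ring
  have hwt' : ∀ k, Continuous fun x => weight θ L x k := hwt
  have hc1 : Continuous fun x => ∑ k, weight θ L x k ^ 2 * l k * (w x k * w' x k) := by fun_prop
  have hc2 : Continuous fun x => ∑ k, (if k = 3 then -θ else θ) * l k / 2
      * (weight θ L x k * w x k) ^ 2 := by fun_prop
  have hI := intervalIntegral.integral_eq_sub_of_hasDerivAt (a := 0) (b := L) (fun x _ => hd x)
    (Continuous.intervalIntegrable (by fun_prop) _ _)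
  rw [intervalIntegral.integral_add (Continuous.intervalIntegrable (by fun_prop) _ _)
    (Continuous.intervalIntegrable (by fun_prop) _ _), intervalIntegral.integral_const_mul,
    intervalIntegral.integral_const_mul, intervalIntegral.integral_of_le hL,
    intervalIntegral.integral_of_le hL, integral_Ioc_eq_integral_Ioo,
    integral_Ioc_eq_integral_Ioo] at hI
  linarith

end Weighted

/-- A diagonalizable system with three right-going and one left-going component is a hyperbolic
boundary value problem if its boundary conditions control the incoming components. -/
theorem exists_diagonal_bvp {F : Type*} [NormedAddCommGroup F] [NormedSpace ℝ F]
    [FiniteDimensional ℝ F] (hF : Module.finrank ℝ F = 3) {L : ℝ} (hL : 0 < L) {l : Fin 4 → ℝ}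
    (hl : ∀ k : Fin 3, 0 < l k.castSucc) (hl₃ : l 3 < 0)
    (J S : EuclideanSpace ℝ (Fin 4) →L[ℝ] EuclideanSpace ℝ (Fin 4))
    (R : EuclideanSpace ℝ (Fin 4) ≃L[ℝ] EuclideanSpace ℝ (Fin 4))
    (hR : ∀ v k, R (J v) k = l k * R v k)
    (bc₀ : EuclideanSpace ℝ (Fin 4) →L[ℝ] F) (bcL : EuclideanSpace ℝ (Fin 4) →L[ℝ] ℝ)
    (κ : L2 (EuclideanSpace ℝ (Fin 4)) L →L[ℝ] ℝ)
    (h₀ : ∃ C, ∀ v, bc₀ v = 0 → ∀ k : Fin 3, (R v k.castSucc) ^ 2 ≤ C * (R v 3) ^ 2)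
    (h_L : ∃ C, ∀ v, (R v 3) ^ 2 ≤ C * ((∑ k : Fin 3, (R v k.castSucc) ^ 2) + (bcL v) ^ 2)) :
    ∃ M : HyperbolicBVP (EuclideanSpace ℝ (Fin 4)) F L,
      M.J = J ∧ M.S = S ∧ M.bc₀ = bc₀ ∧ M.bcL = bcL ∧ M.κ = κ := by
  have hl0 : ∀ k, l k ≠ 0 := Fin.lastCases hl₃.ne fun k => (hl k).ne'
  obtain ⟨C₀, hC₀⟩ := h₀
  obtain ⟨C₁, hC₁⟩ := h_L
  set C := |C₀| + |C₁| with hCdef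
  have hC : 0 ≤ C := by positivity
  have hC₀' : ∀ v, bc₀ v = 0 → ∀ k : Fin 3, (R v k.castSucc) ^ 2 ≤ C * (R v 3) ^ 2 :=
    fun v hv k => (hC₀ v hv k).trans (mul_le_mul_of_nonneg_right
      (by linarith [le_abs_self C₀, abs_nonneg C₁]) (sq_nonneg _))
  have hC₁' : ∀ v, (R v 3) ^ 2 ≤ C * ((∑ k : Fin 3, (R v k.castSucc) ^ 2) + (bcL v) ^ 2) :=
    fun v => (hC₁ v).trans (mul_le_mul_of_nonneg_right
      (by linarith [le_abs_self C₁, abs_nonneg C₀]) (by positivity))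
  obtain ⟨m, hm0, hm⟩ : ∃ m > 0, ∀ k, m ≤ |l k| := by
    obtain ⟨k, -, hk⟩ := Finset.exists_min_image Finset.univ (fun k => |l k|) ⟨0, Finset.mem_univ 0⟩
    exact ⟨|l k|, abs_pos.mpr (hl0 k), fun j => hk j (Finset.mem_univ j)⟩
  obtain ⟨Λ, hΛ0, hΛ⟩ : ∃ Λ > 0, ∀ k, |l k| ≤ Λ := by
    obtain ⟨k, -, hk⟩ := Finset.exists_max_image Finset.univ (fun k => |l k|) ⟨0, Finset.mem_univ 0⟩
    exact ⟨|l k|, abs_pos.mpr (hl0 k), fun j => hk j (Finset.mem_univ j)⟩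
  -- With `θ L = Q`, the inequality `exp Q ≥ Q` gives the ratio of weights that `boundary_form_le`
  -- requires.
  set Q := Λ * (6 * C + 1) / m with hQ
  set θ := Q / L with hθ
  have hQ0 : 0 ≤ Q := by positivity
  have hθ0 : 0 ≤ θ := by positivity
  have hθL : θ * L = Q := div_mul_cancel₀ _ hL.ne'
  have hKm : Λ * (6 * C + 1) ≤ Real.exp (θ * L) * m := by
    rw [hθL, ← div_le_iff₀ hm0, ← hQ]
    linarith [Real.add_one_le_exp Q]
  let G : ℝ → EuclideanSpace ℝ (Fin 4) →L[ℝ] EuclideanSpace ℝ (Fin 4) :=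
    fun x => diagOp (weight θ L x) ∘L (R : EuclideanSpace ℝ (Fin 4) →L[ℝ] EuclideanSpace ℝ (Fin 4))
  let G' : ℝ → EuclideanSpace ℝ (Fin 4) →L[ℝ] EuclideanSpace ℝ (Fin 4) :=
    fun x => (R.symm : EuclideanSpace ℝ (Fin 4) →L[ℝ] EuclideanSpace ℝ (Fin 4)) ∘L
      diagOp (fun k => (weight θ L x k)⁻¹)
  have hwc := continuous_weight θ L
  have hG : Continuous G := (continuous_diagOp hwc).clm_comp continuous_const
  have hG' : Continuous G' := continuous_const.clm_comp (continuous_diagOp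
    (continuous_pi fun k => ((continuous_apply k).comp hwc).inv₀ fun x => (weight_pos θ L x k).ne'))
  obtain ⟨Φ, hΦ⟩ := exists_mulEquiv L hG hG' (fun x v => by
    have h : diagOp (fun k => (weight θ L x k)⁻¹) (diagOp (weight θ L x) (R v)) = R v := by
      ext k
      simp [(weight_pos θ L x k).ne']
    simp [G, G', h]) (fun x v => by
    ext k
    simp [G, G', (weight_pos θ L x k).ne'])
  obtain ⟨N, hN⟩ := exists_mulOperator L (continuous_const (y := S) (X := ℝ))
  have hJinj : Function.Injective J.toLinearMap := by
    refine LinearMap.ker_eq_bot.mp (LinearMap.ker_eq_bot'.mpr fun v hv => R.injective ?_)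
    ext k
    have h := hR v k
    have hv' : J v = 0 := hv
    rw [hv', map_zero] at h
    simpa [hl0 k] using h.symm
  let Je := (LinearEquiv.ofInjectiveEndo J.toLinearMap hJinj).toContinuousLinearEquiv
  have hJe : ∀ v, Je v = J v := fun _ => rfl
  set ω₁ := ‖(Φ : L2 (EuclideanSpace ℝ (Fin 4)) L →L[ℝ] L2 (EuclideanSpace ℝ (Fin 4)) L)‖ * ‖N‖
    * ‖(Φ.symm : L2 (EuclideanSpace ℝ (Fin 4)) L →L[ℝ] L2 (EuclideanSpace ℝ (Fin 4)) L)‖ with hω₁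
  set ω₂ := (‖κ‖
    * ‖(Φ.symm : L2 (EuclideanSpace ℝ (Fin 4)) L →L[ℝ] L2 (EuclideanSpace ℝ (Fin 4)) L)‖) ^ 2 with hω₂
  set ν := ‖(R.symm : EuclideanSpace ℝ (Fin 4) →L[ℝ] EuclideanSpace ℝ (Fin 4))‖ ^ 2 + 1 with hν
  have hν0 : 0 < ν := by positivity
  have hnorm : ∀ v, ‖v‖ ^ 2 ≤ ν * ∑ k, R v k ^ 2 := by
    intro v
    rw [← EuclideanSpace.real_norm_sq_eq]
    have h := (R.symm : EuclideanSpace ℝ (Fin 4) →L[ℝ] EuclideanSpace ℝ (Fin 4)).le_opNorm (R v)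
    simp only [ContinuousLinearEquiv.coe_coe, ContinuousLinearEquiv.symm_apply_apply] at h
    have h2 := pow_le_pow_left₀ (norm_nonneg _) h 2
    rw [mul_pow] at h2
    nlinarith [sq_nonneg ‖R v‖]
  -- The rate `ω` adds the contributions of the source, of the feedback functional in the boundary
  -- term, and of the slope of the weights. In `c`, half of the boundary dissipation `Λ` is
  -- converted by `ν` from Riemann coordinates to the norm of the traces.
  refine ⟨{ J := J, Jinv := Je.symm, S := S, bc₀ := bc₀, bcL := bcL, κ := κ, Φ := Φ
            ω := ω₁ + Λ * C * ω₂ + θ * Λ / 2, c := Λ / 2 / ν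
            L_nonneg := hL.le
            J_Jinv := fun v => Je.apply_symm_apply v
            Jinv_J := fun v => Je.symm_apply_apply v
            finrank_eq := by rw [hF, finrank_euclideanSpace_fin]
            ω_nonneg := by positivity
            c_pos := by positivity
            energy := fun z z' hz' hz h0 hz_L => ?_ }, rfl, rfl, rfl, rfl, rfl⟩
  have hzc : Continuous z := continuous_iff_continuousAt.mpr fun x => (hz x).continuousAt
  have hSz : Continuous fun x => S (z x) := S.continuous.comp hzc
  have hJz : Continuous fun x => J (z' x) := J.continuous.comp hz'
  set y := cls L z with hy
  have hΦy : y = Φ.symm (Φ y) := (Φ.symm_apply_apply y).symm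
  have hynorm : ‖y‖ ≤ ‖(Φ.symm : L2 (EuclideanSpace ℝ (Fin 4)) L →L[ℝ]
      L2 (EuclideanSpace ℝ (Fin 4)) L)‖ * ‖Φ y‖ := by
    conv_lhs => rw [hΦy]
    exact (Φ.symm : L2 (EuclideanSpace ℝ (Fin 4)) L →L[ℝ]
      L2 (EuclideanSpace ℝ (Fin 4)) L).le_opNorm _
  have hsource : ⟪Φ y, Φ (N y)⟫ ≤ ω₁ * ‖Φ y‖ ^ 2 := by
    refine (real_inner_le_norm _ _).trans ?_
    have h1 : ‖Φ (N y)‖ ≤ ‖(Φ : L2 (EuclideanSpace ℝ (Fin 4)) L →L[ℝ]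
        L2 (EuclideanSpace ℝ (Fin 4)) L)‖ * (‖N‖ * ‖y‖) :=
      ((Φ : L2 (EuclideanSpace ℝ (Fin 4)) L →L[ℝ]
        L2 (EuclideanSpace ℝ (Fin 4)) L).le_opNorm _).trans (by gcongr; exact N.le_opNorm y)
    calc ‖Φ y‖ * ‖Φ (N y)‖ ≤ ‖Φ y‖ * (‖(Φ : L2 (EuclideanSpace ℝ (Fin 4)) L →L[ℝ]
        L2 (EuclideanSpace ℝ (Fin 4)) L)‖ * (‖N‖ * (‖(Φ.symm : L2 (EuclideanSpace ℝ (Fin 4)) L →L[ℝ]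
        L2 (EuclideanSpace ℝ (Fin 4)) L)‖ * ‖Φ y‖))) := by
          gcongr
          exact h1.trans (by gcongr)
      _ = ω₁ * ‖Φ y‖ ^ 2 := by rw [hω₁]; ring
  have hκ : κ y ^ 2 ≤ ω₂ * ‖Φ y‖ ^ 2 := by
    rw [hω₂, ← mul_pow, ← sq_abs, ← Real.norm_eq_abs]
    refine pow_le_pow_left₀ (norm_nonneg _) ((κ.le_opNorm y).trans ?_) 2
    rw [mul_assoc]
    gcongr
  have hRz : ∀ x, HasDerivAt (fun x => R (z x)) (R (z' x)) x := fun x =>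
    (R : EuclideanSpace ℝ (Fin 4) →L[ℝ] EuclideanSpace ℝ (Fin 4)).hasFDerivAt.comp_hasDerivAt x (hz x)
  have hRz' : Continuous fun x => R (z' x) := R.continuous.comp hz'
  have hRzc : Continuous fun x => R (z x) := R.continuous.comp hzc
  have htr : ⟪Φ y, Φ (cls L fun x => J (z' x))⟫
      = ∫ x in Ioo 0 L, ∑ k, weight θ L x k ^ 2 * l k * (R (z x) k * R (z' x) k) := by
    rw [hy, hΦ _ hzc, hΦ _ hJz, inner_cls_cls (hG.clm_apply hzc) (hG.clm_apply hJz)]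
    refine integral_congr_ae (.of_forall fun x => ?_)
    simp only [PiLp.inner_apply, G, ContinuousLinearMap.comp_apply, diagOp_apply,
      ContinuousLinearEquiv.coe_coe, hR, RCLike.inner_apply, conj_trivial]
    exact Finset.sum_congr rfl fun k _ => by ring
  have hsq : ‖Φ y‖ ^ 2 = ∫ x in Ioo 0 L, ∑ k, (weight θ L x k * R (z x) k) ^ 2 := by
    rw [← real_inner_self_eq_norm_sq, hy, hΦ _ hzc,
      inner_cls_cls (hG.clm_apply hzc) (hG.clm_apply hzc)]
    refine integral_congr_ae (.of_forall fun x => ?_)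
    simp only [PiLp.inner_apply, G, ContinuousLinearMap.comp_apply, diagOp_apply,
      ContinuousLinearEquiv.coe_coe, RCLike.inner_apply, conj_trivial]
    exact Finset.sum_congr rfl fun k _ => by ring
  have hgrow : ∫ x in Ioo 0 L, ∑ k, (if k = 3 then -θ else θ) * l k / 2
      * (weight θ L x k * R (z x) k) ^ 2 ≤ θ * Λ / 2 * ‖Φ y‖ ^ 2 := by
    rw [hsq, ← integral_const_mul]
    have hwk : ∀ k, Continuous fun x => weight θ L x k := fun k => (continuous_apply k).comp hwc
    have hint : ∀ f : ℝ → ℝ, Continuous f → Integrable f (volume.restrict (Ioo 0 L)) := fun f hf =>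
      (hf.integrableOn_Icc (a := 0) (b := L)).mono_set Ioo_subset_Icc_self
    refine integral_mono (hint _ (by fun_prop)) (hint _ (by fun_prop)) fun x => ?_
    simp only
    rw [Finset.mul_sum]
    refine Finset.sum_le_sum fun k _ => mul_le_mul_of_nonneg_right ?_ (sq_nonneg _)
    have h1 := abs_le.mp (hΛ k)
    split_ifs
    · nlinarith
    · nlinarith
  -- The nonlocal condition enters through `a = κ y`, a bounded functional of the state, so it
  -- affects the growth rate and not the dissipation.
  have hbd := boundary_form_le (K := Real.exp (θ * L)) (l := l) (u := R (z 0)) (v := R (z L))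
    (a := κ y) (m := m) (Λ := Λ) (C := C) (Real.exp_pos _).le hΛ0.le
    (fun k => by rw [← abs_of_pos (hl k)]; exact ⟨hm _, hΛ _⟩)
    (by rw [← abs_of_neg hl₃]; exact ⟨hm _, hΛ _⟩) hKm (hC₀' _ h0)
    (by rw [← hz_L]; exact hC₁' _) hC
  have hid := integral_transport_eq (l := l) (θ := θ) hL.le hRz' hRz
  have hexp : Real.exp (θ / 2 * L) ^ 2 = Real.exp (θ * L) := by
    rw [← Real.exp_nat_mul]; congr 1; push_cast; ring
  have hW : (∑ k, weight θ L L k ^ 2 * l k * R (z L) k ^ 2)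
        - ∑ k, weight θ L 0 k ^ 2 * l k * R (z 0) k ^ 2
      = (Real.exp (θ * L) * R (z L) 0 ^ 2 * l 0 + Real.exp (θ * L) * R (z L) 1 ^ 2 * l 1
          + Real.exp (θ * L) * R (z L) 2 ^ 2 * l 2 + R (z L) 3 ^ 2 * l 3)
        - (R (z 0) 0 ^ 2 * l 0 + R (z 0) 1 ^ 2 * l 1 + R (z 0) 2 ^ 2 * l 2
          + Real.exp (θ * L) * R (z 0) 3 ^ 2 * l 3) := by
    rw [Fin.sum_univ_four, Fin.sum_univ_four]
    simp only [weight, logWeight, Matrix.cons_val, sub_zero, sub_self, mul_zero, Real.exp_zero, hexp]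
    ring
  rw [hW] at hid
  have hn0 := hnorm (z 0)
  have hn1 := hnorm (z L)
  have hc : Λ / 2 / ν * (‖z 0‖ ^ 2 + ‖z L‖ ^ 2)
      ≤ Λ / 2 * ((∑ k, R (z 0) k ^ 2) + ∑ k, R (z L) k ^ 2) := by
    rw [div_mul_eq_mul_div, div_le_iff₀ hν0, mul_assoc]
    refine mul_le_mul_of_nonneg_left ?_ (by positivity)
    linarith
  have hNy : cls L (fun x => S (z x)) = N y := (mulOperator_cls continuous_const hN hzc).symm
  rw [cls_sub hSz hJz, map_sub, inner_sub_right, hNy, htr, hid]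
  have hκ' := mul_le_mul_of_nonneg_left hκ (mul_nonneg hΛ0.le hC)
  linarith

/-! ### The traffic model as a boundary value problem. -/

/-- One-sided limits bound `f` near each point, and compactness concludes. The values at the point
and at both ends are added separately, because the limits are taken within open intervals. -/
theorem PiecewiseContinuousOn.exists_bound {E : Type*} [NormedAddCommGroup E] {f : ℝ → E} {a b : ℝ}
    (hf : PiecewiseContinuousOn f a b) : ∃ C, ∀ x ∈ Icc a b, ‖f x‖ ≤ C := by
  refine isCompact_Icc.induction_on (p := fun s => ∃ C, ∀ x ∈ s, ‖f x‖ ≤ C) ⟨0, by simp⟩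
    (fun s t hst ⟨C, hC⟩ => ⟨C, fun x hx => hC x (hst hx)⟩)
    (fun s t ⟨C, hC⟩ ⟨C', hC'⟩ => ⟨max C C', fun x hx => hx.elim
      (fun h => (hC x h).trans (le_max_left _ _)) fun h => (hC' x h).trans (le_max_right _ _)⟩)
    fun x hx => ?_
  obtain ⟨⟨y, hy⟩, ⟨y', hy'⟩⟩ := hf.2 x hx
  have h1 := eventually_nhdsWithin_iff.mp (hy.norm.eventually_le_const (lt_add_one ‖y‖))
  have h2 := eventually_nhdsWithin_iff.mp (hy'.norm.eventually_le_const (lt_add_one ‖y'‖))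
  refine ⟨_, inter_mem_nhdsWithin _ (h1.and h2),
    (‖y‖ + 1) + (‖y'‖ + 1) + ‖f a‖ + ‖f b‖ + ‖f x‖, fun u hu => ?_⟩
  obtain ⟨⟨hau, hub⟩, hu1, hu2⟩ := hu
  have n1 := norm_nonneg y
  have n2 := norm_nonneg y'
  have n3 := norm_nonneg (f a)
  have n4 := norm_nonneg (f b)
  have n5 := norm_nonneg (f x)
  rcases hau.eq_or_lt with rfl | hau
  · linarith
  rcases hub.eq_or_lt with rfl | hub
  · linarith
  rcases lt_trichotomy u x with h | rfl | h
  · linarith [hu1 ⟨hau, h⟩]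
  · linarith
  · linarith [hu2 ⟨h, hub⟩]

theorem PiecewiseContinuousOn.aestronglyMeasurable {E : Type*} [NormedAddCommGroup E] {f : ℝ → E}
    {a b : ℝ} (hf : PiecewiseContinuousOn f a b) :
    AEStronglyMeasurable f (volume.restrict (Ioo a b)) := by
  obtain ⟨D, hD⟩ := hf.1
  have h1 : ContinuousOn f (Ioo a b \ D) := fun x hx =>
    (hD x (Ioo_subset_Icc_self hx.1) hx.2).mono (sdiff_subset.trans Ioo_subset_Icc_self)
  have h2 : AEStronglyMeasurable f (volume.restrict (Ioo a b \ D)) :=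
    h1.aestronglyMeasurable (measurableSet_Ioo.diff D.measurableSet)
  rwa [Measure.restrict_congr_set (sdiff_null_ae_eq_self (D.finite_toSet.measure_zero _))] at h2

theorem real_inner_eq_dotProduct (u v : EuclideanSpace ℝ (Fin 4)) :
    ⟪u, v⟫ = u.ofLp ⬝ᵥ v.ofLp := by
  simp [PiLp.inner_apply, dotProduct, mul_comm]

/-- Solve `g ⬝ᵥ w` for the last component of `w` and apply the Cauchy–Schwarz inequality; this
bounds the incoming component at the outlet. -/
theorem sq_le_of_dotProduct (g w : Fin 4 → ℝ) (hg : g 3 ≠ 0) :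
    w 3 ^ 2 ≤ (1 + ∑ k : Fin 3, g k.castSucc ^ 2) / g 3 ^ 2
      * ((∑ k : Fin 3, w k.castSucc ^ 2) + (g ⬝ᵥ w) ^ 2) := by
  have h := Finset.sum_mul_sq_le_sq_mul_sq Finset.univ
    ![-g 0, -g 1, -g 2, 1] ![w 0, w 1, w 2, g ⬝ᵥ w]
  rw [div_mul_eq_mul_div, le_div_iff₀ (by positivity), ← mul_pow]
  have hd : g ⬝ᵥ w = g 0 * w 0 + g 1 * w 1 + g 2 * w 2 + g 3 * w 3 := by
    rw [dotProduct, Fin.sum_univ_four]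
  rw [Fin.sum_univ_four, Fin.sum_univ_four, Fin.sum_univ_four] at h
  simp only [Matrix.cons_val, neg_sq] at h
  rw [Fin.sum_univ_three, Fin.sum_univ_three]
  have h1 : w 3 * g 3 = -g 0 * w 0 + -g 1 * w 1 + -g 2 * w 2 + 1 * (g ⬝ᵥ w) := by rw [hd]; ring
  rw [h1]
  refine h.trans_eq ?_
  simp only [Fin.castSucc_zero, Fin.castSucc_one]
  change _ = (1 + (g 0 ^ 2 + g 1 ^ 2 + g 2 ^ 2)) * (w 0 ^ 2 + w 1 ^ 2 + w 2 ^ 2 + _)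
  ring

/-- The first three components of a kernel vector are the last one times a fixed vector, so at the
inlet the outgoing component controls the incoming ones. -/
theorem exists_sq_le_of_mulVec_eq_zero (A : Matrix (Fin 3) (Fin 4) ℝ)
    (hA : IsUnit (A.submatrix id (Fin.castSucc : Fin 3 → Fin 4)).det) :
    ∃ C, ∀ w : Fin 4 → ℝ, A *ᵥ w = 0 → ∀ k : Fin 3, w k.castSucc ^ 2 ≤ C * w 3 ^ 2 := by
  set N := A.submatrix id (Fin.castSucc : Fin 3 → Fin 4)
  set a := N⁻¹ *ᵥ A.col 3
  refine ⟨∑ j, a j ^ 2, fun w hw k => ?_⟩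
  have h1 : N *ᵥ (fun k => w k.castSucc) + w 3 • A.col 3 = 0 := by
    rw [← hw]
    ext i
    simp only [mulVec, dotProduct, Pi.add_apply, Pi.smul_apply, smul_eq_mul, Fin.sum_univ_castSucc
      (n := 3), N, submatrix_apply, id, col_apply]
    change _ = _ + A i 3 * w 3
    rw [mul_comm (w 3)]
  have h2 : (fun k : Fin 3 => w k.castSucc) + w 3 • a = 0 := by
    have := congrArg (fun v => N⁻¹ *ᵥ v) h1
    simpa [mulVec_add, mulVec_smul, mulVec_mulVec, nonsing_inv_mul N hA, a] using this
  have h3 : w k.castSucc = -(w 3 * a k) := by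
    have := congrFun h2 k
    simp only [Pi.add_apply, Pi.smul_apply, smul_eq_mul, Pi.zero_apply] at this
    linarith
  rw [h3, neg_sq, mul_pow, mul_comm]
  gcongr
  exact Finset.single_le_sum (f := fun j => a j ^ 2) (fun j _ => sq_nonneg _) (Finset.mem_univ k)

namespace Params

variable (p : Params)

theorem continuous_T (s : ℝ) (B : Matrix (Fin 4) (Fin 4) ℝ) : Continuous (p.T s B) := by
  refine Continuous.matrix_mul (continuous_matrix fun i j => ?_) continuous_const
  fin_cases i <;> fin_cases j <;> simp <;> fun_prop

/-- The nonlocal term of the feedback law is a bounded functional of the state. -/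
theorem exists_kernelFunctional (c : Feedback) (hK : PiecewiseContinuousOn c.K 0 p.L) :
    ∃ κ : p.State →L[ℝ] ℝ, ∀ z,
      κ z = ∫ ξ in Ioo 0 p.L, c.K ξ ⬝ᵥ (p.T c.s₀ c.B₀ ξ *ᵥ p.val z ξ) := by
  obtain ⟨C, hC⟩ := hK.exists_bound
  have hT := p.continuous_T c.s₀ c.B₀
  -- The functional is the inner product with this square-integrable kernel.
  let k : ℝ → EuclideanSpace ℝ (Fin 4) := fun ξ => WithLp.toLp 2 (c.K ξ ᵥ* p.T c.s₀ c.B₀ ξ)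
  have hvm : Continuous fun q : (Fin 4 → ℝ) × ℝ =>
      (WithLp.toLp 2 (q.1 ᵥ* p.T c.s₀ c.B₀ q.2) : EuclideanSpace ℝ (Fin 4)) :=
    (PiLp.continuous_toLp 2 _).comp
      (continuous_fst.matrix_vecMul (hT.comp continuous_snd))
  have hk : MemLp k 2 (volume.restrict (Ioo 0 p.L)) := by
    obtain ⟨D, hD⟩ := ((isCompact_closedBall (0 : Fin 4 → ℝ) C).prod
      (isCompact_Icc (a := 0) (b := p.L))).exists_bound_of_continuousOn hvm.continuousOn
    refine MemLp.of_bound (hvm.comp_aestronglyMeasurable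
      (hK.aestronglyMeasurable.prodMk aestronglyMeasurable_id)) D ?_
    filter_upwards [ae_restrict_mem measurableSet_Ioo] with x hx
    have hx' := Ioo_subset_Icc_self hx
    exact hD (c.K x, x) ⟨by simpa using hC x hx', hx'⟩
  refine ⟨innerSL ℝ (hk.toLp k), fun z => ?_⟩
  rw [innerSL_apply_apply, L2.inner_def]
  refine integral_congr_ae ?_
  filter_upwards [hk.coeFn_toLp] with x hx
  rw [hx, real_inner_eq_dotProduct, dotProduct_mulVec]
  rfl

/-- In the congested regime the closed loop is a hyperbolic boundary value problem. -/
theorem exists_bvp {s : ℝ} {B : Matrix (Fin 4) (Fin 4) ℝ} {c : Feedback} (hs : p.Congested s)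
    (hB : p.Diagonalizes s B) (hK : PiecewiseContinuousOn c.K 0 p.L)
    (hbdry : p.BoundarySolvable c s B) :
    ∃ M : HyperbolicBVP (EuclideanSpace ℝ (Fin 4)) (Fin 3 → ℝ) p.L,
      M.J = Matrix.toEuclideanCLM (𝕜 := ℝ) (p.Jlam s) ∧
      M.S = Matrix.toEuclideanCLM (𝕜 := ℝ) (p.Jsrc s) ∧
      (∀ v, M.bc₀ v = p.inlet s *ᵥ v.ofLp) ∧
      (∀ v, M.bcL v = p.outlet s ⬝ᵥ v.ofLp + c.F ⬝ᵥ (p.Tplus c.s₀ c.B₀ p.L *ᵥ v.ofLp)) ∧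
      ∀ z, M.κ z = ∫ ξ in Ioo 0 p.L, c.K ξ ⬝ᵥ (p.T c.s₀ c.B₀ ξ *ᵥ p.val z ξ) := by
  obtain ⟨κ, hκ⟩ := p.exists_kernelFunctional c hK
  obtain ⟨hBu, hBd⟩ := hB
  have hBB : B * B⁻¹ = 1 := Matrix.mul_nonsing_inv B hBu
  have hBB' : B⁻¹ * B = 1 := Matrix.nonsing_inv_mul B hBu
  let R : EuclideanSpace ℝ (Fin 4) ≃L[ℝ] EuclideanSpace ℝ (Fin 4) :=
    ContinuousLinearEquiv.equivOfInverse (Matrix.toEuclideanCLM (𝕜 := ℝ) B⁻¹)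
      (Matrix.toEuclideanCLM (𝕜 := ℝ) B)
      (fun v => by rw [← mul_apply_eq_comp, ← map_mul, hBB, map_one]; rfl)
      (fun v => by rw [← mul_apply_eq_comp, ← map_mul, hBB', map_one]; rfl)
  have hR : ∀ v, (R v).ofLp = B⁻¹ *ᵥ v.ofLp := fun v => Matrix.ofLp_toEuclideanCLM _ _
  have hv : ∀ v : EuclideanSpace ℝ (Fin 4), v.ofLp = B *ᵥ (R v).ofLp := fun v => by
    rw [hR, mulVec_mulVec, hBB, one_mulVec]
  let bc₀ : EuclideanSpace ℝ (Fin 4) →L[ℝ] (Fin 3 → ℝ) :=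
    LinearMap.toContinuousLinearMap
      (Matrix.mulVecLin (p.inlet s) ∘ₗ (WithLp.linearEquiv 2 ℝ (Fin 4 → ℝ)).toLinearMap)
  have hbc₀ : ∀ v, bc₀ v = p.inlet s *ᵥ v.ofLp := fun v => rfl
  -- The local part of the control is moved to the left-hand side, so only the integral term remains
  -- as the feedback `κ`.
  let q : Fin 4 → ℝ := p.outlet s + c.F ᵥ* p.Tplus c.s₀ c.B₀ p.L
  let bcL : EuclideanSpace ℝ (Fin 4) →L[ℝ] ℝ := innerSL ℝ (WithLp.toLp 2 q)
  have hbcL : ∀ v, bcL v = q ⬝ᵥ v.ofLp := fun v => by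
    rw [innerSL_apply_apply, real_inner_eq_dotProduct]
  obtain ⟨C, hC⟩ := exists_sq_le_of_mulVec_eq_zero _ hbdry.1
  obtain ⟨h1, h2, h3, h4⟩ := hs
  obtain ⟨M, hJ, hS, hM₀, hML, hMκ⟩ := exists_diagonal_bvp (l := p.lam s)
    (Module.finrank_fin_fun ℝ) p.L_pos
    (by intro k; fin_cases k; exacts [h1, h2, h3]) h4
    (Matrix.toEuclideanCLM (𝕜 := ℝ) (p.Jlam s)) (Matrix.toEuclideanCLM (𝕜 := ℝ) (p.Jsrc s)) R
    (fun v k => by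
      rw [hR, hR, Matrix.ofLp_toEuclideanCLM, mulVec_mulVec,
        show B⁻¹ * p.Jlam s = Matrix.diagonal (p.lam s) * B⁻¹ by
          rw [← hBd, Matrix.mul_assoc, hBB, Matrix.mul_one], ← mulVec_mulVec, mulVec_diagonal])
    bc₀ bcL κ
    ⟨C, fun v hv0 => hC _ (by rw [← mulVec_mulVec, ← hv, ← hbc₀, hv0])⟩
    ⟨_, fun v => by
      rw [hbcL, hv v, dotProduct_mulVec]
      refine sq_le_of_dotProduct (q ᵥ* B) _ ?_
      have : (q ᵥ* B) 3 = q ⬝ᵥ B.col 3 := rfl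
      rw [this, add_dotProduct, ← dotProduct_mulVec]
      exact hbdry.2⟩
  refine ⟨M, hJ, hS, fun v => by rw [hM₀, hbc₀], fun v => ?_, fun z => by rw [hMκ, hκ]⟩
  rw [hML, hbcL, add_dotProduct, ← dotProduct_mulVec]

end Params

/-! ### Equivalence of the two weak formulations. -/

theorem memLp_toLp_iff {μ : Measure ℝ} {h : ℝ → Fin 4 → ℝ} :
    MemLp (fun t => (WithLp.toLp 2 (h t) : EuclideanSpace ℝ (Fin 4))) 2 μ ↔ MemLp h 2 μ :=
  ⟨fun H => (PiLp.continuousLinearEquiv 2 ℝ fun _ : Fin 4 => ℝ).toContinuousLinearMap.comp_memLp' H,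
    fun H => (PiLp.continuousLinearEquiv 2 ℝ
      fun _ : Fin 4 => ℝ).symm.toContinuousLinearMap.comp_memLp' H⟩

theorem ae_restrict_Ioi_iff {q : ℝ → Prop} :
    (∀ᵐ t ∂(volume.restrict (Ioi (0 : ℝ))), q t)
      ↔ ∀ b : ℝ, 0 ≤ b → ∀ᵐ t ∂(volume.restrict (Ioc 0 b)), q t := by
  refine ⟨fun h b _ => ae_restrict_of_ae_restrict_of_subset Ioc_subset_Ioi_self h, fun h => ?_⟩
  have hU : Ioi (0 : ℝ) = ⋃ n : ℕ, Ioc 0 (n : ℝ) := by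
    ext t
    simp only [mem_Ioi, mem_iUnion, mem_Ioc]
    exact ⟨fun ht => ⟨⌈t⌉₊, ht, Nat.le_ceil t⟩, fun ⟨n, ht, _⟩ => ht⟩
  rw [hU, ae_restrict_iUnion_iff]
  exact fun n => h n (Nat.cast_nonneg n)

theorem deriv_ofLp {f : ℝ → EuclideanSpace ℝ (Fin 4)} {f' : EuclideanSpace ℝ (Fin 4)} {t : ℝ}
    (hf : HasDerivAt f f' t) : deriv (fun t => (f t).ofLp) t = f'.ofLp :=
  ((PiLp.continuousLinearEquiv 2 ℝ
    fun _ : Fin 4 => ℝ).toContinuousLinearMap.hasFDerivAt.comp_hasDerivAt t hf).deriv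

/-- `M` is the closed loop with the feedback `c` in the mode with spacing `s`. -/
structure Params.IsClosedLoop (p : Params) (c : Feedback) (s : ℝ)
    (M : HyperbolicBVP (EuclideanSpace ℝ (Fin 4)) (Fin 3 → ℝ) p.L) : Prop where
  J_eq : M.J = Matrix.toEuclideanCLM (𝕜 := ℝ) (p.Jlam s)
  S_eq : M.S = Matrix.toEuclideanCLM (𝕜 := ℝ) (p.Jsrc s)
  bc₀_eq : ∀ v, M.bc₀ v = p.inlet s *ᵥ v.ofLp
  bcL_eq : ∀ v, M.bcL v
    = p.outlet s ⬝ᵥ v.ofLp + c.F ⬝ᵥ (p.Tplus c.s₀ c.B₀ p.L *ᵥ v.ofLp)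
  κ_eq : ∀ z, M.κ z = ∫ ξ in Ioo 0 p.L, c.K ξ ⬝ᵥ (p.T c.s₀ c.B₀ ξ *ᵥ p.val z ξ)

namespace Params.IsClosedLoop

variable {p : Params} {c : Feedback} {s : ℝ}
  {M : HyperbolicBVP (EuclideanSpace ℝ (Fin 4)) (Fin 3 → ℝ) p.L} (hM : p.IsClosedLoop c s M)

include hM

theorem inner_J (u v : EuclideanSpace ℝ (Fin 4)) :
    ⟪M.J.adjoint u, v⟫ = u.ofLp ⬝ᵥ (p.Jlam s *ᵥ v.ofLp) := by
  rw [ContinuousLinearMap.adjoint_inner_left, real_inner_eq_dotProduct, hM.J_eq,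
    Matrix.ofLp_toEuclideanCLM]

theorem inner_S (u v : EuclideanSpace ℝ (Fin 4)) :
    ⟪M.S.adjoint u, v⟫ = u.ofLp ⬝ᵥ (p.Jsrc s *ᵥ v.ofLp) := by
  rw [ContinuousLinearMap.adjoint_inner_left, real_inner_eq_dotProduct, hM.S_eq,
    Matrix.ofLp_toEuclideanCLM]

theorem bc_iff (z : p.State) (v : EuclideanSpace ℝ (Fin 4)) :
    M.bcL v = M.κ z ↔ p.outlet s ⬝ᵥ v.ofLp = p.control c z v.ofLp := by
  rw [hM.bcL_eq, hM.κ_eq, Params.control]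
  constructor <;> intro h <;> linarith

theorem greenRate_eq {φ : ℝ → ℝ → EuclideanSpace ℝ (Fin 4)}
    (hφ : ContDiff ℝ 1 (fun q : ℝ × ℝ => φ q.1 q.2)) (τ : ℝ) (z : p.State)
    (γ₀ γL : EuclideanSpace ℝ (Fin 4)) :
    M.greenRate φ τ z γ₀ γL = p.weakInterior s (fun t x => (φ t x).ofLp) τ z
      - ((φ τ p.L).ofLp ⬝ᵥ (p.Jlam s *ᵥ γL.ofLp) - (φ τ 0).ofLp ⬝ᵥ (p.Jlam s *ᵥ γ₀.ofLp)) := by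
  have hct : Continuous fun x => deriv (fun t => φ t x) τ :=
    (HyperbolicBVP.continuous_deriv_time hφ).comp (continuous_const.prodMk continuous_id)
  have hcx : Continuous fun x => deriv (φ τ) x :=
    (HyperbolicBVP.continuous_deriv_space hφ).comp (continuous_const.prodMk continuous_id)
  have hc : Continuous (φ τ) := hφ.continuous.comp (continuous_const.prodMk continuous_id)
  have hca : Continuous fun x => M.J.adjoint (deriv (φ τ) x) + M.S.adjoint (φ τ x) := by fun_prop
  rw [HyperbolicBVP.greenRate, hM.inner_J, hM.inner_J]
  congr 1
  have h1 : M.testInterior φ τ = cls p.L (fun x => deriv (fun s => φ s x) τ)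
      + cls p.L (fun x => M.J.adjoint (deriv (φ τ) x) + M.S.adjoint (φ τ x)) := rfl
  rw [h1, inner_add_left, inner_cls hct, inner_cls hca,
    ← integral_add (integrable_inner_of_continuous hct z) (integrable_inner_of_continuous hca z)]
  refine integral_congr_ae (.of_forall fun x => ?_)
  simp only [inner_add_left, hM.inner_J, hM.inner_S, real_inner_eq_dotProduct]
  rw [deriv_ofLp (HyperbolicBVP.hasDerivAt_time hφ τ x).differentiableAt.hasDerivAt,
    deriv_ofLp (HyperbolicBVP.hasDerivAt_space hφ τ x).differentiableAt.hasDerivAt, ← add_assoc]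
  rfl

end Params.IsClosedLoop

namespace Params

variable {p : Params} {c : Feedback} {r : ℕ} {s : Fin r → ℝ}
  {M : Fin r → HyperbolicBVP (EuclideanSpace ℝ (Fin 4)) (Fin 3 → ℝ) p.L}
  (hM : ∀ i, p.IsClosedLoop c (s i) (M i)) {x : ℝ → Fin r} (hx : IsRightCont x)

include hM hx

/-- Splitting one integral into an interior and a boundary part requires integrability of each. Zero
traces give it for the interior part, and the boundary part is a difference. -/
theorem integral_greenRate_eq {z : ℝ → p.State} (hz : ContinuousOn z (Ici 0)) {h₀ hL : ℝ → Fin 4 → ℝ}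
    {t : ℝ} (ht : 0 ≤ t) (hh₀ : MemLp h₀ 2 (volume.restrict (Ioc 0 t)))
    (hhL : MemLp hL 2 (volume.restrict (Ioc 0 t))) {φ : ℝ → ℝ → EuclideanSpace ℝ (Fin 4)}
    (hφ : ContDiff ℝ 1 (fun q : ℝ × ℝ => φ q.1 q.2)) :
    ∫ τ in (0 : ℝ)..t, (M (x τ)).greenRate φ τ (z τ) (WithLp.toLp 2 (h₀ τ)) (WithLp.toLp 2 (hL τ))
      = (∫ τ in Ioc 0 t, p.weakInterior (s (x τ)) (fun t x => (φ t x).ofLp) τ (z τ))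
        - ∫ τ in Ioc 0 t, ((φ τ p.L).ofLp ⬝ᵥ (p.Jlam (s (x τ)) *ᵥ hL τ)
            - (φ τ 0).ofLp ⬝ᵥ (p.Jlam (s (x τ)) *ᵥ h₀ τ)) := by
  have hc := hz.mono (Icc_subset_Ici_self : Icc 0 t ⊆ Ici 0)
  have h1 := HyperbolicBVP.integrableOn_greenRate_path (M := M) hx hφ hc
    (memLp_toLp_iff.mpr hh₀) (memLp_toLp_iff.mpr hhL)
  have h2 := HyperbolicBVP.integrableOn_greenRate_path (M := M) hx hφ hc
    (h₀ := fun _ => 0) (hL := fun _ => 0) (by simp) (by simp)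
  have e1 := fun τ => (hM (x τ)).greenRate_eq hφ τ (z τ) (WithLp.toLp 2 (h₀ τ)) (WithLp.toLp 2 (hL τ))
  have e2 : ∀ τ, (M (x τ)).greenRate φ τ (z τ) 0 0
      = p.weakInterior (s (x τ)) (fun t x => (φ t x).ofLp) τ (z τ) := fun τ => by
    rw [(hM (x τ)).greenRate_eq hφ]
    simp
  simp only [e2] at h2
  have h3 := h2.sub h1
  rw [intervalIntegral.integral_of_le ht]
  have e3 : ∀ τ, (φ τ p.L).ofLp ⬝ᵥ (p.Jlam (s (x τ)) *ᵥ hL τ)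
            - (φ τ 0).ofLp ⬝ᵥ (p.Jlam (s (x τ)) *ᵥ h₀ τ)
      = p.weakInterior (s (x τ)) (fun t x => (φ t x).ofLp) τ (z τ)
        - (M (x τ)).greenRate φ τ (z τ) (WithLp.toLp 2 (h₀ τ)) (WithLp.toLp 2 (hL τ)) := fun τ => by
    rw [e1, sub_sub_cancel]
  simp only [e3]
  rw [integral_sub h2 h1, sub_sub_cancel]

/-- The `L²` solutions are the weak solutions of the corresponding boundary value problems. -/
theorem isL2Solution_iff {z₀ : p.State} {z : ℝ → p.State} :
    p.IsL2Solution c (fun t => s (x t)) z₀ z ↔ ContinuousOn z (Ici 0) ∧ z 0 = z₀ ∧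
      ∃ h₀ hL, ∀ b, 0 ≤ b → HyperbolicBVP.IsWeakSolutionOn (fun t => M (x t)) 0 b z h₀ hL := by
  have hdot : ∀ (φ : ℝ → EuclideanSpace ℝ (Fin 4)), Continuous φ → ∀ u : p.State,
      ⟪cls p.L φ, u⟫ = ∫ ξ in Ioo 0 p.L, (φ ξ).ofLp ⬝ᵥ p.val u ξ := fun φ hφ u => by
    rw [inner_cls hφ]
    exact integral_congr_ae (.of_forall fun ξ => real_inner_eq_dotProduct _ _)
  have hsp : ∀ φ : ℝ → ℝ → EuclideanSpace ℝ (Fin 4), ContDiff ℝ 1 (fun q : ℝ × ℝ => φ q.1 q.2) →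
      ∀ t, Continuous (φ t) := fun φ hφ t =>
    hφ.continuous.comp (continuous_const.prodMk continuous_id)
  constructor
  · rintro ⟨hz, hz0, h₀, hL, hmem, hbc, hgreen⟩
    refine ⟨hz, hz0, fun t => WithLp.toLp 2 (h₀ t), fun t => WithLp.toLp 2 (hL t), fun b hb => ?_⟩
    refine ⟨memLp_toLp_iff.mpr (hmem b).1, memLp_toLp_iff.mpr (hmem b).2, ?_, fun φ hφ => ?_,
      fun φ hφ t ht => ?_⟩
    · filter_upwards [ae_restrict_Ioi_iff.mp hbc b hb] with t ht
      exact ⟨by rw [(hM _).bc₀_eq]; exact ht.1, ((hM _).bc_iff _ _).mpr ht.2⟩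
    -- `IsL2Solution` does not record integrability; it follows from continuity in time,
    -- square-integrable traces and the finiteness of the modes.
    · exact HyperbolicBVP.integrableOn_greenRate_path (M := M) hx hφ
        (hz.mono Icc_subset_Ici_self) (memLp_toLp_iff.mpr (hmem b).1) (memLp_toLp_iff.mpr (hmem b).2)
    · rw [integral_greenRate_eq hM hx hz ht.1 (hmem t).1 (hmem t).2 hφ, hdot _ (hsp φ hφ t),
        hdot _ (hsp φ hφ 0), hz0]
      exact hgreen (fun t x => (φ t x).ofLp) ((PiLp.continuousLinearEquiv 2 ℝ
        fun _ : Fin 4 => ℝ).contDiff.comp hφ) t ht.1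
  · rintro ⟨hz, hz0, h₀, hL, hw⟩
    have hmem : ∀ t, MemLp (fun t => (h₀ t).ofLp) 2 (volume.restrict (Ioc 0 t)) ∧
        MemLp (fun t => (hL t).ofLp) 2 (volume.restrict (Ioc 0 t)) := by
      intro t
      rcases le_total 0 t with ht | ht
      · exact ⟨memLp_toLp_iff.mp (hw t ht).memLp₀, memLp_toLp_iff.mp (hw t ht).memLpL⟩
      · rw [Ioc_eq_empty (not_lt.mpr ht)]
        simp
    refine ⟨hz, hz0, fun t => (h₀ t).ofLp, fun t => (hL t).ofLp, hmem,
      ae_restrict_Ioi_iff.mpr fun b hb => ?_, fun φ hφ t ht => ?_⟩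
    · filter_upwards [(hw b hb).bc] with t ht
      exact ⟨by rw [← (hM _).bc₀_eq]; exact ht.1, ((hM _).bc_iff _ _).mp ht.2⟩
    · have hφ' : ContDiff ℝ 1 (fun q : ℝ × ℝ =>
          (WithLp.toLp 2 (φ q.1 q.2) : EuclideanSpace ℝ (Fin 4))) :=
        (PiLp.continuousLinearEquiv 2 ℝ fun _ : Fin 4 => ℝ).symm.contDiff.comp hφ
      have h := (hw t ht).green (fun t x => WithLp.toLp 2 (φ t x)) hφ' t ⟨ht, le_rfl⟩
      have h' := integral_greenRate_eq hM hx hz ht (hmem t).1 (hmem t).2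
        (φ := fun t x => WithLp.toLp 2 (φ t x)) hφ'
      rw [hdot _ (hsp (fun t x => WithLp.toLp 2 (φ t x)) hφ' t),
        hdot _ (hsp (fun t x => WithLp.toLp 2 (φ t x)) hφ' 0), hz0] at h
      exact h.trans h'

end Params

end MixedTraffic

theorem lemma1
    (p : MixedTraffic.Params)
    -- the modes: finitely many ordered values of the spacing of autonomous vehicles
    (r : ℕ) (s : Fin r → ℝ) (hs : StrictMono s) (hs_pos : ∀ i, 0 < s i)
    (hcong : ∀ i, p.Congested (s i))
    (B : Fin r → Matrix (Fin 4) (Fin 4) ℝ) (hB : ∀ i, p.Diagonalizes (s i) (B i))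
    -- the nominal feedback law
    (c : MixedTraffic.Feedback) (hs₀ : 0 < c.s₀) (hcong₀ : p.Congested c.s₀)
    (hB₀ : p.Diagonalizes c.s₀ c.B₀)
    (hK : MixedTraffic.PiecewiseContinuousOn c.K 0 p.L)
    (hbdry : ∀ i, p.BoundarySolvable c (s i) (B i))
    -- the Markov chain of modes
    {Ω : Type*} [MeasurableSpace Ω] (μ : MeasureTheory.Measure Ω)
    [MeasureTheory.IsProbabilityMeasure μ]
    (τ : Fin r → Fin r → ℝ → ℝ) (τmax : ℝ) (P : Fin r → Fin r → ℝ → ℝ → ℝ)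
    (hP : MixedTraffic.IsTransitionFamily τ τmax P)
    (X : ℝ → Ω → Fin r) (hX : MixedTraffic.IsMarkovChain μ P X)
    -- the initial condition
    (z₀ : p.State) :
    ∃ Z : ℝ → Ω → p.State,
      (∀ᵐ ω ∂μ, p.IsL2Solution c (fun t => s (X t ω)) z₀ (fun t => Z t ω)) ∧
      (∀ t : ℝ, 0 ≤ t → MeasureTheory.AEStronglyMeasurable (Z t) μ ∧ ∫⁻ ω, ‖Z t ω‖ₑ ∂μ < ⊤) ∧
      (∀ Z' : ℝ → Ω → p.State,
        (∀ᵐ ω ∂μ, p.IsL2Solution c (fun t => s (X t ω)) z₀ (fun t => Z' t ω)) →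
        ∀ᵐ ω ∂μ, ∀ t : ℝ, 0 ≤ t → Z' t ω = Z t ω) := by
  choose M hJ hS hM₀ hML hκ using fun i => p.exists_bvp (hcong i) (hB i) hK (hbdry i)
  have hM : ∀ i, p.IsClosedLoop c (s i) (M i) := fun i => ⟨hJ i, hS i, hM₀ i, hML i, hκ i⟩
  choose T hT using fun i => (M i).exists_isEvolution
  obtain ⟨Z, hZ, hmean⟩ := MixedTraffic.HyperbolicBVP.exists_process hP hX hT z₀
  have hsol : ∀ᵐ ω ∂μ, p.IsL2Solution c (fun t => s (X t ω)) z₀ (fun t => Z t ω) := by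
    filter_upwards [hX.rightCont, hX.ae_hasLeftLimits hP, hZ] with ω h1 h2 h3
    obtain ⟨hc, hw⟩ := MixedTraffic.HyperbolicBVP.exists_global_traces hT h1 h2 h3.2
    exact (MixedTraffic.Params.isL2Solution_iff hM h1).mpr ⟨hc, h3.1, hw⟩
  -- Uniqueness is pathwise: on one event of full probability both processes solve the same
  -- deterministic switched system, so they agree at all times at once.
  refine ⟨Z, hsol, hmean, fun Z' hZ' => ?_⟩
  filter_upwards [hX.rightCont, hsol, hZ'] with ω h1 h2 h3 t ht
  obtain ⟨hc, h0, _, _, hw⟩ := (MixedTraffic.Params.isL2Solution_iff hM h1).mp h2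
  obtain ⟨hc', h0', _, _, hw'⟩ := (MixedTraffic.Params.isL2Solution_iff hM h1).mp h3
  exact MixedTraffic.HyperbolicBVP.eq_of_isWeakSolutionOn_path hT h1 hc hc' hw hw'
    (h0'.trans h0.symm) ht
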